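/- Let $\mathbb T=\mathbb R/\mathbb Z$ be the flat torus, $\mathcal P(\mathbb T)$ the set of Borel probability measures on $\mathbb T$, absolutely continuous measures being identified with their densities with respect to Lebesgue measure, and let $d_2$ be the $L^2$-Wasserstein distance on $\mathcal P(\mathbb T)$; write $\mathcal W^2(\mathbb T)=(\mathcal P(\mathbb T),d_2)$. **Potential.** Let $W\in C^2([0,\infty),[0,\infty))$, let $W^{**}$ be its convex envelope on $[0,\infty)$, and put $Q'(y)=yW'(y)-W(y)$ and $Q^{**\prime}(y)=yW^{**\prime}(y)-W^{**}(y)$. Assume: 1. there is $C>0$ with $|Q'(y)|\le C(1+W(y))$ and $|W'(y)|\le C(1+W(y))$ for all $y\ge 0$; 2. $Q'(y)\to+\infty$ as $y\to+\infty$; 3. $\Sigma:=\overline{\{W>W^{**}\}\cup\{0\}}$ is a finite union of pairwise disjoint compact intervals $[a_i,b_i]$, $a_i\le b_i$; 4. $\inf_K W''>0$ for every nonempty compact $K\subset[0,\infty)\setminus\Sigma$. **Functionals.** For $\varepsilon>0$ and a probability density $\mu$ on $\mathbb T$ let $$E^\varepsilon(\mu)=\int_{\mathbb T}\frac{\varepsilon^2}{2}|\mu_x|^2+W(\mu)\,dx\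 \text{ if }\mu\in H^1(\mathbb T),\qquad E^\varepsilon(\mu)=+\infty\ \text{ otherwise.}$$ For $\mu\in H^1(\mathbb T)$ define the distribution $$G^\varepsilon(\mu)=\mu W'(\mu)-W(\mu)+\frac{3\varepsilon^2}{2}|\mu_x|^2-\varepsilon^2(\mu\mu_x)_x$$ and the set $\mathcal T^\varepsilon(\mu)=\{g\in L^2(\mathbb T): G^\varepsilon(\mu)_x=\sqrt\mu\,g\text{ in the sense of distributions}\}$. Let $\mathcal G^\varepsilon(\mu)=\inf_{g\in\mathcal T^\varepsilon(\mu)}\|g\|_{L^2(\mathbb T)}$ if $\mu\in H^1(\mathbb T)$ and $\mathcal T^\varepsilon(\mu)\neq\varnothing$, and $\mathcal G^\varepsilon(\mu)=+\infty$ otherwise. For $\mu\in\mathcal P(\mathbb T)$ let $$|\nabla E^{**}|(\mu)=\left(\int_{\mathbb T}\mu\,|(W^{**\prime}(\mu))_x|^2\,dx\right)^{1/2}$$ if $\mu$ is absolutely continuous and $Q^{**\prime}(\mu)\in W^{1,1}(\mathbb T)$, and $|\nabla E^{**}|(\mu)=+\infty$ otherwise. Here $(W^{**\prime}(\mu))_x$,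 which is needed only on $\{\mu>0\}$, is the function $w$, unique a.e. on $\{\mu>0\}$, such that for every $\delta>0$ the truncation $W^{**\prime}(\max(\mu,\delta))$ has weak derivative $w\,\mathbf 1_{\{\mu>\delta\}}\in L^1(\mathbb T)$. **Theorem.** Let $\{\rho^\varepsilon\}_{\varepsilon>0}$ be probability densities on $\mathbb T$ with $\rho^\varepsilon\in C^1(\mathbb T)\cap C^4_{loc}(\{\rho^\varepsilon>0\})$, let $\rho_0\in\mathcal P(\mathbb T)$, and suppose that $\rho^\varepsilon\to\rho_0$ in $\mathcal W^2(\mathbb T)$ as $\varepsilon\to0^+$ and that $\sup_{\varepsilon>0}E^\varepsilon(\rho^\varepsilon)<\infty$. Then $$\liminf_{\varepsilon\to0^+}\mathcal G^\varepsilon(\rho^\varepsilon)\ \ge\ |\nabla E^{**}|(\rho_0).$$ -/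

import Mathlib

open MeasureTheory Filter Topology Set
open scoped ENNReal ContDiff

namespace SlopeLiminf

noncomputable section

/-- The flat torus `𝕋 = ℝ/ℤ`, with its quotient metric and its Lebesgue probability measure
`volume`. -/
abbrev Torus : Type := UnitAddCircle

/-! ### Calculus on the torus -/

/-- The `1`-periodic function on `ℝ` given by a function on the torus. -/
def lift (f : Torus → ℝ) : ℝ → ℝ := fun t => f (t : Torus)

/-- The classical derivative of a function on the torus. -/
def tderiv (f : Torus → ℝ) : Torus → ℝ := fun x => deriv (fun t : ℝ => f (x + (t : Torus))) 0

/-- Test functions: `φ ∈ C^∞(𝕋)`. -/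
def IsTest (φ : Torus → ℝ) : Prop := ContDiff ℝ ∞ (lift φ)

/-- `v ∈ L¹(𝕋)` is the weak (distributional) derivative of `u ∈ L¹(𝕋)`. -/
def IsWeakDeriv (u v : Torus → ℝ) : Prop :=
  Integrable u ∧ Integrable v ∧
    ∀ φ : Torus → ℝ, IsTest φ → ∫ x, u x * tderiv φ x = -∫ x, v x * φ x

/-- The Sobolev space `W^{1,p}(𝕋)` for `p ≥ 1`; `H¹(𝕋)` is the case `p = 2`. -/
def MemW1 (p : ℝ≥0∞) (u : Torus → ℝ) : Prop :=
  MemLp u p ∧ ∃ v : Torus → ℝ, MemLp v p ∧ IsWeakDeriv u v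

open Classical in
/-- The weak derivative `u_x` (unique up to null sets when it exists, and `0` if it does not). -/
def weakDeriv (u : Torus → ℝ) : Torus → ℝ :=
  if h : ∃ v, IsWeakDeriv u v then h.choose else 0

/-! ### The Wasserstein distance -/

/-- The `L²`-Wasserstein distance `d₂` on the torus: the square root of the infimum of
`∫ |x - y|² dπ(x, y)` over the transference plans `π` from `μ` to `ν`. -/
def wasserstein2 (μ ν : Measure Torus) : ℝ≥0∞ :=
  (⨅ π ∈ {π : Measure (Torus × Torus) | π.map Prod.fst = μ ∧ π.map Prod.snd = ν},
    ∫⁻ z, edist z.1 z.2 ^ 2 ∂π) ^ (1 / 2 : ℝ)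

/-- The measure with density `u` with respect to the Lebesgue measure. -/
def toMeasure (u : Torus → ℝ) : Measure Torus := volume.withDensity fun x => ENNReal.ofReal (u x)

/-- The density of (the absolutely continuous part of) `μ` with respect to the Lebesgue measure. -/
def density (μ : Measure Torus) : Torus → ℝ := fun x => (μ.rnDeriv volume x).toReal

/-! ### Functions on `[0, ∞)` -/

/-- The derivative of `F : [0, ∞) → ℝ` (one-sided at `0`). -/
def dHalf (F : ℝ → ℝ) : ℝ → ℝ := derivWithin F (Ici 0)

/-- `Q'(y) = y F'(y) - F(y)`. -/
def pressure (F : ℝ → ℝ) : ℝ → ℝ := fun y => y * dHalf F y - F y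

/-- The convex envelope `W^{**}` on `[0, ∞)`: the largest convex function on `[0, ∞)` below `W`. -/
def convexEnvelope (W : ℝ → ℝ) : ℝ → ℝ := fun y =>
  sSup {r | ∃ F : ℝ → ℝ, ConvexOn ℝ (Ici 0) F ∧ (∀ z ∈ Ici (0 : ℝ), F z ≤ W z) ∧ r = F y}

/-- The unstable set `Σ = cl ({W > W^{**}} ∪ {0}) ⊆ [0, ∞)`. -/
def unstableSet (W : ℝ → ℝ) : Set ℝ :=
  closure ({y | 0 ≤ y ∧ convexEnvelope W y < W y} ∪ {0})

/-- The standing assumptions on the potential `W ∈ C²([0, ∞), [0, ∞))`. -/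
structure IsPotential (W : ℝ → ℝ) : Prop where
  contDiff : ContDiffOn ℝ 2 W (Ici 0)
  nonneg : ∀ y, 0 ≤ y → 0 ≤ W y
  growth : ∃ C : ℝ, 0 < C ∧ ∀ y, 0 ≤ y →
    |pressure W y| ≤ C * (1 + W y) ∧ |dHalf W y| ≤ C * (1 + W y)
  pressure_tendsto : Tendsto (pressure W) atTop atTop
  /-- `Σ` is a finite union of disjoint compact intervals, listed in increasing order;
  a degenerate interval `[a, a]` is allowed. -/
  unstable : ∃ (p : ℕ) (a b : Fin p → ℝ), (∀ i, a i ≤ b i) ∧ (∀ i j, i < j → b i < a j) ∧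
    unstableSet W = ⋃ i, Icc (a i) (b i)
  /-- `inf_K W'' > 0` for every compact `K ⊆ [0, ∞)` disjoint from `Σ`. -/
  convex : ∀ K : Set ℝ, IsCompact K → K ⊆ Ici 0 \ unstableSet W →
    ∃ c : ℝ, 0 < c ∧ ∀ y ∈ K, c ≤ dHalf (dHalf W) y

/-! ### The functionals

Absolutely continuous measures are identified with their densities. -/

open Classical in
/-- `E^ε[u] = ∫ (ε²/2) |u_x|² + W(u) dx` if `u ∈ H¹(𝕋)`, and `+∞` otherwise. -/
def energy (W : ℝ → ℝ) (ε : ℝ) (u : Torus → ℝ) : ℝ≥0∞ :=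
  if MemW1 2 u then ∫⁻ x, ENNReal.ofReal (ε ^ 2 / 2 * weakDeriv u x ^ 2 + W (u x)) else ⊤

/-- For `u ∈ H¹(𝕋)`, the pairing with a test function `ψ` of the distribution
`G^ε(u) = u W'(u) - W(u) + (3ε²/2) |u_x|² - ε² (u u_x)_x`. -/
def distG (W : ℝ → ℝ) (ε : ℝ) (u ψ : Torus → ℝ) : ℝ :=
  (∫ x, (u x * dHalf W (u x) - W (u x) + 3 * ε ^ 2 / 2 * weakDeriv u x ^ 2) * ψ x)
    + ε ^ 2 * ∫ x, u x * weakDeriv u x * tderiv ψ x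

/-- `𝒯^ε(u) = {g ∈ L²(𝕋) : G^ε(u)_x = √u g}`, the equation holding in the sense of distributions;
empty if `u ∉ H¹(𝕋)`. -/
def admissibleFluxes (W : ℝ → ℝ) (ε : ℝ) (u : Torus → ℝ) : Set (Torus → ℝ) :=
  {g | MemW1 2 u ∧ MemLp g 2 ∧
    ∀ φ : Torus → ℝ, IsTest φ → -distG W ε u (tderiv φ) = ∫ x, √(u x) * g x * φ x}

/-- `𝒢^ε(u) = inf {‖g‖₂ : g ∈ 𝒯^ε(u)}`, which is `+∞` if `𝒯^ε(u)` is empty. -/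
def slopeEps (W : ℝ → ℝ) (ε : ℝ) (u : Torus → ℝ) : ℝ≥0∞ :=
  ⨅ g ∈ admissibleFluxes W ε u, eLpNorm g 2 volume

/-- `w` is the derivative `(F(u))_x` on the set `{u > 0}`, where `F` is nondecreasing and `u ≥ 0`:
for every `δ > 0` the truncation `F(max(u, δ)) = max(F(u), F(δ))` is weakly differentiable, with
derivative `w` on `{u > δ}` and `0` elsewhere. This determines `w` a.e. on `{u > 0}`, and `w` is the
weak derivative of `F(u)` there whenever `F(u)` has one. -/
def IsDerivOnPos (F : ℝ → ℝ) (u w : Torus → ℝ) : Prop :=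
  ∀ δ : ℝ, 0 < δ → IsWeakDeriv (fun x => F (max (u x) δ)) ({x | δ < u x}.indicator w)

open Classical in
/-- `|∇E^{**}|(μ) = (∫ μ |(W^{**}'(μ))_x|² dx)^{1/2}` if `μ` is absolutely continuous and
`Q^{**}'(μ) ∈ W^{1,1}(𝕋)`, and `+∞` otherwise. Only the values of `(W^{**}'(μ))_x` on `{μ > 0}`
matter; all the `w` in the infimum agree there almost everywhere. -/
def slopeStar (W : ℝ → ℝ) (μ : Measure Torus) : ℝ≥0∞ :=
  if μ ≪ volume ∧ MemW1 1 (fun x => pressure (convexEnvelope W) (density μ x)) then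
    (⨅ w ∈ {w | IsDerivOnPos (dHalf (convexEnvelope W)) (density μ) w},
      ∫⁻ x, ENNReal.ofReal (density μ x * w x ^ 2)) ^ (1 / 2 : ℝ)
  else ⊤

end

end SlopeLiminf

open SlopeLiminf

/-!
Write `Q` for the pressure `Q^{**}'` of the convex envelope. The proof extracts from the densities
`u = ρ^ε` a limit `q` of the functions `Q(u)`, controls `q` by the limits of the fluxes, and shows
that `q = Q(ρ₀)`. It uses no compactness of `u` beyond boundedness.

**Structure of the envelope.** `W^{**}` is differentiable on `(0, ∞)` and affine on every component
of `{W^{**} < W}`, and `Q` is continuous and nondecreasing. The image under `Q` of the unstable set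
is a null set (`IsPotential.volume_image_unstableSet`): intervals on which `Q` is constant give
countably many values, and at the remaining interior points of the unstable set `W''` vanishes, so
that a one-dimensional Sard theorem applies.

**Fixed `ε`.** If `g` is an admissible flux, the distribution `G^ε(u)` is a continuous function `G`
with `G' = √u g`, and `u` is bounded uniformly in `ε` (`exists_profile`). Where `W` has a supporting
line at `u(x)`, the first integral of the equation `G = Q'(u) + (ε²/2) |u'|² - ε² u u''` forces
`ε u'(x)` to be small (`IsProfile.sq_deriv_le`). Therefore `G` is uniformly close to `Q(u)` wherever
`Q(u)` avoids a neighbourhood of the image of the unstable set (`IsPotential.exists_flux_close`).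
This neighbourhood can be taken of arbitrarily small measure, so by the intermediate value theorem
the increments of `Q(u)` are bounded by the oscillation of `G` up to a small error
(`ProfileFamily.pressure_sub_le`). No information on oscillations of `u` itself is needed.

**The limit.** Along an ultrafilter, `Q(u)` converges pointwise to `q`, and the primitives of `g²`
converge to a nondecreasing function `M` whose total increment is at most `L²`. The Cauchy-Schwarz
inequality for `∫ √u g` passes to the limit as `|q(t) - q(s)|² ≤ ρ₀(arc) (M(t) - M(s))`, where the
arc has end points `s` and `t` (`ProfileFamily.exists_mass_of_tendsto`). As `ρ₀` has bounded
density, `q` is absolutely continuous, and `q'² ≤ ρ₀ M'` almost everywhere. Since the convergence to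
`q` is locally uniform and `Q` is monotone, `q = Q(ρ₀)` at every Lebesgue point of `ρ₀`
(`ProfileFamily.pressure_density_eq`). Finally `(W^{**}'(ρ₀))_x = q' / ρ₀`
(`IsPotential.hasDerivAt_dHalf_max`), so that the slope of `W^{**}` satisfies
`∫ q'² / ρ₀ ≤ ∫ M' ≤ L²` (`ProfileFamily.slopeStar_le`).
-/

namespace SlopeLiminf

/-! ### The convex envelope of the potential -/

section Envelope

variable {W : ℝ → ℝ}

lemma IsPotential.continuousOn (hW : IsPotential W) : ContinuousOn W (Ici 0) :=
  hW.contDiff.continuousOn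

lemma IsPotential.continuousOn_dHalf (hW : IsPotential W) : ContinuousOn (dHalf W) (Ici 0) :=
  hW.contDiff.continuousOn_derivWithin (uniqueDiffOn_Ici 0) (by norm_num)

lemma IsPotential.continuousOn_pressure (hW : IsPotential W) :
    ContinuousOn (pressure W) (Ici 0) :=
  (continuousOn_id.mul hW.continuousOn_dHalf).sub hW.continuousOn

lemma IsPotential.hasDerivAt (hW : IsPotential W) {y : ℝ} (hy : 0 < y) :
    HasDerivAt W (dHalf W y) y :=
  ((hW.contDiff.differentiableOn (by norm_num) y hy.le).hasDerivWithinAt).hasDerivAt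
    (Ici_mem_nhds hy)

lemma IsPotential.contDiffOn_dHalf (hW : IsPotential W) : ContDiffOn ℝ 1 (dHalf W) (Ici 0) :=
  ((contDiffOn_succ_iff_derivWithin (n := 1) (uniqueDiffOn_Ici 0)).1 hW.contDiff).2.2

lemma IsPotential.hasDerivAt_dHalf (hW : IsPotential W) {y : ℝ} (hy : 0 < y) :
    HasDerivAt (dHalf W) (dHalf (dHalf W) y) y :=
  ((hW.contDiffOn_dHalf.differentiableOn (by norm_num) y hy.le).hasDerivWithinAt).hasDerivAt
    (Ici_mem_nhds hy)

lemma IsPotential.continuousOn_dHalf_dHalf (hW : IsPotential W) :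
    ContinuousOn (dHalf (dHalf W)) (Ici 0) :=
  hW.contDiffOn_dHalf.continuousOn_derivWithin (uniqueDiffOn_Ici 0) (by norm_num)

lemma IsPotential.hasDerivAt_pressure (hW : IsPotential W) {y : ℝ} (hy : 0 < y) :
    HasDerivAt (pressure W) (y * dHalf (dHalf W) y) y := by
  have h : HasDerivAt (pressure W)
      (1 * dHalf W y + y * dHalf (dHalf W) y - dHalf W y) y :=
    ((hasDerivAt_id y).mul (hW.hasDerivAt_dHalf hy)).sub (hW.hasDerivAt hy)
  exact h.congr_deriv (by ring)

lemma convexEnvelope_bddAbove {y : ℝ} (hy : 0 ≤ y) :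
    BddAbove {r | ∃ F : ℝ → ℝ, ConvexOn ℝ (Ici 0) F ∧ (∀ z ∈ Ici (0 : ℝ), F z ≤ W z) ∧ r = F y} :=
  ⟨W y, by rintro r ⟨F, -, hF, rfl⟩; exact hF y hy⟩

lemma IsPotential.le_convexEnvelope {F : ℝ → ℝ} (hF : ConvexOn ℝ (Ici 0) F)
    (hle : ∀ z, 0 ≤ z → F z ≤ W z) {y : ℝ} (hy : 0 ≤ y) : F y ≤ convexEnvelope W y :=
  le_csSup (convexEnvelope_bddAbove hy) ⟨F, hF, fun z hz => hle z hz, rfl⟩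

lemma IsPotential.le_convexEnvelope_of_affine {k b : ℝ}
    (hle : ∀ z, 0 ≤ z → k * z + b ≤ W z) {y : ℝ} (hy : 0 ≤ y) :
    k * y + b ≤ convexEnvelope W y := by
  refine IsPotential.le_convexEnvelope (F := fun z => k * z + b) ?_ hle hy
  refine ⟨convex_Ici 0, fun x _ z _ s t _ _ hst => le_of_eq ?_⟩
  simp only [smul_eq_mul]
  linear_combination (-b) * hst

lemma IsPotential.envelope_set_nonempty (hW : IsPotential W) (y : ℝ) :
    {r | ∃ F : ℝ → ℝ, ConvexOn ℝ (Ici 0) F ∧ (∀ z ∈ Ici (0 : ℝ), F z ≤ W z) ∧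
      r = F y}.Nonempty :=
  ⟨0, fun _ => 0, convexOn_const 0 (convex_Ici 0), fun z hz => hW.nonneg z hz, rfl⟩

lemma IsPotential.convexEnvelope_le (hW : IsPotential W) {y : ℝ} (hy : 0 ≤ y) :
    convexEnvelope W y ≤ W y :=
  csSup_le (hW.envelope_set_nonempty y) (by rintro r ⟨F, -, hF, rfl⟩; exact hF y hy)

lemma IsPotential.convexOn_convexEnvelope (hW : IsPotential W) :
    ConvexOn ℝ (Ici 0) (convexEnvelope W) := by
  refine ⟨convex_Ici 0, fun x hx y hy s t hs ht hst => ?_⟩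
  refine csSup_le (hW.envelope_set_nonempty _) ?_
  rintro r ⟨F, hF, hle, rfl⟩
  refine (hF.2 hx hy hs ht hst).trans ?_
  simp only [smul_eq_mul]
  have h1 := IsPotential.le_convexEnvelope hF hle hx
  have h2 := IsPotential.le_convexEnvelope hF hle hy
  gcongr

/-- A convex function on `[0, ∞)` has a supporting line at every interior point. -/
lemma exists_support_of_convexOn {F : ℝ → ℝ} (hF : ConvexOn ℝ (Ici 0) F) {y : ℝ} (hy : 0 < y) :
    ∃ k, ∀ z, 0 ≤ z → F y + k * (z - y) ≤ F z := by
  have hyi : y ∈ interior (Ici (0 : ℝ)) := by simpa using hy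
  refine ⟨derivWithin F (Ioi y) y, fun z hz => ?_⟩
  rcases lt_trichotomy z y with h | rfl | h
  · have h1 := hF.slope_le_leftDeriv_of_mem_interior hz hyi h
    have h2 := hF.leftDeriv_le_rightDeriv_of_mem_interior hyi
    have h3 := h1.trans h2
    rw [slope_def_field, div_le_iff₀ (by linarith)] at h3
    linarith
  · simp
  · have h1 := hF.rightDeriv_le_slope_of_mem_interior hyi hz h
    rw [slope_def_field, le_div_iff₀ (by linarith)] at h1
    linarith

lemma notMem_unstableSet {y : ℝ} (hy : 0 ≤ y) (hW : IsPotential W) (h : y ∉ unstableSet W) :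
    convexEnvelope W y = W y := by
  by_contra hne
  exact h (subset_closure (Or.inl ⟨hy, lt_of_le_of_ne (hW.convexEnvelope_le hy) hne⟩))

lemma zero_mem_unstableSet : (0 : ℝ) ∈ unstableSet W := subset_closure (Or.inr rfl)

lemma isClosed_unstableSet : IsClosed (unstableSet W) := isClosed_closure

lemma IsPotential.exists_stable_gt (hW : IsPotential W) (y : ℝ) :
    ∃ β, y < β ∧ 0 < β ∧ convexEnvelope W β = W β := by
  obtain ⟨p, a, b, -, -, hS⟩ := hW.unstable
  have hc : IsCompact (unstableSet W) := by
    rw [hS]; exact isCompact_iUnion fun i => isCompact_Icc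
  obtain ⟨M, hM⟩ := hc.bddAbove
  refine ⟨max (max y 0) M + 1, ?_, ?_, ?_⟩
  · linarith [le_max_left (max y 0) M, le_max_left y 0]
  · linarith [le_max_left (max y 0) M, le_max_right y 0]
  · refine notMem_unstableSet ?_ hW fun h => ?_
    · linarith [le_max_left (max y 0) M, le_max_right y 0]
    · linarith [hM h, le_max_right (max y 0) M]

lemma exists_pos_le_of_continuousOn_Icc {h : ℝ → ℝ} {a b : ℝ} (hc : ContinuousOn h (Icc a b))
    (hpos : ∀ z ∈ Icc a b, 0 < h z) : ∃ κ, 0 < κ ∧ ∀ z ∈ Icc a b, κ ≤ h z := by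
  rcases (Icc a b).eq_empty_or_nonempty with he | hne
  · exact ⟨1, one_pos, by simp [he]⟩
  · obtain ⟨x, hx, hmin⟩ := isCompact_Icc.exists_isMinOn hne hc
    exact ⟨h x, hpos x hx, fun z hz => hmin hz⟩

/-- To the right of a point where `W^{**} < W`, the supporting line of `W^{**}` touches `W`: else
it could be tilted upwards about a point slightly to the left of `y`. At infinity the tilted line
stays below `W` because `W` lies above a supporting line of larger slope, taken at a stable point
`β > y`. -/
lemma IsPotential.exists_contact_gt (hW : IsPotential W) {y k : ℝ} (hy : 0 < y)
    (hlt : convexEnvelope W y < W y)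
    (hk : ∀ z, 0 ≤ z → convexEnvelope W y + k * (z - y) ≤ convexEnvelope W z) :
    ∃ β, y < β ∧ W β = convexEnvelope W y + k * (β - y) := by
  by_contra hcon
  push Not at hcon
  set F := convexEnvelope W with hF
  have hmW : ∀ z, 0 ≤ z → F y + k * (z - y) ≤ W z := fun z hz =>
    (hk z hz).trans (hW.convexEnvelope_le hz)
  obtain ⟨β, hyβ, hβ0, hβ⟩ := hW.exists_stable_gt y
  rw [← hF] at hβ
  obtain ⟨k₀, hk₀⟩ := exists_support_of_convexOn hW.convexOn_convexEnvelope hβ0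
  rw [← hF] at hk₀
  have hβm : F y + k * (β - y) < F β := by
    rw [hβ]; exact lt_of_le_of_ne (hmW β hβ0.le) (hcon β hyβ).symm
  have hkk : k < k₀ := by
    have h1 := hk₀ y hy.le
    by_contra hc
    nlinarith
  have hcont : ContinuousOn (fun z => W z - (F y + k * (z - y))) (Ici 0) :=
    hW.continuousOn.sub (by fun_prop)
  obtain ⟨h, hh0, hhy, hpos⟩ : ∃ h, 0 < h ∧ h < y ∧
      ∀ z ∈ Icc (y - h) y, 0 < W z - (F y + k * (z - y)) := by
    have h1 : ∀ᶠ z in 𝓝 y, 0 < W z - (F y + k * (z - y)) := by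
      refine (hcont.continuousAt (Ici_mem_nhds hy)).eventually (lt_mem_nhds ?_)
      simp; linarith
    obtain ⟨r, hr, hball⟩ := Metric.eventually_nhds_iff.1 h1
    refine ⟨min (r / 2) (y / 2), by positivity, by
      linarith [min_le_right (r / 2) (y / 2)], fun z hz => hball ?_⟩
    rw [Real.dist_eq, abs_lt]
    constructor <;> linarith [hz.1, hz.2, min_le_left (r / 2) (y / 2)]
  obtain ⟨κ, hκ, hκle⟩ := exists_pos_le_of_continuousOn_Icc
    (h := fun z => W z - (F y + k * (z - y))) (a := y - h) (b := β)
    (hcont.mono fun z hz => by have := hz.1; simp only [mem_Ici]; linarith)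
    (fun z hz => by
      rcases le_or_gt z y with hzy | hzy
      · exact hpos z ⟨hz.1, hzy⟩
      · have hz0 : 0 ≤ z := by linarith
        exact sub_pos.2 (lt_of_le_of_ne (hmW z hz0) (hcon z hzy).symm))
  obtain ⟨t, ht, ht1, ht2⟩ : ∃ t, 0 < t ∧ t * (β - (y - h)) ≤ κ ∧ t ≤ k₀ - k := by
    have hL : 0 < β - (y - h) := by linarith
    refine ⟨min (κ / (β - (y - h))) (k₀ - k), lt_min (by positivity) (by linarith), ?_,
      min_le_right _ _⟩
    rw [← le_div_iff₀ hL]; exact min_le_left _ _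
  -- the line of slope `k + t` that meets the supporting line at `y - h`
  have key : (k + t) * y + (F y - k * y - t * (y - h)) ≤ F y := by
    refine IsPotential.le_convexEnvelope_of_affine (fun z hz => ?_) hy.le
    rcases le_or_gt z (y - h) with h1 | h1
    · have := hmW z hz
      nlinarith
    · rcases le_or_gt z β with h2 | h2
      · have := hκle z ⟨h1.le, h2⟩
        nlinarith
      · have h3 := hk₀ z hz
        have h4 := hW.convexEnvelope_le hz
        have h5 := hκle β ⟨by linarith, le_rfl⟩
        have h6 : t * (z - β) ≤ (k₀ - k) * (z - β) :=
          mul_le_mul_of_nonneg_right ht2 (by linarith)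
        nlinarith
  nlinarith

/-- The counterpart of `exists_contact_gt` on the left; here the tilting needs no control at
infinity. -/
lemma IsPotential.exists_contact_lt (hW : IsPotential W) {y k : ℝ} (hy : 0 < y)
    (hlt : convexEnvelope W y < W y)
    (hk : ∀ z, 0 ≤ z → convexEnvelope W y + k * (z - y) ≤ convexEnvelope W z) :
    ∃ α, 0 ≤ α ∧ α < y ∧ W α = convexEnvelope W y + k * (α - y) := by
  by_contra hcon
  push Not at hcon
  set F := convexEnvelope W with hF
  have hmW : ∀ z, 0 ≤ z → F y + k * (z - y) ≤ W z := fun z hz =>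
    (hk z hz).trans (hW.convexEnvelope_le hz)
  have hcont : ContinuousOn (fun z => W z - (F y + k * (z - y))) (Ici 0) :=
    hW.continuousOn.sub (by fun_prop)
  obtain ⟨h, hh0, hpos⟩ : ∃ h, 0 < h ∧
      ∀ z ∈ Icc y (y + h), 0 < W z - (F y + k * (z - y)) := by
    have h1 : ∀ᶠ z in 𝓝 y, 0 < W z - (F y + k * (z - y)) := by
      refine (hcont.continuousAt (Ici_mem_nhds hy)).eventually (lt_mem_nhds ?_)
      simp; linarith
    obtain ⟨r, hr, hball⟩ := Metric.eventually_nhds_iff.1 h1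
    refine ⟨r / 2, by positivity, fun z hz => hball ?_⟩
    rw [Real.dist_eq, abs_lt]
    constructor <;> linarith [hz.1, hz.2]
  obtain ⟨κ, hκ, hκle⟩ := exists_pos_le_of_continuousOn_Icc
    (h := fun z => W z - (F y + k * (z - y))) (a := 0) (b := y + h)
    (hcont.mono fun z hz => hz.1)
    (fun z hz => by
      rcases le_or_gt y z with hzy | hzy
      · exact hpos z ⟨hzy, hz.2⟩
      · exact sub_pos.2 (lt_of_le_of_ne (hmW z hz.1) (hcon z hz.1 hzy).symm))
  have hL : 0 < y + h := by linarith
  obtain ⟨t, ht, ht1⟩ : ∃ t, 0 < t ∧ t * (y + h) ≤ κ :=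
    ⟨κ / (y + h), by positivity, by field_simp; rfl⟩
  have key : (k - t) * y + (F y - k * y + t * (y + h)) ≤ F y := by
    refine IsPotential.le_convexEnvelope_of_affine (fun z hz => ?_) hy.le
    rcases le_or_gt z (y + h) with h1 | h1
    · have := hκle z ⟨hz, h1⟩
      nlinarith
    · have := hmW z hz
      nlinarith
  nlinarith

/-- Every point where `W^{**} < W` lies inside an interval on which `W^{**}` is affine and at whose
ends `W^{**} = W`. -/
lemma IsPotential.exists_affine_interval (hW : IsPotential W) {y : ℝ} (hy : 0 < y)
    (hlt : convexEnvelope W y < W y) :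
    ∃ α β k, 0 ≤ α ∧ α < y ∧ y < β ∧ convexEnvelope W α = W α ∧ convexEnvelope W β = W β ∧
      ∀ z ∈ Icc α β, convexEnvelope W z = convexEnvelope W y + k * (z - y) := by
  obtain ⟨k, hk⟩ := exists_support_of_convexOn hW.convexOn_convexEnvelope hy
  obtain ⟨α, hα0, hαy, hα⟩ := hW.exists_contact_lt hy hlt hk
  obtain ⟨β, hyβ, hβ⟩ := hW.exists_contact_gt hy hlt hk
  have hβ0 : 0 ≤ β := by linarith
  have hα' : convexEnvelope W α = W α :=
    le_antisymm (hW.convexEnvelope_le hα0) (by rw [hα]; exact hk α hα0)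
  have hβ' : convexEnvelope W β = W β :=
    le_antisymm (hW.convexEnvelope_le hβ0) (by rw [hβ]; exact hk β hβ0)
  refine ⟨α, β, k, hα0, hαy, hyβ, hα', hβ', fun z hz => ?_⟩
  refine le_antisymm ?_ (hk z (hα0.trans hz.1))
  have hαβ : 0 < β - α := by linarith
  have hw1 : 0 ≤ (β - z) / (β - α) := div_nonneg (by linarith [hz.2]) hαβ.le
  have hw2 : 0 ≤ (z - α) / (β - α) := div_nonneg (by linarith [hz.1]) hαβ.le
  have hconv := hW.convexOn_convexEnvelope.2 (mem_Ici.2 hα0) (mem_Ici.2 hβ0) hw1 hw2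
    (by field_simp; ring)
  simp only [smul_eq_mul] at hconv
  rw [hα', hβ', hα, hβ] at hconv
  have e1 : (β - z) / (β - α) * α + (z - α) / (β - α) * β = z := by field_simp; ring
  rw [e1] at hconv
  refine hconv.trans (le_of_eq ?_)
  field_simp
  ring

/-- At a point of contact, `W^{**}` is squeezed between a line and `W`. -/
lemma IsPotential.hasDerivAt_envelope_of_contact (hW : IsPotential W) {y : ℝ} (hy : 0 < y)
    (h : convexEnvelope W y = W y) : HasDerivAt (convexEnvelope W) (dHalf W y) y := by
  obtain ⟨k, hk⟩ := exists_support_of_convexOn hW.convexOn_convexEnvelope hy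
  have hd : HasDerivAt (fun z => W z - (W y + k * (z - y))) (dHalf W y - k) y := by
    have := (hW.hasDerivAt hy).sub
      (((hasDerivAt_id y).sub_const y).const_mul k |>.const_add (W y))
    exact this.congr_deriv (by ring)
  have hmin : IsLocalMin (fun z => W z - (W y + k * (z - y))) y := by
    filter_upwards [Ici_mem_nhds hy] with z hz
    have h1 := hk z hz
    have h2 := hW.convexEnvelope_le hz
    rw [h] at h1
    simp only [sub_self, mul_zero, add_zero]
    linarith
  have h0 := hmin.hasDerivAt_eq_zero hd
  have hkW : dHalf W y = k := by linarith
  rw [h0] at hd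
  rw [hasDerivAt_iff_isLittleO] at hd ⊢
  refine (Asymptotics.IsBigO.of_bound 1 ?_).trans_isLittleO hd
  filter_upwards [Ici_mem_nhds hy] with z hz
  have h1 := hk z hz
  have h2 := hW.convexEnvelope_le hz
  rw [h] at h1
  simp only [smul_eq_mul, h, hkW, sub_self, mul_zero, add_zero, sub_zero, one_mul, Real.norm_eq_abs]
  rw [abs_of_nonneg (by linarith), abs_of_nonneg (by linarith)]
  linarith

lemma dHalf_eq_of_hasDerivAt {F : ℝ → ℝ} {k y : ℝ} (hy : 0 < y) (h : HasDerivAt F k y) :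
    dHalf F y = k :=
  h.hasDerivWithinAt.derivWithin (uniqueDiffOn_Ici 0 y hy.le)

lemma hasDerivAt_of_affine {F : ℝ → ℝ} {α β k y c z : ℝ}
    (h : ∀ z ∈ Icc α β, F z = c + k * (z - y)) (hz : z ∈ Ioo α β) : HasDerivAt F k z := by
  have h1 : HasDerivAt (fun z => c + k * (z - y)) k z := by
    simpa using ((hasDerivAt_id z).sub_const y).const_mul k |>.const_add c
  refine h1.congr_of_eventuallyEq ?_
  filter_upwards [Ioo_mem_nhds hz.1 hz.2] with w hw
  exact h w ⟨hw.1.le, hw.2.le⟩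

lemma IsPotential.hasDerivAt_envelope (hW : IsPotential W) {y : ℝ} (hy : 0 < y) :
    HasDerivAt (convexEnvelope W) (dHalf (convexEnvelope W) y) y := by
  have : ∃ k, HasDerivAt (convexEnvelope W) k y := by
    rcases (hW.convexEnvelope_le hy.le).eq_or_lt with h | h
    · exact ⟨_, hW.hasDerivAt_envelope_of_contact hy h⟩
    · obtain ⟨α, β, k, -, hα, hβ, -, -, haff⟩ := hW.exists_affine_interval hy h
      exact ⟨k, hasDerivAt_of_affine haff ⟨hα, hβ⟩⟩
  obtain ⟨k, hk⟩ := this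
  rwa [dHalf_eq_of_hasDerivAt hy hk]

lemma IsPotential.dHalf_envelope_of_contact (hW : IsPotential W) {y : ℝ} (hy : 0 < y)
    (h : convexEnvelope W y = W y) : dHalf (convexEnvelope W) y = dHalf W y :=
  dHalf_eq_of_hasDerivAt hy (hW.hasDerivAt_envelope_of_contact hy h)

lemma IsPotential.pressure_envelope_of_contact (hW : IsPotential W) {y : ℝ} (hy : 0 < y)
    (h : convexEnvelope W y = W y) : pressure (convexEnvelope W) y = pressure W y := by
  simp only [pressure, hW.dHalf_envelope_of_contact hy h, h]

lemma IsPotential.envelope_support (hW : IsPotential W) {y z : ℝ} (hy : 0 < y) (hz : 0 ≤ z) :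
    convexEnvelope W y + dHalf (convexEnvelope W) y * (z - y) ≤ convexEnvelope W z := by
  obtain ⟨k, hk⟩ := exists_support_of_convexOn hW.convexOn_convexEnvelope hy
  have hd : HasDerivAt (fun z => convexEnvelope W z - (convexEnvelope W y + k * (z - y)))
      (dHalf (convexEnvelope W) y - k) y := by
    have := (hW.hasDerivAt_envelope hy).sub
      (((hasDerivAt_id y).sub_const y).const_mul k |>.const_add (convexEnvelope W y))
    exact this.congr_deriv (by ring)
  have hmin : IsLocalMin (fun z => convexEnvelope W z - (convexEnvelope W y + k * (z - y))) y := by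
    filter_upwards [Ici_mem_nhds hy] with z hz
    have h1 := hk z hz
    simp only [sub_self, mul_zero, add_zero]
    linarith
  have h0 := hmin.hasDerivAt_eq_zero hd
  have : dHalf (convexEnvelope W) y = k := by linarith
  rw [this]; exact hk z hz

lemma IsPotential.dHalf_envelope_mono (hW : IsPotential W) {y z : ℝ} (hy : 0 < y) (hyz : y ≤ z) :
    dHalf (convexEnvelope W) y ≤ dHalf (convexEnvelope W) z := by
  rcases hyz.eq_or_lt with rfl | h
  · rfl
  have h1 := hW.envelope_support hy (z := z) (by linarith)
  have h2 := hW.envelope_support (y := z) (by linarith) (z := y) hy.le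
  by_contra hc
  nlinarith

/-- `dQ^{**}' = y dW^{**}'`, in integrated form. -/
lemma IsPotential.pressure_envelope_sub_ge (hW : IsPotential W) {y z : ℝ} (hy : 0 < y)
    (hz : 0 < z) :
    y * (dHalf (convexEnvelope W) z - dHalf (convexEnvelope W) y) ≤
      pressure (convexEnvelope W) z - pressure (convexEnvelope W) y := by
  have h1 := hW.envelope_support hz hy.le
  simp only [pressure]
  linarith

lemma IsPotential.pressure_envelope_sub_le (hW : IsPotential W) {y z : ℝ} (hy : 0 < y)
    (hz : 0 < z) :
    pressure (convexEnvelope W) z - pressure (convexEnvelope W) y ≤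
      z * (dHalf (convexEnvelope W) z - dHalf (convexEnvelope W) y) := by
  have h1 := hW.envelope_support hy hz.le
  simp only [pressure]
  linarith

lemma IsPotential.pressure_envelope_zero_le (hW : IsPotential W) {y : ℝ} (hy : 0 < y) :
    pressure (convexEnvelope W) 0 ≤ pressure (convexEnvelope W) y := by
  have h1 := hW.envelope_support hy le_rfl
  simp only [pressure]
  linarith

lemma IsPotential.monotoneOn_pressure_envelope (hW : IsPotential W) :
    MonotoneOn (pressure (convexEnvelope W)) (Ici 0) := by
  intro y hy z hz hyz
  rcases (mem_Ici.1 hy).eq_or_lt with rfl | hy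
  · rcases (mem_Ici.1 hz).eq_or_lt with rfl | hz
    · rfl
    · exact hW.pressure_envelope_zero_le hz
  · have h1 := hW.pressure_envelope_sub_ge hy (hy.trans_le hyz)
    have h2 := hW.dHalf_envelope_mono hy hyz
    nlinarith

lemma IsPotential.continuousAt_dHalf_envelope (hW : IsPotential W) {y : ℝ} (hy : 0 < y) :
    ContinuousAt (dHalf (convexEnvelope W)) y := by
  set F := convexEnvelope W with hF
  have hFy := hW.hasDerivAt_envelope hy
  rw [← hF] at hFy
  have hFc : ContinuousAt F y := hFy.continuousAt
  have hs := hasDerivAt_iff_tendsto_slope.1 hFy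
  rw [Metric.continuousAt_iff']
  intro η hη
  have hs' : ∀ᶠ w in 𝓝[≠] y, dist (slope F y w) (dHalf F y) < η :=
    (Metric.tendsto_nhds.1 hs) η hη
  -- a chord to the right of `y` with slope close to `W^{**}'(y)`, and one to the left
  have hr : ∃ w, y < w ∧ dist (slope F y w) (dHalf F y) < η := by
    have : ∀ᶠ w in 𝓝[>] y, dist (slope F y w) (dHalf F y) < η :=
      hs'.filter_mono (nhdsWithin_mono _ fun x hx => ne_of_gt hx)
    obtain ⟨w, hw1, hw2⟩ := (this.and self_mem_nhdsWithin).exists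
    exact ⟨w, hw2, hw1⟩
  have hl : ∃ w, 0 < w ∧ w < y ∧ dist (slope F y w) (dHalf F y) < η := by
    have : ∀ᶠ w in 𝓝[<] y, dist (slope F y w) (dHalf F y) < η :=
      hs'.filter_mono (nhdsWithin_mono _ fun x hx => ne_of_lt hx)
    obtain ⟨w, ⟨hw1, hw2⟩, hw3⟩ := ((this.and self_mem_nhdsWithin).and
      (mem_nhdsWithin_of_mem_nhds (Ioi_mem_nhds hy))).exists
    exact ⟨w, hw3, hw2, hw1⟩
  obtain ⟨w, hyw, hw⟩ := hr
  obtain ⟨v, hv0, hvy, hv⟩ := hl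
  rw [Real.dist_eq, abs_lt] at hw hv
  have htr : Tendsto (fun z => slope F z w) (𝓝 y) (𝓝 (slope F y w)) := by
    simp only [slope_def_field]
    exact (tendsto_const_nhds.sub hFc).div (tendsto_const_nhds.sub tendsto_id)
      (by linarith)
  have htl : Tendsto (fun z => slope F z v) (𝓝 y) (𝓝 (slope F y v)) := by
    simp only [slope_def_field]
    exact (tendsto_const_nhds.sub hFc).div (tendsto_const_nhds.sub tendsto_id)
      (by linarith)
  filter_upwards [htr.eventually (gt_mem_nhds (show slope F y w < dHalf F y + η by linarith)),
    htl.eventually (lt_mem_nhds (show dHalf F y - η < slope F y v by linarith)),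
    Ioo_mem_nhds hvy hyw] with z hz1 hz2 hz3
  have hz0 : 0 < z := hv0.trans hz3.1
  have s1 := hW.envelope_support hz0 (z := w) (by linarith)
  have s2 := hW.envelope_support hz0 (z := v) hv0.le
  rw [← hF] at s1 s2
  have e1 : dHalf F z ≤ slope F z w := by
    rw [slope_def_field, le_div_iff₀ (by linarith [hz3.2])]; linarith
  have e2 : slope F z v ≤ dHalf F z := by
    rw [slope_def_field, div_le_iff_of_neg (by linarith [hz3.1])]; linarith
  rw [Real.dist_eq, abs_lt]
  constructor <;> linarith

/-- `W^{**}` is right continuous at `0`. A convex function can only jump upwards as it reaches the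
boundary point; this is excluded by steep lines below `W` with value close to `W(0)` at `0`. -/
lemma IsPotential.tendsto_envelope_zero (hW : IsPotential W) :
    Tendsto (convexEnvelope W) (𝓝[>] 0) (𝓝 (convexEnvelope W 0)) := by
  set F := convexEnvelope W with hF
  refine tendsto_order.2 ⟨fun a ha => ?_, fun a ha => ?_⟩
  · have hFW : F 0 ≤ W 0 := hW.convexEnvelope_le le_rfl
    set η := (F 0 - a) / 2 with hη
    have hη0 : 0 < η := by rw [hη]; linarith
    have hnear : ∀ᶠ z in 𝓝[≥] 0, W 0 - η < W z :=
      (hW.continuousOn 0 self_mem_Ici).eventually (lt_mem_nhds (by linarith))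
    obtain ⟨r, hr, hball⟩ := mem_nhdsGE_iff_exists_Icc_subset.1 hnear
    have hr0 : 0 < r := hr
    have hW0 := hW.nonneg 0 le_rfl
    have hline : ∀ z, 0 ≤ z → -(W 0 / r) * z + (W 0 - η) ≤ W z := by
      intro z hz
      rcases le_or_gt z r with hzr | hzr
      · have h1 : W 0 - η < W z := hball ⟨hz, hzr⟩
        have h2 : 0 ≤ W 0 / r * z := by positivity
        linarith
      · have h1 : W 0 ≤ W 0 / r * z := by
          rw [div_mul_eq_mul_div, le_div_iff₀ hr0]; nlinarith
        have := hW.nonneg z hz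
        linarith
    have hlim : Tendsto (fun z => -(W 0 / r) * z + (W 0 - η)) (𝓝[>] 0)
        (𝓝 (-(W 0 / r) * 0 + (W 0 - η))) :=
      (Continuous.tendsto (by fun_prop) 0).mono_left nhdsWithin_le_nhds
    filter_upwards [hlim.eventually (lt_mem_nhds (show a < _ by rw [hη]; linarith)),
      self_mem_nhdsWithin] with z hz hz0
    exact hz.trans_le (IsPotential.le_convexEnvelope_of_affine hline (le_of_lt hz0))
  · have hlim : Tendsto (fun z => (1 - z) * F 0 + z * F 1) (𝓝[>] 0)
        (𝓝 ((1 - 0) * F 0 + 0 * F 1)) :=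
      (Continuous.tendsto (by fun_prop) 0).mono_left nhdsWithin_le_nhds
    filter_upwards [hlim.eventually (gt_mem_nhds (show _ < a by linarith)),
      Ioo_mem_nhdsGT one_pos] with z hz hz1
    refine lt_of_le_of_lt ?_ hz
    have hz2 : 0 ≤ 1 - z := by linarith [hz1.2]
    have := hW.convexOn_convexEnvelope.2 (self_mem_Ici : (0 : ℝ) ∈ Ici 0)
      (mem_Ici.2 zero_le_one) hz2 hz1.1.le (by ring)
    simpa using this

lemma IsPotential.continuousOn_pressure_envelope (hW : IsPotential W) :
    ContinuousOn (pressure (convexEnvelope W)) (Ici 0) := by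
  intro y hy
  rcases (mem_Ici.1 hy).eq_or_lt with rfl | hy
  · rw [← continuousWithinAt_Ioi_iff_Ici]
    set F := convexEnvelope W with hF
    have hF0 := hW.tendsto_envelope_zero
    rw [← hF] at hF0
    have hup : Tendsto (fun z => z * dHalf F 1) (𝓝[>] 0) (𝓝 0) := by
      have : Tendsto (fun z => z * dHalf F 1) (𝓝[>] 0) (𝓝 (0 * dHalf F 1)) :=
        (Continuous.tendsto (by fun_prop) 0).mono_left nhdsWithin_le_nhds
      simpa using this
    have hlo : Tendsto (fun z => F z - F 0) (𝓝[>] 0) (𝓝 0) := by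
      simpa using hF0.sub_const (F 0)
    have hm : Tendsto (fun z => z * dHalf F z) (𝓝[>] 0) (𝓝 0) := by
      refine tendsto_of_tendsto_of_tendsto_of_le_of_le' hlo hup ?_ ?_
      · filter_upwards [self_mem_nhdsWithin] with z hz
        have := hW.envelope_support (y := z) hz le_rfl
        rw [← hF] at this
        linarith
      · filter_upwards [Ioo_mem_nhdsGT one_pos] with z hz
        have := hW.dHalf_envelope_mono hz.1 hz.2.le
        rw [← hF] at this
        nlinarith [hz.1]
    have := hm.sub hF0
    have h0 : pressure F 0 = 0 - F 0 := by simp [pressure]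
    rw [ContinuousWithinAt, h0]
    exact this
  · exact ((continuousAt_id.mul (hW.continuousAt_dHalf_envelope hy)).sub
      (hW.hasDerivAt_envelope hy).continuousAt).continuousWithinAt

/-- The set of values that `Q^{**}'` takes more than once. -/
def flatValues (W : ℝ → ℝ) : Set ℝ :=
  {c | ∃ x y, x ∈ Ici (0 : ℝ) ∧ y ∈ Ici (0 : ℝ) ∧ x < y ∧ pressure (convexEnvelope W) x = c ∧
    pressure (convexEnvelope W) y = c}

lemma IsPotential.countable_flatValues (hW : IsPotential W) : (flatValues W).Countable :=
  hW.monotoneOn_pressure_envelope.countable_setOfPred_two_preimages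

lemma IsPotential.pressure_envelope_eq (hW : IsPotential W) {y z : ℝ} (hy : 0 < y)
    (hz : 0 < z) (h : dHalf (convexEnvelope W) y = dHalf (convexEnvelope W) z) :
    pressure (convexEnvelope W) y = pressure (convexEnvelope W) z := by
  have h1 := hW.pressure_envelope_sub_ge hy hz
  have h2 := hW.pressure_envelope_sub_le hy hz
  rw [h, sub_self, mul_zero] at h1 h2
  linarith

/-- At an accumulation point `y` of `{W^{**} < W}` from the right, `W''` vanishes if `Q^{**}'` takes
the value `Q^{**}'(y)` only once: otherwise `W'` would be injective near `y`, while it takes equal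
values at the ends of every interval on which `W^{**}` is affine. -/
lemma IsPotential.dHalf_dHalf_eq_zero (hW : IsPotential W) {y : ℝ} (hy : 0 < y)
    (hflat : pressure (convexEnvelope W) y ∉ flatValues W)
    (hacc : ∀ r, 0 < r → ∃ z ∈ Ioo y (y + r), convexEnvelope W z < W z) :
    dHalf (dHalf W) y = 0 := by
  by_contra hne
  have hnear : ∀ᶠ z in 𝓝 y, dHalf (dHalf W) z ≠ 0 :=
    (hW.continuousOn_dHalf_dHalf.continuousAt (Ici_mem_nhds hy)).eventually_ne hne
  obtain ⟨r, hr, hball⟩ := Metric.eventually_nhds_iff.1 hnear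
  have hinj : ∀ s t, y < s → s < t → t < y + r → dHalf W s ≠ dHalf W t := by
    intro s t hs hst ht heq
    obtain ⟨c, hc, hc0⟩ := exists_hasDerivAt_eq_zero (f := dHalf W) (f' := dHalf (dHalf W)) hst
      (hW.continuousOn_dHalf.mono fun z hz => (hy.trans (hs.trans_le hz.1)).le) heq
      (fun z hz => hW.hasDerivAt_dHalf (hy.trans (hs.trans hz.1)))
    refine hball ?_ hc0
    rw [Real.dist_eq, abs_lt]
    constructor <;> linarith [hc.1, hc.2]
  have hgap : ∀ z, y < z → convexEnvelope W z < W z → ∃ α β k, y < α ∧ α < z ∧ z < β ∧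
      convexEnvelope W α = W α ∧ convexEnvelope W β = W β ∧ dHalf (convexEnvelope W) z = k ∧
      (∀ w ∈ Ioo α β, dHalf (convexEnvelope W) w = k) ∧ dHalf (convexEnvelope W) α = k ∧
      dHalf (convexEnvelope W) β = k := by
    intro z hz hlt
    have hz0 := hy.trans hz
    obtain ⟨α, β, k, hα0, hαz, hzβ, hα, hβ, haff⟩ := hW.exists_affine_interval hz0 hlt
    have hin : ∀ w ∈ Ioo α β, dHalf (convexEnvelope W) w = k := fun w hw =>
      dHalf_eq_of_hasDerivAt (hα0.trans_lt hw.1) (hasDerivAt_of_affine haff hw)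
    have hyα : y < α := by
      by_contra hc
      push Not at hc
      -- `Q^{**}'` is constant on `(α, β)`, hence also at `y ∈ [α, z]` by continuity
      have hconst : ∀ w ∈ Ioo α β, pressure (convexEnvelope W) w =
          pressure (convexEnvelope W) z := fun w hw =>
        hW.pressure_envelope_eq (hα0.trans_lt hw.1) hz0 (by rw [hin w hw, hin z ⟨hαz, hzβ⟩])
      have hlim : Tendsto (pressure (convexEnvelope W)) (𝓝[>] y)
          (𝓝 (pressure (convexEnvelope W) y)) :=
        (hW.continuousOn_pressure_envelope y hy.le).mono_left
          (nhdsWithin_mono _ fun w (hw : y < w) => (hy.trans hw).le)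
      have hlim2 : Tendsto (pressure (convexEnvelope W)) (𝓝[>] y)
          (𝓝 (pressure (convexEnvelope W) z)) := by
        refine tendsto_const_nhds.congr' ?_
        filter_upwards [Ioo_mem_nhdsGT (hz.trans hzβ)] with w hw
        exact (hconst w ⟨hc.trans_lt hw.1, hw.2⟩).symm
      have := tendsto_nhds_unique hlim hlim2
      exact hflat ⟨y, z, hy.le, hz0.le, hz, rfl, this.symm⟩
    have hα0' : 0 < α := hy.trans hyα
    have hβ0 : 0 < β := hz0.trans hzβ
    have hend : ∀ e, 0 < e → e ∈ closure (Ioo α β) → dHalf (convexEnvelope W) e = k := by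
      intro e he hcl
      have hcl' : (𝓝[Ioo α β] e).NeBot := mem_closure_iff_nhdsWithin_neBot.1 hcl
      refine tendsto_nhds_unique ((hW.continuousAt_dHalf_envelope he).mono_left
        (nhdsWithin_le_nhds (s := Ioo α β))) (tendsto_const_nhds.congr' ?_)
      filter_upwards [self_mem_nhdsWithin] with w hw
      exact (hin w hw).symm
    have hcl : closure (Ioo α β) = Icc α β := closure_Ioo (by linarith)
    have hαβ : α ≤ β := by linarith
    exact ⟨α, β, k, hyα, hαz, hzβ, hα, hβ, hin z ⟨hαz, hzβ⟩, hin,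
      hend α hα0' (by rw [hcl]; exact left_mem_Icc.2 hαβ),
      hend β hβ0 (by rw [hcl]; exact right_mem_Icc.2 hαβ)⟩
  -- two intervals on which `W^{**}` is affine, the second one closer to `y`
  obtain ⟨z₁, hz₁, hlt₁⟩ := hacc r hr
  obtain ⟨α₁, β₁, k₁, hyα₁, hαz₁, hzβ₁, hα₁, -, -, -, hkα₁, -⟩ := hgap z₁ hz₁.1 hlt₁
  obtain ⟨z₂, hz₂, hlt₂⟩ := hacc (α₁ - y) (by linarith)
  obtain ⟨α₂, β₂, k₂, hyα₂, hαz₂, hzβ₂, hα₂, hβ₂, -, hin₂, hkα₂, hkβ₂⟩ := hgap z₂ hz₂.1 hlt₂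
  have hz₂α₁ : z₂ < α₁ := by linarith [hz₂.2]
  have hα₁r : α₁ < y + r := by linarith [hz₁.2]
  rcases lt_or_ge β₂ α₁ with h | h
  · refine hinj α₂ β₂ hyα₂ (hαz₂.trans hzβ₂) (h.trans hα₁r) ?_
    rw [← hW.dHalf_envelope_of_contact (hy.trans hyα₂) hα₂,
      ← hW.dHalf_envelope_of_contact (by linarith) hβ₂, hkα₂, hkβ₂]
  · refine hinj α₂ α₁ hyα₂ (hαz₂.trans hz₂α₁) hα₁r ?_
    rw [← hW.dHalf_envelope_of_contact (hy.trans hyα₂) hα₂,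
      ← hW.dHalf_envelope_of_contact (hy.trans hyα₁) hα₁, hkα₂]
    rcases h.eq_or_lt with h | h
    · rw [h, hkβ₂]
    · rw [hin₂ α₁ ⟨hαz₂.trans hz₂α₁, h⟩]

/-- `Q^{**}'` maps the unstable set to a null set: up to countably many values, the image consists
of critical values of `Q'`. -/
lemma IsPotential.volume_image_unstableSet (hW : IsPotential W) :
    volume (pressure (convexEnvelope W) '' unstableSet W) = 0 := by
  obtain ⟨p, a, b, hab, -, hS⟩ := hW.unstable
  set Q := pressure (convexEnvelope W) with hQ
  set crit : Set ℝ := {y | 0 < y ∧ dHalf (dHalf W) y = 0} with hcrit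
  have hsub : Q '' unstableSet W ⊆
      flatValues W ∪ ({Q 0} ∪ (range (Q ∘ a) ∪ range (Q ∘ b))) ∪ pressure W '' crit := by
    rintro _ ⟨y, hy, rfl⟩
    by_cases hfl : Q y ∈ flatValues W
    · exact Or.inl (Or.inl hfl)
    have hy0 : 0 ≤ y := by
      have : unstableSet W ⊆ Ici 0 := by
        refine closure_minimal ?_ isClosed_Ici
        rintro z (hz | rfl)
        exacts [hz.1, self_mem_Ici]
      exact this hy
    rcases hy0.eq_or_lt with rfl | hy0
    · exact Or.inl (Or.inr (Or.inl rfl))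
    obtain ⟨i, hi⟩ := mem_iUnion.1 (hS ▸ hy)
    rcases hi.1.eq_or_lt with h1 | h1
    · exact Or.inl (Or.inr (Or.inr (Or.inl ⟨i, by simp [h1]⟩)))
    rcases hi.2.eq_or_lt with h2 | h2
    · exact Or.inl (Or.inr (Or.inr (Or.inr ⟨i, by simp [h2]⟩)))
    right
    have hacc : ∀ r, 0 < r → ∃ z ∈ Ioo y (y + r), convexEnvelope W z < W z := by
      intro r hr
      obtain ⟨x, hx1, hx2⟩ := exists_between (lt_min h2 (show y < y + r by linarith))
      have hxS : x ∈ unstableSet W := by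
        rw [hS]
        exact mem_iUnion.2 ⟨i, (h1.trans hx1).le, (hx2.trans_le (min_le_left _ _)).le⟩
      obtain ⟨z, hz1, hz2⟩ := mem_closure_iff.1 hxS (Ioo y (y + r)) isOpen_Ioo
        ⟨hx1, hx2.trans_le (min_le_right _ _)⟩
      rcases hz2 with hz2 | hz2
      · exact ⟨z, hz1, hz2.2⟩
      · rw [mem_singleton_iff] at hz2
        linarith [hz1.1]
    have hcont : convexEnvelope W y = W y := by
      refine le_antisymm (hW.convexEnvelope_le hy0.le) (not_lt.1 fun hlt => hfl ?_)
      obtain ⟨α, β, k, hα0, hαy, hyβ, -, -, haff⟩ := hW.exists_affine_interval hy0 hlt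
      obtain ⟨z, hz1, hz2⟩ := exists_between hyβ
      refine ⟨y, z, hy0.le, (hy0.trans hz1).le, hz1, rfl, ?_⟩
      refine (hW.pressure_envelope_eq hy0 (hy0.trans hz1) ?_).symm
      rw [dHalf_eq_of_hasDerivAt hy0 (hasDerivAt_of_affine haff ⟨hαy, hyβ⟩),
        dHalf_eq_of_hasDerivAt (hy0.trans hz1)
          (hasDerivAt_of_affine haff ⟨hαy.trans hz1, hz2⟩)]
    exact ⟨y, ⟨hy0, hW.dHalf_dHalf_eq_zero hy0 hfl hacc⟩,
      (hW.pressure_envelope_of_contact hy0 hcont).symm⟩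
  refine measure_mono_null hsub (measure_union_null ?_ ?_)
  · refine Set.Countable.measure_zero ?_ _
    exact hW.countable_flatValues.union ((countable_singleton _).union
      ((countable_range _).union (countable_range _)))
  -- the one-dimensional case of Sard's theorem, with `Q'' = y W''`
  · refine addHaar_image_eq_zero_of_det_fderivWithin_eq_zero (μ := volume)
      (f' := fun _ => 0) (fun y hy => ?_) (fun y hy => ?_)
    · have h := hW.hasDerivAt_pressure hy.1
      rw [hy.2, mul_zero] at h
      exact (h.hasFDerivAt.congr_fderiv (by ext; simp)).hasFDerivWithinAt
    · rw [ContinuousLinearMap.det]; simp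

end Envelope

/-! ### Profiles with a slowly varying flux -/

section Profile

variable {W : ℝ → ℝ}

/-- A nonnegative `C¹` function `u ≤ R` with derivative `u'` which is twice differentiable on
`{u > 0}` and there solves `G = Q'(u) + (ε²/2) |u'|² - ε² u u''`. -/
structure IsProfile (W : ℝ → ℝ) (ε R : ℝ) (u u' G : ℝ → ℝ) : Prop where
  eps_pos : 0 < ε
  hasDerivAt : ∀ x, HasDerivAt u (u' x) x
  continuous_deriv : Continuous u'
  nonneg : ∀ x, 0 ≤ u x
  le : ∀ x, u x ≤ R
  flux : ∀ x, 0 < u x → ∃ u₂, HasDerivAt u' u₂ x ∧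
    G x = pressure W (u x) + ε ^ 2 / 2 * u' x ^ 2 - ε ^ 2 * u x * u₂

lemma exists_first_eq {h : ℝ → ℝ} (hc : Continuous h) {a b η : ℝ} (hab : a ≤ b) (ha : η < h a)
    (hb : h b ≤ η) : ∃ x ∈ Icc a b, h x = η ∧ ∀ z ∈ Icc a x, η ≤ h z := by
  have hS : IsCompact (Icc a b ∩ h ⁻¹' {η}) :=
    isCompact_Icc.inter_right (isClosed_singleton.preimage hc)
  have hne : (Icc a b ∩ h ⁻¹' {η}).Nonempty := by
    obtain ⟨x, hx, hxe⟩ := intermediate_value_Icc' hab hc.continuousOn ⟨hb, ha.le⟩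
    exact ⟨x, hx, hxe⟩
  obtain ⟨x, ⟨hx, hxe⟩, hleast⟩ := hS.exists_isLeast hne
  refine ⟨x, hx, hxe, fun z hz => ?_⟩
  by_contra hlt
  push Not at hlt
  obtain ⟨y, hy, hye⟩ := intermediate_value_Icc' hz.1 hc.continuousOn ⟨hlt.le, ha.le⟩
  have h1 := hleast ⟨⟨hy.1, hy.2.trans (hz.2.trans hx.2)⟩, hye⟩
  have h2 : z = x := le_antisymm hz.2 (h1.trans hy.2)
  rw [h2, hxe] at hlt
  exact lt_irrefl _ hlt

lemma exists_last_eq {h : ℝ → ℝ} (hc : Continuous h) {a b η : ℝ} (hab : a ≤ b) (ha : h a ≤ η)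
    (hb : η < h b) : ∃ x ∈ Icc a b, h x = η ∧ ∀ z ∈ Icc x b, η ≤ h z := by
  obtain ⟨x, hx, hxe, hle⟩ := exists_first_eq (h := fun z => h (-z)) (hc.comp continuous_neg)
    (neg_le_neg hab) (by simpa using hb) (by simpa using ha)
  refine ⟨-x, ⟨by linarith [hx.2], by linarith [hx.1]⟩, hxe, fun z hz => ?_⟩
  simpa using hle (-z) ⟨by linarith [hz.2], by linarith [hz.1]⟩

namespace IsProfile

variable {ε R : ℝ} {u u' G : ℝ → ℝ}

lemma reflect (h : IsProfile W ε R u u' G) :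
    IsProfile W ε R (fun x => u (-x)) (fun x => -u' (-x)) (fun x => G (-x)) where
  eps_pos := h.eps_pos
  hasDerivAt x := by
    have := (h.hasDerivAt (-x)).comp x (hasDerivAt_neg x)
    exact this.congr_deriv (by ring)
  continuous_deriv := (h.continuous_deriv.comp continuous_neg).neg
  nonneg x := h.nonneg _
  le x := h.le _
  flux x hx := by
    obtain ⟨u₂, h1, h2⟩ := h.flux (-x) hx
    refine ⟨u₂, ?_, ?_⟩
    · have := (h1.comp x (hasDerivAt_neg x)).neg
      exact this.congr_deriv (by ring)
    · rw [h2]; ring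

lemma deriv_eq_zero (h : IsProfile W ε R u u' G) {x : ℝ} (hx : u x = 0) : u' x = 0 := by
  have : IsLocalMin u x := Eventually.of_forall fun z => by rw [hx]; exact h.nonneg z
  exact this.hasDerivAt_eq_zero (h.hasDerivAt x)

lemma pos_of_deriv_pos (h : IsProfile W ε R u u' G) {x : ℝ} (hx : 0 < u' x) : 0 < u x :=
  (h.nonneg x).lt_of_ne fun h0 => hx.ne' (h.deriv_eq_zero h0.symm)

/-- The first integral of the profile equation: it is constant for `G = c`. -/
lemma hasDerivAt_firstIntegral (h : IsProfile W ε R u u' G) (hW : IsPotential W) (c : ℝ) {x : ℝ}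
    (hx : 0 < u x) :
    HasDerivAt (fun x => (W (u x) - ε ^ 2 / 2 * u' x ^ 2 + c) / u x)
      (u' x * (G x - c) / u x ^ 2) x := by
  obtain ⟨u₂, h1, h2⟩ := h.flux x hx
  have hWu : HasDerivAt (fun x => W (u x)) (dHalf W (u x) * u' x) x :=
    (hW.hasDerivAt hx).comp x (h.hasDerivAt x)
  have hN := ((hWu.sub ((h1.pow 2).const_mul (ε ^ 2 / 2))).add_const c).div (h.hasDerivAt x) hx.ne'
  refine hN.congr_deriv ?_
  simp only [Pi.sub_apply, Pi.pow_apply]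
  rw [h2, pressure]
  congr 1
  push_cast
  ring

lemma continuousOn_firstIntegral (h : IsProfile W ε R u u' G) (hW : IsPotential W) (c : ℝ)
    {s : Set ℝ} (hs : ∀ x ∈ s, 0 < u x) :
    ContinuousOn (fun x => (W (u x) - ε ^ 2 / 2 * u' x ^ 2 + c) / u x) s :=
  fun x hx => (h.hasDerivAt_firstIntegral hW c (hs x hx)).continuousAt.continuousWithinAt

lemma firstIntegral_antitone (h : IsProfile W ε R u u' G) (hW : IsPotential W) {a b c : ℝ}
    (hab : a ≤ b) (hpos : ∀ x ∈ Icc a b, 0 < u' x) (hu : ∀ x ∈ Icc a b, 0 < u x)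
    (hG : ∀ x ∈ Icc a b, G x ≤ c) :
    (W (u b) - ε ^ 2 / 2 * u' b ^ 2 + c) / u b ≤ (W (u a) - ε ^ 2 / 2 * u' a ^ 2 + c) / u a := by
  refine antitoneOn_of_deriv_nonpos (convex_Icc a b) (h.continuousOn_firstIntegral hW c hu)
    (fun x hx => ?_) (fun x hx => ?_) (left_mem_Icc.2 hab) (right_mem_Icc.2 hab) hab
  · exact (h.hasDerivAt_firstIntegral hW c
      (hu x (interior_subset hx))).differentiableAt.differentiableWithinAt
  · have hx' := interior_subset hx
    rw [(h.hasDerivAt_firstIntegral hW c (hu x hx')).deriv]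
    exact div_nonpos_of_nonpos_of_nonneg
      (mul_nonpos_of_nonneg_of_nonpos (hpos x hx').le (by linarith [hG x hx'])) (sq_nonneg _)

lemma firstIntegral_monotone (h : IsProfile W ε R u u' G) (hW : IsPotential W) {a b c : ℝ}
    (hab : a ≤ b) (hpos : ∀ x ∈ Icc a b, 0 < u' x) (hu : ∀ x ∈ Icc a b, 0 < u x)
    (hG : ∀ x ∈ Icc a b, c ≤ G x) :
    (W (u a) - ε ^ 2 / 2 * u' a ^ 2 + c) / u a ≤ (W (u b) - ε ^ 2 / 2 * u' b ^ 2 + c) / u b := by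
  refine monotoneOn_of_deriv_nonneg (convex_Icc a b) (h.continuousOn_firstIntegral hW c hu)
    (fun x hx => ?_) (fun x hx => ?_) (left_mem_Icc.2 hab) (right_mem_Icc.2 hab) hab
  · exact (h.hasDerivAt_firstIntegral hW c
      (hu x (interior_subset hx))).differentiableAt.differentiableWithinAt
  · have hx' := interior_subset hx
    rw [(h.hasDerivAt_firstIntegral hW c (hu x hx')).deriv]
    exact div_nonneg (mul_nonneg (hpos x hx').le (by linarith [hG x hx'])) (sq_nonneg _)

lemma mono_of_deriv_pos (h : IsProfile W ε R u u' G) {a b : ℝ}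
    (hab : a ≤ b) (hpos : ∀ x ∈ Icc a b, 0 < u' x) : u a ≤ u b := by
  refine monotoneOn_of_deriv_nonneg (convex_Icc a b)
    (fun x _ => (h.hasDerivAt x).continuousAt.continuousWithinAt)
    (fun x _ => (h.hasDerivAt x).differentiableAt.differentiableWithinAt)
    (fun x hx => ?_) (left_mem_Icc.2 hab) (right_mem_Icc.2 hab) hab
  rw [(h.hasDerivAt x).deriv]
  exact (hpos x (interior_subset hx)).le

/-- If `G` is nearly constant near `x₀` and the graph of `W` has a supporting line at `u(x₀)`, then
`ε u'(x₀)` is small. Follow `u` from `x₀` in both directions until `ε u'` has dropped to `η`. At the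
two end points `W(u)` almost equals the affine function of `u` given by the first integral, while at
`x₀` it exceeds this function by `ε² u'² / 2`; this contradicts the supporting line. The threshold
`η = ε R / δ` is reached within distance `δ`, because `0 ≤ u ≤ R`. -/
lemma sq_deriv_le_of_pos (h : IsProfile W ε R u u' G) (hW : IsPotential W) {δ σ : ℝ} (hδ : 0 < δ)
    (hσ : ∀ x y, |x - y| ≤ δ → |G x - G y| ≤ σ) {x₀ k : ℝ} (hu' : 0 < u' x₀)
    (hk : ∀ z, 0 ≤ z → W (u x₀) + k * (z - u x₀) ≤ W z) :
    (ε * u' x₀) ^ 2 ≤ (ε * R / δ) ^ 2 + 4 * σ := by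
  have hε := h.eps_pos
  have hc : 0 < u x₀ := h.pos_of_deriv_pos hu'
  have hR : 0 < R := hc.trans_le (h.le x₀)
  have hσ0 : 0 ≤ σ := by simpa using (abs_nonneg _).trans (hσ x₀ x₀ (by simpa using hδ.le))
  have hη : 0 < ε * R / δ := by positivity
  set η := ε * R / δ with hηdef
  rcases le_or_gt (ε * u' x₀) η with hle | hlt
  · have : (ε * u' x₀) ^ 2 ≤ η ^ 2 := pow_le_pow_left₀ (by positivity) hle 2
    linarith
  have hcont : Continuous fun x => ε * u' x := continuous_const.mul h.continuous_deriv
  have hslow : ∀ a, ∃ z ∈ Icc a (a + δ), ε * u' z ≤ η := by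
    intro a
    obtain ⟨z, hz, hze⟩ := exists_hasDerivAt_eq_slope u u' (show a < a + δ by linarith)
      (fun x _ => (h.hasDerivAt x).continuousAt.continuousWithinAt) (fun x _ => h.hasDerivAt x)
    refine ⟨z, ⟨hz.1.le, hz.2.le⟩, ?_⟩
    rw [hze, hηdef, ← mul_div_assoc]
    have h1 := h.le (a + δ)
    have h2 := h.nonneg a
    have : a + δ - a = δ := by ring
    rw [this]
    gcongr
    linarith
  obtain ⟨z₂, hz₂, hz₂'⟩ := hslow x₀
  obtain ⟨x₂, hx₂, hx₂e, hx₂'⟩ := exists_first_eq hcont hz₂.1 hlt hz₂'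
  obtain ⟨z₁, hz₁, hz₁'⟩ := hslow (x₀ - δ)
  obtain ⟨x₁, hx₁, hx₁e, hx₁'⟩ := exists_last_eq hcont (show z₁ ≤ x₀ by linarith [hz₁.2]) hz₁' hlt
  have hpos : ∀ x, η ≤ ε * u' x → 0 < u' x := fun x hx =>
    pos_of_mul_pos_right (hη.trans_le hx) hε.le
  have hp₂ : ∀ x ∈ Icc x₀ x₂, 0 < u' x := fun x hx => hpos x (hx₂' x hx)
  have hp₁ : ∀ x ∈ Icc x₁ x₀, 0 < u' x := fun x hx => hpos x (hx₁' x hx)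
  have hG : ∀ x, |x - x₀| ≤ δ → G x ≤ G x₀ + σ ∧ G x₀ - σ ≤ G x := fun x hx => by
    have := abs_le.1 (hσ x x₀ hx)
    constructor <;> linarith
  have e₂ := h.firstIntegral_antitone hW (c := G x₀ + σ) hx₂.1 hp₂
    (fun x hx => h.pos_of_deriv_pos (hp₂ x hx)) (fun x hx => (hG x (by
      rw [abs_of_nonneg (by linarith [hx.1])]; linarith [hx.2, hx₂.2, hz₂.2])).1)
  have e₁ := h.firstIntegral_monotone hW (c := G x₀ - σ) hx₁.2 hp₁
    (fun x hx => h.pos_of_deriv_pos (hp₁ x hx)) (fun x hx => (hG x (by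
      rw [abs_of_nonpos (by linarith [hx.2])]; linarith [hx.1, hx₁.1, hz₁.1])).2)
  have m₂ := h.mono_of_deriv_pos hx₂.1 hp₂
  have m₁ := h.mono_of_deriv_pos hx₁.2 hp₁
  have q₁ : 0 < u x₁ := h.pos_of_deriv_pos (hp₁ x₁ ⟨le_rfl, hx₁.2⟩)
  have q₂ : 0 < u x₂ := hc.trans_le m₂
  have k₁ := hk (u x₁) q₁.le
  have k₂ := hk (u x₂) q₂.le
  have sq : ∀ x, ε ^ 2 / 2 * u' x ^ 2 = (ε * u' x) ^ 2 / 2 := fun x => by ring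
  rw [sq, sq, hx₁e, div_le_div_iff₀ q₁ hc] at e₁
  rw [sq, sq, hx₂e, div_le_div_iff₀ q₂ hc] at e₂
  -- now everything is linear algebra in the two inequalities `f₁` and `f₂`
  set S := (ε * u' x₀) ^ 2 / 2 with hS
  set A := W (u x₀) - k * u x₀ + G x₀ with hA
  have f₁ : (A - η ^ 2 / 2 - σ) * u x₀ ≤ (A - S - σ) * u x₁ := by
    have := mul_le_mul_of_nonneg_right k₁ hc.le
    simp only [hA]; nlinarith
  have f₂ : (A - η ^ 2 / 2 + σ) * u x₀ ≤ (A - S + σ) * u x₂ := by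
    have := mul_le_mul_of_nonneg_right k₂ hc.le
    simp only [hA]; nlinarith
  have hgoal : S ≤ η ^ 2 / 2 + 2 * σ := by
    by_contra hcon
    push Not at hcon
    rcases le_or_gt (A - S + σ) 0 with hs | hs
    · have : (A - S + σ) * u x₂ ≤ (A - S + σ) * u x₀ := mul_le_mul_of_nonpos_left m₂ hs
      have := le_of_mul_le_mul_right (f₂.trans this) hc
      linarith
    · have h1 : 0 < (A - S - σ) * u x₁ :=
        (mul_pos (by linarith : 0 < A - η ^ 2 / 2 - σ) hc).trans_le f₁
      have h2 : 0 < A - S - σ := pos_of_mul_pos_left h1 q₁.le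
      have : (A - S - σ) * u x₁ ≤ (A - S - σ) * u x₀ := mul_le_mul_of_nonneg_left m₁ h2.le
      have := le_of_mul_le_mul_right (f₁.trans this) hc
      linarith
  linarith

lemma sq_deriv_le (h : IsProfile W ε R u u' G) (hW : IsPotential W) {δ σ : ℝ} (hδ : 0 < δ)
    (hσ : ∀ x y, |x - y| ≤ δ → |G x - G y| ≤ σ) {x₀ k : ℝ}
    (hk : ∀ z, 0 ≤ z → W (u x₀) + k * (z - u x₀) ≤ W z) :
    (ε * u' x₀) ^ 2 ≤ (ε * R / δ) ^ 2 + 4 * σ := by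
  have hσ0 : 0 ≤ σ := by simpa using (abs_nonneg _).trans (hσ x₀ x₀ (by simpa using hδ.le))
  rcases lt_trichotomy (u' x₀) 0 with h0 | h0 | h0
  · have := h.reflect.sq_deriv_le_of_pos hW hδ (x₀ := -x₀) (k := k) (σ := σ)
      (fun x y hxy => hσ _ _ (by rwa [neg_sub_neg, abs_sub_comm]))
      (by simpa using h0) (by simpa using hk)
    simpa using this
  · rw [h0]; simp; positivity
  · exact h.sq_deriv_le_of_pos hW hδ hσ h0 hk

/-- If `ε u'` is small wherever `u` is within `r` of `u(x₀)`, then on `[x₀, x₀ + ε]` the function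
`u` stays there and `ε² u''` is small somewhere, so that `G` is close to `Q'(u)`. -/
lemma abs_flux_sub_pressure_le (h : IsProfile W ε R u u' G) {x₀ r τ σ κ : ℝ}
    (hr : r < u x₀) (hτ0 : 0 ≤ τ) (hτ : τ < r) (hτ1 : ∀ x, |u x - u x₀| ≤ r → |ε * u' x| ≤ τ)
    (hσ : ∀ x y, |x - y| ≤ ε → |G x - G y| ≤ σ)
    (hκ : ∀ z, |z - u x₀| ≤ r → |pressure W z - pressure W (u x₀)| ≤ κ) :
    |G x₀ - pressure W (u x₀)| ≤ σ + κ + τ ^ 2 / 2 + 2 * R * τ := by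
  have hε := h.eps_pos
  have hr0 : 0 < r := hτ0.trans_lt hτ
  have hstay : ∀ x ∈ Icc x₀ (x₀ + ε), |u x - u x₀| ≤ r := by
    intro x hx
    have := image_norm_le_of_norm_deriv_right_lt_deriv_boundary (f := fun x => u x - u x₀)
      (f' := u') (a := x₀) (b := x₀ + ε) (B := fun x => r / ε * (x - x₀)) (B' := fun _ => r / ε)
      (fun x _ => ((h.hasDerivAt x).continuousAt.sub continuousAt_const).continuousWithinAt)
      (fun x _ => ((h.hasDerivAt x).sub_const _).hasDerivWithinAt) (by simp)
      (fun x => (((hasDerivAt_id x).sub_const x₀).const_mul (r / ε)).congr_deriv (by ring))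
      (fun y hy hye => ?_) hx
    · refine this.trans ?_
      rw [div_mul_eq_mul_div, div_le_iff₀ hε]
      exact mul_le_mul_of_nonneg_left (by linarith [hx.2]) hr0.le
    · have h1 : |u y - u x₀| ≤ r := by
        rw [← Real.norm_eq_abs, hye, div_mul_eq_mul_div, div_le_iff₀ hε]
        exact mul_le_mul_of_nonneg_left (by linarith [hy.2]) hr0.le
      have h2 := hτ1 y h1
      rw [abs_mul, abs_of_pos hε] at h2
      rw [Real.norm_eq_abs, lt_div_iff₀ hε]
      linarith
  have hpos : ∀ x ∈ Icc x₀ (x₀ + ε), 0 < u x := fun x hx => by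
    have := abs_le.1 (hstay x hx)
    linarith
  choose! u₂ hu₂ hGu₂ using fun x hx => h.flux x (hpos x hx)
  obtain ⟨x, hx, hxe⟩ := exists_hasDerivAt_eq_slope u' u₂ (show x₀ < x₀ + ε by linarith)
    h.continuous_deriv.continuousOn (fun x hx => hu₂ x ⟨hx.1.le, hx.2.le⟩)
  have hx' : x ∈ Icc x₀ (x₀ + ε) := ⟨hx.1.le, hx.2.le⟩
  have hsecond : |ε ^ 2 * u₂ x| ≤ 2 * τ := by
    have h1 := abs_le.1 (hτ1 x₀ (hstay x₀ ⟨le_rfl, by linarith⟩))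
    have h2 := abs_le.1 (hτ1 (x₀ + ε) (hstay _ ⟨by linarith, le_rfl⟩))
    have : ε ^ 2 * u₂ x = ε * u' (x₀ + ε) - ε * u' x₀ := by
      rw [hxe, add_sub_cancel_left]; field_simp
    rw [this, abs_le]
    constructor <;> linarith
  have h1 := hκ (u x) (hstay x hx')
  have h2 := hσ x₀ x (by rw [abs_le]; constructor <;> linarith [hx.1, hx.2])
  have h3 : (ε * u' x) ^ 2 ≤ τ ^ 2 :=
    sq_le_sq.2 (by rw [abs_of_nonneg hτ0]; exact hτ1 x (hstay x hx'))
  have h4 : |u x * (ε ^ 2 * u₂ x)| ≤ R * (2 * τ) := by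
    rw [abs_mul, abs_of_nonneg (h.nonneg x)]
    exact mul_le_mul (h.le x) hsecond (abs_nonneg _) ((h.nonneg x).trans (h.le x))
  have h5 := hGu₂ x hx'
  rw [abs_le] at h1 h2 h4 ⊢
  constructor <;> nlinarith [sq_nonneg (ε * u' x)]

end IsProfile

/-- Away from the values of `Q^{**}'` on the unstable set, `G` is close to `Q^{**}'(u)` for small
`ε`, uniformly over all profiles whose flux has a given modulus of continuity. If `Q^{**}'(u(x))`
avoids these values, then `u(x)` keeps a uniform distance from the unstable set, so that all values
of `u` near `u(x)` are points of contact, where `sq_deriv_le` applies. -/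
lemma IsPotential.exists_flux_close (hW : IsPotential W) {R : ℝ} (L : ℝ) (hR : 0 < R)
    {U : Set ℝ} (hU : IsOpen U) (hsub : pressure (convexEnvelope W) '' unstableSet W ⊆ U)
    {κ : ℝ} (hκ : 0 < κ) :
    ∃ ε₀ > 0, ∀ ε < ε₀, ∀ u u' G : ℝ → ℝ, IsProfile W ε R u u' G →
      (∀ x y, |x - y| ≤ 1 → |G x - G y| ≤ L * √(R * |x - y|)) →
      ∀ x, pressure (convexEnvelope W) (u x) ∉ U →
        |G x - pressure (convexEnvelope W) (u x)| ≤ κ := by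
  set Q := pressure (convexEnvelope W) with hQ
  set K := Icc 0 R ∩ Q ⁻¹' Uᶜ with hK
  have hKc : IsCompact K := isCompact_Icc.of_isClosed_subset
    (ContinuousOn.preimage_isClosed_of_isClosed
      (hW.continuousOn_pressure_envelope.mono Icc_subset_Ici_self) isClosed_Icc hU.isClosed_compl)
    inter_subset_left
  have hKS : K ⊆ (unstableSet W)ᶜ := fun y hy hyS => hy.2 (hsub ⟨y, hyS, rfl⟩)
  obtain ⟨r₁, hr₁, hthick⟩ := hKc.exists_cthickening_subset_open
    isClosed_unstableSet.isOpen_compl hKS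
  have hunif : UniformContinuousOn (pressure W) (Icc 0 (R + 1)) :=
    isCompact_Icc.uniformContinuousOn_of_continuous
      (hW.continuousOn_pressure.mono Icc_subset_Ici_self)
  obtain ⟨r₂, hr₂, hunif⟩ := Metric.uniformContinuousOn_iff.1 hunif (κ / 4) (by positivity)
  obtain ⟨r, hr, hrr₁, hrr₂, hr1⟩ : ∃ r, 0 < r ∧ r ≤ r₁ ∧ r < r₂ ∧ r ≤ 1 :=
    ⟨min (min r₁ (r₂ / 2)) 1, by positivity, (min_le_left _ _).trans (min_le_left _ _),
      ((min_le_left _ _).trans (min_le_right _ _)).trans_lt (by linarith), min_le_right _ _⟩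
  have hstable : ∀ c ∈ K, ∀ z, |z - c| ≤ r → 0 < z ∧ convexEnvelope W z = W z := by
    intro c hc z hz
    have hcl : ∀ y, |y - c| ≤ r → y ∉ unstableSet W := fun y hy =>
      hthick (Metric.mem_cthickening_of_dist_le y c r₁ K hc (hy.trans hrr₁))
    have hz0 : 0 < z := by
      by_contra hneg
      push Not at hneg
      refine hcl 0 ?_ zero_mem_unstableSet
      have h1 := abs_le.1 hz
      have h2 := hc.1.1
      rw [abs_le]; constructor <;> linarith
    exact ⟨hz0, notMem_unstableSet hz0.le hW (hcl z hz)⟩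
  obtain ⟨τ, hτ, hτr, hτκ⟩ : ∃ τ, 0 < τ ∧ τ < r ∧ τ ^ 2 / 2 + 2 * R * τ ≤ κ / 4 := by
    have hden : 0 < 4 * (1 + 2 * R) := by positivity
    refine ⟨min (r / 2) (κ / (4 * (1 + 2 * R))), by positivity,
      (min_le_left _ _).trans_lt (by linarith), ?_⟩
    set τ := min (r / 2) (κ / (4 * (1 + 2 * R)))
    have h0 : 0 < τ := by positivity
    have h1 : τ ≤ 1 := (min_le_left _ _).trans (by linarith)
    have h2 : τ * (4 * (1 + 2 * R)) ≤ κ := by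
      rw [← le_div_iff₀ hden]; exact min_le_right _ _
    nlinarith
  have hlim : ∀ c : ℝ, 0 < c → ∃ δ > 0, δ ≤ 1 ∧ ∀ x, 0 ≤ x → x ≤ δ → L * √(R * x) ≤ c := by
    intro c hc
    have : Tendsto (fun x => L * √(R * x)) (𝓝 0) (𝓝 (L * √(R * 0))) :=
      Continuous.tendsto (by fun_prop) 0
    have h1 := this.eventually (gt_mem_nhds (show L * √(R * 0) < c by simpa using hc))
    obtain ⟨δ, hδ, hball⟩ := Metric.eventually_nhds_iff.1 h1
    refine ⟨min (δ / 2) 1, by positivity, min_le_right _ _, fun x hx0 hx => (hball ?_).le⟩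
    rw [Real.dist_eq, sub_zero, abs_of_nonneg hx0]
    linarith [min_le_left (δ / 2) 1]
  obtain ⟨δ, hδ, hδ1, hδle⟩ := hlim (τ ^ 2 / 8) (by positivity)
  obtain ⟨ε₁, hε₁, hε₁1, hε₁le⟩ := hlim (κ / 4) (by positivity)
  refine ⟨min ε₁ (τ * δ / (2 * R)), by positivity, fun ε hε u u' G hp hG x hx => ?_⟩
  have hε0 := hp.eps_pos
  have hxK : u x ∈ K := ⟨⟨hp.nonneg x, hp.le x⟩, hx⟩
  have hcx := hstable _ hxK (u x) (by simpa using hr.le)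
  rw [hQ, hW.pressure_envelope_of_contact hcx.1 hcx.2]
  have hslope : (ε * R / δ) ^ 2 ≤ τ ^ 2 / 2 := by
    have h1 : ε * R / δ ≤ τ / 2 := by
      have := (hε.le.trans (min_le_right _ _))
      rw [le_div_iff₀ (by positivity)] at this
      rw [div_le_iff₀ hδ]; linarith
    have h2 : (ε * R / δ) ^ 2 ≤ (τ / 2) ^ 2 := pow_le_pow_left₀ (by positivity) h1 2
    nlinarith [sq_nonneg τ]
  have := hp.abs_flux_sub_pressure_le (x₀ := x) (r := r) (τ := τ) (σ := κ / 4) (κ := κ / 4)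
    (by
      have := (hstable _ hxK (u x - r) (by simp [abs_of_pos hr])).1
      linarith) hτ.le hτr
    (fun y hy => by
      obtain ⟨hy0, hyW⟩ := hstable _ hxK (u y) hy
      have := hp.sq_deriv_le hW hδ (σ := τ ^ 2 / 8) (x₀ := y)
        (k := dHalf (convexEnvelope W) (u y))
        (fun s t hst => (hG s t (hst.trans hδ1)).trans (hδle _ (abs_nonneg _) hst))
        (fun z hz => by
          rw [← hyW]
          exact (hW.envelope_support hy0 hz).trans (hW.convexEnvelope_le hz))
      exact abs_le_of_sq_le_sq (by linarith) hτ.le)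
    (fun s t hst => (hG s t (hst.trans ((hε.le.trans (min_le_left _ _)).trans hε₁1))).trans
      (hε₁le _ (abs_nonneg _) (hst.trans (hε.le.trans (min_le_left _ _)))))
    (fun z hz => by
      have hz0 := (hstable _ hxK z hz).1
      have h1 := abs_le.1 hz
      have h2 := hp.le x
      have := hunif z ⟨hz0.le, by linarith⟩ (u x) ⟨hp.nonneg x, by linarith⟩
        (by rw [Real.dist_eq]; linarith)
      rw [Real.dist_eq] at this
      exact this.le)
  linarith

end Profile

/-! ### Calculus on the torus through periodic functions on the line -/

section TorusCalculus

lemma periodic_lift (f : Torus → ℝ) : Function.Periodic (lift f) 1 := fun t => by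
  simp only [lift]
  congr 1
  rw [AddCircle.coe_add, AddCircle.coe_period, add_zero]

lemma tderiv_coe (f : Torus → ℝ) (t : ℝ) : tderiv f (t : Torus) = deriv (lift f) t := by
  have : (fun s : ℝ => f ((t : Torus) + (s : Torus))) = fun s => lift f (t + s) := by
    ext s; simp [lift]
  rw [tderiv, this, deriv_comp_const_add, add_zero]

lemma lift_tderiv (f : Torus → ℝ) : lift (tderiv f) = deriv (lift f) := funext (tderiv_coe f)

lemma lift_periodicLift {ψ : ℝ → ℝ} (h : Function.Periodic ψ 1) :
    lift (fun x : Torus => h.lift x) = ψ := funext fun t => h.lift_coe t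

lemma integral_torus (f : Torus → ℝ) : ∫ x, f x = ∫ t in (0 : ℝ)..1, lift f t := by
  have := UnitAddCircle.intervalIntegral_preimage 0 f
  rw [zero_add] at this
  exact this.symm

lemma lintegral_torus (f : Torus → ℝ≥0∞) :
    ∫⁻ x, f x = ∫⁻ t in Ioc (0 : ℝ) 1, f (t : Torus) := by
  have := UnitAddCircle.lintegral_preimage 0 f
  rw [zero_add] at this
  exact this.symm

lemma measurePreserving_coe :
    MeasurePreserving (fun t : ℝ => (t : Torus)) (volume.restrict (Ioc (0 : ℝ) 1))
      (volume : Measure Torus) := by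
  have := UnitAddCircle.measurePreserving_mk 0
  rwa [zero_add] at this

lemma ae_Ioc_of_ae_torus {p : Torus → Prop} (h : ∀ᵐ x, p x) :
    ∀ᵐ t : ℝ ∂(volume.restrict (Ioc (0 : ℝ) 1)), p (t : Torus) :=
  measurePreserving_coe.quasiMeasurePreserving.ae h

lemma intervalIntegrable_lift {f : Torus → ℝ} (hf : Integrable f) (a b : ℝ) :
    IntervalIntegrable (lift f) volume a b := by
  refine (periodic_lift f).intervalIntegrable₀ one_ne_zero ?_ a b
  rw [intervalIntegrable_iff_integrableOn_Ioc_of_le zero_le_one]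
  exact measurePreserving_coe.integrable_comp_of_integrable hf

lemma intervalIntegrable_all_of_periodic {f : ℝ → ℝ} (hp : Function.Periodic f 1)
    (h : IntervalIntegrable f volume 0 1) (a b : ℝ) : IntervalIntegrable f volume a b :=
  hp.intervalIntegrable₀ one_ne_zero h a b

/-- The test functions on the torus are the smooth `1`-periodic functions on the line. -/
lemma IsWeakDeriv.lift_integral {u v : Torus → ℝ} (h : IsWeakDeriv u v) {ψ : ℝ → ℝ}
    (hψ : ContDiff ℝ ∞ ψ) (hp : Function.Periodic ψ 1) :
    ∫ t in (0 : ℝ)..1, lift u t * deriv ψ t = -∫ t in (0 : ℝ)..1, lift v t * ψ t := by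
  have h1 := h.2.2 (fun x => hp.lift x) (by rw [IsTest, lift_periodicLift]; exact hψ)
  rw [integral_torus, integral_torus] at h1
  have e1 : lift (fun x => u x * tderiv (fun x => hp.lift x) x) =
      fun t => lift u t * deriv ψ t := by
    ext t
    simp only [lift]
    rw [tderiv_coe, lift_periodicLift]
  rw [e1] at h1
  exact h1

/-- A continuous periodic function orthogonal to all derivatives of smooth periodic functions is
constant: its nonzero Fourier coefficients vanish. -/
lemma eq_const_of_orthogonal_deriv {Z : ℝ → ℝ} (hZ : Continuous Z) (hp : Function.Periodic Z 1)
    (horth : ∀ ψ : ℝ → ℝ, ContDiff ℝ ∞ ψ → Function.Periodic ψ 1 →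
      ∫ t in (0 : ℝ)..1, Z t * deriv ψ t = 0) (t : ℝ) : Z t = Z 0 := by
  have hcos : ∀ n : ℤ, n ≠ 0 → ∫ t in (0 : ℝ)..1, Z t * Real.cos (2 * Real.pi * n * t) = 0 := by
    intro n hn
    have hne : (2 * Real.pi * n : ℝ) ≠ 0 := by
      have : (n : ℝ) ≠ 0 := by exact_mod_cast hn
      positivity
    have h := horth (fun t => (2 * Real.pi * n)⁻¹ * Real.sin (2 * Real.pi * n * t)) (by fun_prop)
      (fun t => by
        have : 2 * Real.pi * n * (t + 1) = 2 * Real.pi * n * t + n * (2 * Real.pi) := by ring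
        simp only [this, Real.sin_add_int_mul_two_pi])
    rw [← h]
    congr 1
    ext t
    have : HasDerivAt (fun t => (2 * Real.pi * n)⁻¹ * Real.sin (2 * Real.pi * n * t))
        ((2 * Real.pi * n)⁻¹ * (Real.cos (2 * Real.pi * n * t) * (2 * Real.pi * n * 1))) t :=
      (((hasDerivAt_id t).const_mul _).sin).const_mul _
    rw [this.deriv]
    field_simp
  have hsin : ∀ n : ℤ, n ≠ 0 → ∫ t in (0 : ℝ)..1, Z t * Real.sin (2 * Real.pi * n * t) = 0 := by
    intro n hn
    have hne : (2 * Real.pi * n : ℝ) ≠ 0 := by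
      have : (n : ℝ) ≠ 0 := by exact_mod_cast hn
      positivity
    have h := horth (fun t => -(2 * Real.pi * n)⁻¹ * Real.cos (2 * Real.pi * n * t)) (by fun_prop)
      (fun t => by
        have : 2 * Real.pi * n * (t + 1) = 2 * Real.pi * n * t + n * (2 * Real.pi) := by ring
        simp only [this, Real.cos_add_int_mul_two_pi])
    rw [← h]
    congr 1
    ext t
    have : HasDerivAt (fun t => -(2 * Real.pi * n)⁻¹ * Real.cos (2 * Real.pi * n * t))
        (-(2 * Real.pi * n)⁻¹ * (-Real.sin (2 * Real.pi * n * t) * (2 * Real.pi * n * 1))) t :=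
      (((hasDerivAt_id t).const_mul _).cos).const_mul _
    rw [this.deriv]
    field_simp
  have hZc : Continuous fun t => (Z t : ℂ) := Complex.continuous_ofReal.comp hZ
  have hpc : Function.Periodic (fun t => (Z t : ℂ)) 1 := fun t => by simp [hp t]
  let f : C(UnitAddCircle, ℂ) := ⟨fun x => hpc.lift x,
    isQuotientMap_quotient_mk'.continuous_iff.2 hZc⟩
  have hf : ∀ t : ℝ, f (t : UnitAddCircle) = Z t := fun t => hpc.lift_coe t
  have hcoeff : ∀ n : ℤ, n ≠ 0 → fourierCoeff f n = 0 := by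
    intro n hn
    rw [fourierCoeff_eq_intervalIntegral f n 0]
    have e : ∀ t : ℝ, (fourier (-n)) (t : UnitAddCircle) • f (t : UnitAddCircle) =
        ((Z t * Real.cos (2 * Real.pi * n * t) : ℝ) : ℂ) -
          ((Z t * Real.sin (2 * Real.pi * n * t) : ℝ) : ℂ) * Complex.I := by
      intro t
      rw [hf, fourier_coe_apply]
      have e1 : 2 * (Real.pi : ℂ) * Complex.I * ((-n : ℤ) : ℂ) * (t : ℂ) / ((1 : ℝ) : ℂ) =
          ((-(2 * Real.pi * n * t) : ℝ) : ℂ) * Complex.I := by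
        push_cast; ring
      rw [e1, Complex.exp_mul_I, ← Complex.ofReal_cos, ← Complex.ofReal_sin, Real.cos_neg,
        Real.sin_neg, smul_eq_mul]
      push_cast; ring
    simp only [e, zero_add]
    rw [intervalIntegral.integral_sub, intervalIntegral.integral_mul_const,
      intervalIntegral.integral_ofReal, intervalIntegral.integral_ofReal, hcos n hn, hsin n hn]
    · simp
    · exact Continuous.intervalIntegrable (by fun_prop) _ _
    · exact Continuous.intervalIntegrable (by fun_prop) _ _
  have hsum : Summable (fourierCoeff f) :=
    summable_of_ne_finset_zero (s := {0}) fun n hn => hcoeff n (by simpa using hn)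
  have hval : ∀ t : ℝ, (Z t : ℂ) = fourierCoeff f 0 := by
    intro t
    have h1 := has_pointwise_sum_fourier_series_of_summable hsum (t : UnitAddCircle)
    have h2 := hasSum_single (f := fun i => fourierCoeff f i • (fourier i) (t : UnitAddCircle)) 0
      (fun n hn => by rw [hcoeff n hn, zero_smul])
    rw [← hf, h1.unique h2]
    simp
  have := (hval t).trans (hval 0).symm
  exact_mod_cast this

lemma periodic_primitive {h : ℝ → ℝ} (hi : IntervalIntegrable h volume 0 1)
    (hp : Function.Periodic h 1) (h0 : ∫ t in (0 : ℝ)..1, h t = 0) :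
    Function.Periodic (fun t => ∫ s in (0 : ℝ)..t, h s) 1 := fun t => by
  have hall := intervalIntegrable_all_of_periodic hp hi
  have h1 := intervalIntegral.integral_add_adjacent_intervals (hall 0 t) (hall t (t + 1))
  have h2 := hp.intervalIntegral_add_eq t 0
  rw [zero_add, h0] at h2
  simp only
  rw [← h1, h2, add_zero]

lemma intervalIntegral_primitive_mul_deriv {h ψ : ℝ → ℝ} (hi : IntervalIntegrable h volume 0 1)
    (hψ : ContDiff ℝ 1 ψ) :
    ∫ t in (0 : ℝ)..1, (∫ s in (0 : ℝ)..t, h s) * deriv ψ t =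
      (∫ t in (0 : ℝ)..1, h t) * ψ 1 - ∫ t in (0 : ℝ)..1, h t * ψ t := by
  have hK := hi.absolutelyContinuousOnInterval_intervalIntegral (c := 0)
    (left_mem_uIcc : (0 : ℝ) ∈ uIcc 0 1)
  have := hK.integral_mul_deriv_eq_deriv_mul (g := ψ) hψ.contDiffOn.absolutelyContinuousOnInterval
  rw [this]
  simp only [intervalIntegral.integral_same, zero_mul, sub_zero]
  congr 1
  refine intervalIntegral.integral_congr_ae ?_
  filter_upwards [hi.ae_hasDerivAt_integral] with t ht htm
  rw [(ht (uIoc_subset_uIcc htm) 0 left_mem_uIcc).deriv]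

/-- **Du Bois-Reymond's lemma** on the torus. -/
lemma eq_add_integral_of_weak {Y h : ℝ → ℝ} (hY : Continuous Y) (hpY : Function.Periodic Y 1)
    (hi : IntervalIntegrable h volume 0 1) (hph : Function.Periodic h 1)
    (hweak : ∀ ψ : ℝ → ℝ, ContDiff ℝ ∞ ψ → Function.Periodic ψ 1 →
      ∫ t in (0 : ℝ)..1, Y t * deriv ψ t = -∫ t in (0 : ℝ)..1, h t * ψ t) (t : ℝ) :
    Y t = Y 0 + ∫ s in (0 : ℝ)..t, h s := by
  have h0 : ∫ t in (0 : ℝ)..1, h t = 0 := by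
    have := hweak (fun _ => 1) contDiff_const (fun _ => rfl)
    simpa using this
  have hall := intervalIntegrable_all_of_periodic hph hi
  have hKc : Continuous fun t => ∫ s in (0 : ℝ)..t, h s :=
    intervalIntegral.continuous_primitive hall 0
  have hpK := periodic_primitive hi hph h0
  have key := eq_const_of_orthogonal_deriv (Z := fun t => Y t - ∫ s in (0 : ℝ)..t, h s)
    (hY.sub hKc) (hpY.sub hpK) (fun ψ hψ hpψ => by
      have hψ1 : ContDiff ℝ 1 ψ := hψ.of_le (by exact_mod_cast le_top)
      have hd : Continuous (deriv ψ) := hψ1.continuous_deriv le_rfl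
      simp only [sub_mul]
      rw [intervalIntegral.integral_sub (f := fun t => Y t * deriv ψ t)
        (g := fun t => (∫ s in (0 : ℝ)..t, h s) * deriv ψ t) ((hY.mul hd).intervalIntegrable _ _)
        ((hKc.mul hd).intervalIntegrable _ _), hweak ψ hψ hpψ,
        intervalIntegral_primitive_mul_deriv hi hψ1, h0]
      ring) t
  simp only [intervalIntegral.integral_same, sub_zero] at key
  linarith

lemma ae_deriv_eq_of_eq_add_integral {Y h : ℝ → ℝ} (hall : ∀ a b, IntervalIntegrable h volume a b)
    (he : ∀ t, Y t = Y 0 + ∫ s in (0 : ℝ)..t, h s) : ∀ᵐ t, deriv Y t = h t := by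
  have hloc : LocallyIntegrable h volume := by
    intro x
    refine ⟨Ioc (x - 1) (x + 1), ?_, ?_⟩
    · exact mem_of_superset (Ioo_mem_nhds (by linarith) (by linarith)) Ioo_subset_Ioc_self
    · exact (intervalIntegrable_iff_integrableOn_Ioc_of_le (by linarith)).1 (hall _ _)
  filter_upwards [LocallyIntegrable.ae_hasDerivAt_integral hloc] with t ht
  have := (ht 0).const_add (Y 0)
  rw [← funext he] at this
  exact this.deriv

/-- The weak derivative of a `C¹` function is its classical derivative. -/
lemma IsWeakDeriv.ae_eq_deriv {u v : Torus → ℝ} (h : IsWeakDeriv u v)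
    (hu : Continuous (lift u)) : ∀ᵐ t, lift v t = deriv (lift u) t := by
  have hi := intervalIntegrable_lift h.2.1
  have := ae_deriv_eq_of_eq_add_integral hi (eq_add_integral_of_weak hu (periodic_lift u) (hi 0 1)
    (periodic_lift v) (fun ψ hψ hp => h.lift_integral hψ hp))
  filter_upwards [this] with t ht using ht.symm

end TorusCalculus

/-! ### From admissible fluxes to profiles -/

section Flux

variable {W : ℝ → ℝ} {ε : ℝ} {u g : Torus → ℝ}

lemma integral_sqrt_mul_abs_le {α : Type*} [MeasurableSpace α] {μ : Measure α} {u g : α → ℝ}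
    (hu0 : ∀ x, 0 ≤ u x) (hu : Integrable u μ) (hg : MemLp g 2 μ) :
    ∫ x, √(u x) * |g x| ∂μ ≤ √(∫ x, u x ∂μ) * √(∫ x, g x ^ 2 ∂μ) := by
  have hs : ∀ x, √(u x) ^ 2 = u x := fun x => Real.sq_sqrt (hu0 x)
  have hsq : MemLp (fun x => √(u x)) 2 μ := by
    rw [memLp_two_iff_integrable_sq (Real.continuous_sqrt.comp_aestronglyMeasurable hu.1)]
    simpa only [hs] using hu
  have h2 : ENNReal.ofReal 2 = 2 := by norm_num
  have := integral_mul_le_Lp_mul_Lq_of_nonneg (μ := μ) Real.HolderConjugate.two_two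
    (f := fun x => √(u x)) (g := fun x => |g x|) (Eventually.of_forall fun x => Real.sqrt_nonneg _)
    (Eventually.of_forall fun x => abs_nonneg _) (by rwa [h2]) (by rw [h2]; exact hg.abs)
  refine this.trans (le_of_eq ?_)
  simp only [Real.rpow_two, hs, sq_abs]
  rw [← Real.sqrt_eq_rpow, ← Real.sqrt_eq_rpow]

lemma intervalIntegrable_sq_lift (hg : MemLp g 2) (a b : ℝ) :
    IntervalIntegrable (fun t => lift g t ^ 2) volume a b :=
  intervalIntegrable_lift (f := fun x => g x ^ 2) hg.integrable_sq a b

lemma memLp_lift_Ioc (hg : MemLp g 2) (a b : ℝ) :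
    MemLp (lift g) 2 (volume.restrict (Ioc a b)) := by
  rcases le_or_gt a b with hab | hab
  · have h1 := intervalIntegrable_lift (hg.integrable (by norm_num)) a b
    rw [intervalIntegrable_iff_integrableOn_Ioc_of_le hab] at h1
    rw [memLp_two_iff_integrable_sq h1.aestronglyMeasurable]
    exact (intervalIntegrable_iff_integrableOn_Ioc_of_le hab).1 (intervalIntegrable_sq_lift hg a b)
  · simp [Ioc_eq_empty (not_lt.2 hab.le)]

lemma intervalIntegral_sqrt_mul_abs_le {U : ℝ → ℝ} (hU : Continuous U) (hU0 : ∀ t, 0 ≤ U t)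
    (hg : MemLp g 2) {a b : ℝ} (hab : a ≤ b) :
    ∫ t in a..b, √(U t) * |lift g t| ≤
      √(∫ t in a..b, U t) * √(∫ t in a..b, lift g t ^ 2) := by
  rw [intervalIntegral.integral_of_le hab, intervalIntegral.integral_of_le hab,
    intervalIntegral.integral_of_le hab]
  exact integral_sqrt_mul_abs_le hU0 (hU.integrableOn_Ioc) (memLp_lift_Ioc hg a b)

lemma intervalIntegrable_sqrt_mul {U : ℝ → ℝ} (hU : Continuous U) (hg : MemLp g 2) (a b : ℝ) :
    IntervalIntegrable (fun t => √(U t) * lift g t) volume a b :=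
  (intervalIntegrable_lift (hg.integrable (by norm_num)) a b).continuousOn_mul
    (Real.continuous_sqrt.comp hU).continuousOn

lemma continuous_comp_of_nonneg {F U : ℝ → ℝ} (hF : ContinuousOn F (Ici 0)) (hU : Continuous U)
    (hU0 : ∀ t, 0 ≤ U t) : Continuous fun t => F (U t) :=
  continuousOn_univ.1 (hF.comp hU.continuousOn fun t _ => hU0 t)

lemma lift_weakDeriv_ae (hu : MemW1 2 u) (hu1 : ContDiff ℝ 1 (lift u)) :
    ∀ᵐ t, lift (weakDeriv u) t = deriv (lift u) t := by
  obtain ⟨-, v, -, hv⟩ := hu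
  have hex : ∃ v, IsWeakDeriv u v := ⟨v, hv⟩
  have : IsWeakDeriv u (weakDeriv u) := by
    rw [weakDeriv, dif_pos hex]; exact hex.choose_spec
  exact this.ae_eq_deriv hu1.continuous

/-- The defining equation of `𝒯^ε(u)`, in terms of smooth periodic functions on the line. -/
lemma admissible_lift (hu1 : ContDiff ℝ 1 (lift u)) (hg : g ∈ admissibleFluxes W ε u)
    {Ψ : ℝ → ℝ} (hΨ : ContDiff ℝ ∞ Ψ) (hp : Function.Periodic Ψ 1) :
    (∫ t in (0 : ℝ)..1, (pressure W (lift u t) + 3 * ε ^ 2 / 2 * deriv (lift u) t ^ 2) *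
        deriv Ψ t) + ε ^ 2 * ∫ t in (0 : ℝ)..1, lift u t * deriv (lift u) t * deriv (deriv Ψ) t =
      -∫ t in (0 : ℝ)..1, √(lift u t) * lift g t * Ψ t := by
  obtain ⟨hH, -, heq⟩ := hg
  have hae := lift_weakDeriv_ae hH hu1
  have h1 := heq (fun x => hp.lift x) (by rw [IsTest, lift_periodicLift]; exact hΨ)
  rw [distG, integral_torus, integral_torus, integral_torus] at h1
  have e1 : ∫ t in (0 : ℝ)..1, lift (fun x => (u x * dHalf W (u x) - W (u x) +
      3 * ε ^ 2 / 2 * weakDeriv u x ^ 2) * tderiv (fun x => hp.lift x) x) t =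
      ∫ t in (0 : ℝ)..1, (pressure W (lift u t) + 3 * ε ^ 2 / 2 * deriv (lift u) t ^ 2) *
        deriv Ψ t := by
    refine intervalIntegral.integral_congr_ae ?_
    filter_upwards [hae] with t ht _
    rw [← ht]
    simp only [lift]
    rw [tderiv_coe, lift_periodicLift]
    rfl
  have e2 : ∫ t in (0 : ℝ)..1, lift (fun x => u x * weakDeriv u x *
      tderiv (tderiv fun x => hp.lift x) x) t =
      ∫ t in (0 : ℝ)..1, lift u t * deriv (lift u) t * deriv (deriv Ψ) t := by
    refine intervalIntegral.integral_congr_ae ?_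
    filter_upwards [hae] with t ht _
    rw [← ht]
    simp only [lift]
    rw [tderiv_coe, lift_tderiv, lift_periodicLift]
  rw [e1, e2] at h1
  have e3 : ∫ t in (0 : ℝ)..1, lift (fun x => √(u x) * g x * hp.lift x) t =
      ∫ t in (0 : ℝ)..1, √(lift u t) * lift g t * Ψ t := rfl
  rw [e3] at h1
  linarith

lemma periodic_deriv {f : ℝ → ℝ} (hf : Function.Periodic f 1) : Function.Periodic (deriv f) 1 :=
  fun t => by
    rw [← deriv_comp_add_const]
    congr 1
    exact funext hf

/-- An admissible flux `g` comes with a continuous representative `G` of the distribution `G^ε(u)`,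
a primitive of `√u g`. The constant of integration is fixed by the mean of `G`, to which the
divergence term `(u u_x)_x` does not contribute. -/
lemma exists_flux (hW : IsPotential W) (hu0 : ∀ x, 0 ≤ u x)
    (hu1 : ContDiff ℝ 1 (lift u)) (hu4 : ContDiffOn ℝ 4 (lift u) {t | 0 < lift u t})
    (hg : g ∈ admissibleFluxes W ε u) :
    ∃ G : ℝ → ℝ, (∀ s t, G t - G s = ∫ τ in s..t, √(lift u τ) * lift g τ) ∧
      (∫ t in (0 : ℝ)..1, G t =
        ∫ t in (0 : ℝ)..1, (pressure W (lift u t) + 3 * ε ^ 2 / 2 * deriv (lift u) t ^ 2)) ∧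
      ∀ t, 0 < lift u t → ∃ u₂, HasDerivAt (deriv (lift u)) u₂ t ∧
        G t = pressure W (lift u t) + ε ^ 2 / 2 * deriv (lift u) t ^ 2 - ε ^ 2 * lift u t * u₂ := by
  set U := lift u with hU
  have hU0 : ∀ t, 0 ≤ U t := fun t => hu0 _
  have hUp : Function.Periodic U 1 := periodic_lift u
  have hUc : Continuous U := hu1.continuous
  have hU'c : Continuous (deriv U) := hu1.continuous_deriv le_rfl
  have hU'p : Function.Periodic (deriv U) 1 := periodic_deriv hUp
  have hUd : ∀ t, HasDerivAt U (deriv U t) t := fun t =>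
    (hu1.differentiable one_ne_zero t).hasDerivAt
  set P : ℝ → ℝ := fun t => pressure W (U t) + 3 * ε ^ 2 / 2 * deriv U t ^ 2 with hP
  have hPc : Continuous P :=
    (continuous_comp_of_nonneg hW.continuousOn_pressure hUc hU0).add (by fun_prop)
  have hPp : Function.Periodic P 1 := fun t => by simp only [hP, hUp t, hU'p t]
  set h : ℝ → ℝ := fun t => √(U t) * lift g t with hh
  have hhi : ∀ a b, IntervalIntegrable h volume a b := intervalIntegrable_sqrt_mul hUc hg.2.1
  have hhp : Function.Periodic h 1 := fun t => by simp only [hh, hUp t, periodic_lift g t]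
  have hadm : ∀ Ψ : ℝ → ℝ, ContDiff ℝ ∞ Ψ → Function.Periodic Ψ 1 →
      (∫ t in (0 : ℝ)..1, P t * deriv Ψ t) +
        ε ^ 2 * ∫ t in (0 : ℝ)..1, U t * deriv U t * deriv (deriv Ψ) t =
      -∫ t in (0 : ℝ)..1, h t * Ψ t := fun Ψ hΨ hΨp => admissible_lift hu1 hg hΨ hΨp
  have hh0 : ∫ t in (0 : ℝ)..1, h t = 0 := by
    have := hadm (fun _ => 1) contDiff_const (fun _ => rfl)
    simpa using this
  set K : ℝ → ℝ := fun t => ∫ s in (0 : ℝ)..t, h s with hK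
  have hKc : Continuous K := intervalIntegral.continuous_primitive hhi 0
  have hKp : Function.Periodic K 1 := periodic_primitive (hhi 0 1) hhp hh0
  set c : ℝ := ∫ t in (0 : ℝ)..1, (P t - K t) with hc
  have hYd : ∀ t, HasDerivAt (fun t => ε ^ 2 * (U t * deriv U t)) (P t - K t - c) t := by
    have hmain := eq_add_integral_of_weak (Y := fun t => ε ^ 2 * (U t * deriv U t))
      (h := fun t => P t - K t - c) (by fun_prop)
      (fun t => by simp only [hUp t, hU'p t])
      (Continuous.intervalIntegrable (by fun_prop) _ _)
      (fun t => by simp only [hPp t, hKp t])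
      (fun ψ hψ hψp => by
        -- test the equation with a primitive of `ψ` minus its mean
        set m := ∫ t in (0 : ℝ)..1, ψ t with hm
        have hψc : Continuous ψ := hψ.continuous
        set Ψ : ℝ → ℝ := fun t => ∫ s in (0 : ℝ)..t, (ψ s - m) with hΨ
        have hΨd : deriv Ψ = fun t => ψ t - m := by
          ext t
          exact (Continuous.deriv_integral (fun s => ψ s - m) (by fun_prop) 0 t)
        have hΨ' : ∀ t, HasDerivAt Ψ (ψ t - m) t := fun t =>
          intervalIntegral.integral_hasDerivAt_right
            ((show Continuous fun s => ψ s - m by fun_prop).intervalIntegrable _ _)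
            ((show Continuous fun s => ψ s - m by fun_prop).stronglyMeasurableAtFilter _ _)
            (by fun_prop)
        have hΨs : ContDiff ℝ ∞ Ψ := by
          rw [contDiff_infty_iff_deriv, hΨd]
          exact ⟨fun t => (hΨ' t).differentiableAt, hψ.sub contDiff_const⟩
        have hΨp : Function.Periodic Ψ 1 := by
          refine periodic_primitive ((show Continuous fun s => ψ s - m by
            fun_prop).intervalIntegrable _ _) (fun t => by simp only [hψp t]) ?_
          rw [intervalIntegral.integral_sub (hψc.intervalIntegrable _ _)
            (continuous_const.intervalIntegrable _ _)]
          simp [hm]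
        have h1 := hadm Ψ hΨs hΨp
        have h2 := intervalIntegral_primitive_mul_deriv (hhi 0 1)
          (hΨs.of_le (by exact_mod_cast le_top) : ContDiff ℝ 1 Ψ)
        rw [hh0, zero_mul, zero_sub] at h2
        have hΨdd : deriv (fun t => ψ t - m) = deriv ψ := by
          ext t; rw [deriv_sub_const]
        rw [hΨd, hΨdd, ← h2, hΨd] at h1
        have hψ'c : Continuous (deriv ψ) := hψ.continuous_deriv (by exact_mod_cast le_top)
        have e1 : ∫ t in (0 : ℝ)..1, (P t - K t) * (ψ t - m) =
            (∫ t in (0 : ℝ)..1, P t * (ψ t - m)) - ∫ t in (0 : ℝ)..1, K t * (ψ t - m) := by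
          rw [← intervalIntegral.integral_sub
            (Continuous.intervalIntegrable (by fun_prop) _ _)
            (Continuous.intervalIntegrable (by fun_prop) _ _)]
          simp only [sub_mul]
        have e2 : ∫ t in (0 : ℝ)..1, (P t - K t) * (ψ t - m) =
            (∫ t in (0 : ℝ)..1, (P t - K t) * ψ t) - c * m := by
          rw [hc, ← intervalIntegral.integral_mul_const, ← intervalIntegral.integral_sub
            (Continuous.intervalIntegrable (by fun_prop) _ _)
            (Continuous.intervalIntegrable (by fun_prop) _ _)]
          simp only [mul_sub]
        have e3 : ∫ t in (0 : ℝ)..1, (P t - K t - c) * ψ t =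
            (∫ t in (0 : ℝ)..1, (P t - K t) * ψ t) - c * m := by
          rw [hm, ← intervalIntegral.integral_const_mul, ← intervalIntegral.integral_sub
            (Continuous.intervalIntegrable (by fun_prop) _ _)
            (Continuous.intervalIntegrable (by fun_prop) _ _)]
          simp only [sub_mul]
        have e4 : ∫ t in (0 : ℝ)..1, ε ^ 2 * (U t * deriv U t) * deriv ψ t =
            ε ^ 2 * ∫ t in (0 : ℝ)..1, U t * deriv U t * deriv ψ t := by
          rw [← intervalIntegral.integral_const_mul]
          simp only [mul_assoc]
        have h3 : ∫ t in (0 : ℝ)..1, (∫ s in (0 : ℝ)..t, h s) * (ψ t - m) =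
          ∫ t in (0 : ℝ)..1, K t * (ψ t - m) := rfl
        rw [h3] at h1
        rw [e3, e4]
        linarith)
    intro t
    have hi : HasDerivAt (fun t => ε ^ 2 * (U 0 * deriv U 0) +
        ∫ s in (0 : ℝ)..t, (P s - K s - c)) (P t - K t - c) t := by
      refine HasDerivAt.const_add _ (intervalIntegral.integral_hasDerivAt_right
        ((show Continuous fun s => P s - K s - c by fun_prop).intervalIntegrable _ _)
        ((show Continuous fun s => P s - K s - c by fun_prop).stronglyMeasurableAtFilter _ _)
        (by fun_prop))
    rwa [← funext hmain] at hi
  refine ⟨fun t => K t + c, fun s t => ?_, ?_, fun t ht => ?_⟩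
  · simp only [hK, add_sub_add_right_eq_sub]
    exact intervalIntegral.integral_interval_sub_left (hhi _ _) (hhi _ _)
  · rw [intervalIntegral.integral_add (hKc.intervalIntegrable _ _)
      (continuous_const.intervalIntegrable _ _), intervalIntegral.integral_const, hc,
      intervalIntegral.integral_sub (hPc.intervalIntegrable _ _) (hKc.intervalIntegrable _ _)]
    simp
  · have hopen : IsOpen {t | 0 < U t} := isOpen_lt continuous_const hUc
    have hd2 : DifferentiableAt ℝ (deriv U) t :=
      ((hu4.deriv_of_isOpen (m := 1) hopen (by norm_num)).differentiableOn
        one_ne_zero).differentiableAt (hopen.mem_nhds ht)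
    refine ⟨deriv (deriv U) t, hd2.hasDerivAt, ?_⟩
    have h1 := ((hUd t).mul hd2.hasDerivAt).const_mul (ε ^ 2)
    have h2 := (hYd t).unique h1
    simp only [hP] at h2
    linarith

end Flux

section Bounds

variable {W : ℝ → ℝ} {ε : ℝ} {u g : Torus → ℝ}

lemma integral_energy_le (hW : IsPotential W) (hu0 : ∀ x, 0 ≤ u x)
    (hu1 : ContDiff ℝ 1 (lift u)) {M : ℝ} (hM : 0 ≤ M) (hE : energy W ε u ≤ ENNReal.ofReal M) :
    ∫ t in (0 : ℝ)..1, (ε ^ 2 / 2 * deriv (lift u) t ^ 2 + W (lift u t)) ≤ M := by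
  have hH : MemW1 2 u := by
    by_contra hn
    rw [energy, if_neg hn] at hE
    exact absurd hE (by simp)
  rw [energy, if_pos hH, lintegral_torus] at hE
  have hae := ae_restrict_of_ae (s := Ioc 0 1) (lift_weakDeriv_ae hH hu1)
  have hWc : Continuous fun t => W (lift u t) :=
    continuous_comp_of_nonneg hW.continuousOn hu1.continuous fun t => hu0 _
  have hdc : Continuous (deriv (lift u)) := hu1.continuous_deriv le_rfl
  have hc : Continuous fun t => ε ^ 2 / 2 * deriv (lift u) t ^ 2 + W (lift u t) :=
    Continuous.add (by fun_prop) hWc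
  have e1 : ∫⁻ t in Ioc (0 : ℝ) 1, ENNReal.ofReal
      (ε ^ 2 / 2 * weakDeriv u (t : Torus) ^ 2 + W (u (t : Torus))) =
      ∫⁻ t in Ioc (0 : ℝ) 1, ENNReal.ofReal
        (ε ^ 2 / 2 * deriv (lift u) t ^ 2 + W (lift u t)) := by
    refine lintegral_congr_ae ?_
    filter_upwards [hae] with t ht
    rw [← ht]
    rfl
  rw [e1, ← ofReal_integral_eq_lintegral_ofReal hc.integrableOn_Ioc
    (Eventually.of_forall fun t => add_nonneg (by positivity) (hW.nonneg _ (hu0 _))),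
    ENNReal.ofReal_le_ofReal_iff hM] at hE
  rwa [intervalIntegral.integral_of_le zero_le_one]

lemma integral_sq_le {L : ℝ} (hL : 0 ≤ L) (hg : MemLp g 2)
    (hgL : eLpNorm g 2 volume ≤ ENNReal.ofReal L) :
    ∫ t in (0 : ℝ)..1, lift g t ^ 2 ≤ L ^ 2 := by
  rw [hg.eLpNorm_eq_integral_rpow_norm (by norm_num) (by norm_num),
    ENNReal.ofReal_le_ofReal_iff hL] at hgL
  have h2 : (2 : ℝ≥0∞).toReal = 2 := by norm_num
  simp only [h2, Real.rpow_two, Real.norm_eq_abs, sq_abs] at hgL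
  have e : ∫ x, g x ^ 2 = ∫ t in (0 : ℝ)..1, lift g t ^ 2 := integral_torus fun x => g x ^ 2
  rw [e] at hgL
  have h0 : 0 ≤ ∫ t in (0 : ℝ)..1, lift g t ^ 2 :=
    intervalIntegral.integral_nonneg zero_le_one fun t _ => sq_nonneg _
  have h3 : √(∫ t in (0 : ℝ)..1, lift g t ^ 2) ≤ L := by
    rw [Real.sqrt_eq_rpow, one_div]; exact hgL
  calc _ = √(∫ t in (0 : ℝ)..1, lift g t ^ 2) ^ 2 := (Real.sq_sqrt h0).symm
    _ ≤ L ^ 2 := pow_le_pow_left₀ (Real.sqrt_nonneg _) h3 2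

lemma exists_max_of_periodic {U : ℝ → ℝ} (hU : Continuous U) (hp : Function.Periodic U 1) :
    ∃ t ∈ Icc (0 : ℝ) 1, ∀ s, U s ≤ U t := by
  obtain ⟨t, ht, hmax⟩ := isCompact_Icc.exists_isMaxOn (nonempty_Icc.2 zero_le_one)
    (hU.continuousOn (s := Icc (0 : ℝ) 1))
  refine ⟨t, ht, fun s => ?_⟩
  obtain ⟨y, hy, hye⟩ := hp.exists_mem_Ico₀ one_pos s
  rw [hye]
  exact hmax ⟨hy.1, hy.2.le⟩

lemma second_deriv_nonpos_of_max {U : ℝ → ℝ} (hU : Continuous U) {t u₂ : ℝ}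
    (hmax : ∀ s, U s ≤ U t) (h2 : HasDerivAt (deriv U) u₂ t) : u₂ ≤ 0 := by
  by_contra hpos
  push Not at hpos
  have hM : IsLocalMax U t := Eventually.of_forall hmax
  have hm : IsLocalMin U t := isLocalMin_of_deriv_deriv_pos (by rw [h2.deriv]; exact hpos)
    hM.deriv_eq_zero hU.continuousAt
  have hconst : U =ᶠ[𝓝 t] fun _ => U t := by
    filter_upwards [hm, hM] with s h1 h2 using le_antisymm h2 h1
  have h0 : deriv U =ᶠ[𝓝 t] deriv fun _ => U t := hconst.deriv
  have := h0.deriv_eq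
  rw [h2.deriv] at this
  simp at this
  linarith

/-- Densities with bounded energy and bounded slope are bounded, uniformly in `ε`: the flux `G` is
bounded above, since its mean and its oscillation are, and `G ≥ Q'(u)` at a maximum point of `u`,
while `Q'` tends to infinity. -/
lemma exists_profile (hW : IsPotential W) {M L : ℝ} (hM : 0 ≤ M) (hL : 0 ≤ L) :
    ∃ R, 0 < R ∧ ∀ (ε : ℝ) (u g : Torus → ℝ), 0 < ε → (∀ x, 0 ≤ u x) → ∫ x, u x = 1 →
      ContDiff ℝ 1 (lift u) → ContDiffOn ℝ 4 (lift u) {t | 0 < lift u t} →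
      energy W ε u ≤ ENNReal.ofReal M → g ∈ admissibleFluxes W ε u →
      eLpNorm g 2 volume ≤ ENNReal.ofReal L →
      ∃ G, IsProfile W ε R (lift u) (deriv (lift u)) G ∧ ∀ s t, s ≤ t →
        |G t - G s| ≤ √(∫ τ in s..t, lift u τ) * √(∫ τ in s..t, lift g τ ^ 2) := by
  obtain ⟨C, hC, hgrow⟩ := hW.growth
  obtain ⟨R₀, hR₀⟩ := eventually_atTop.1
    (hW.pressure_tendsto.eventually_gt_atTop (C * (1 + M) + 3 * M + L))
  refine ⟨max R₀ 1, by positivity, fun ε u g hε hu0 hmass hu1 hu4 hE hg hgL => ?_⟩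
  obtain ⟨G, hGd, hGm, hGe⟩ := exists_flux hW hu0 hu1 hu4 hg
  set U := lift u with hU
  have hU0 : ∀ t, 0 ≤ U t := fun t => hu0 _
  have hUp : Function.Periodic U 1 := periodic_lift u
  have hUc : Continuous U := hu1.continuous
  have hU'c : Continuous (deriv U) := hu1.continuous_deriv le_rfl
  have hUd : ∀ t, HasDerivAt U (deriv U t) t := fun t =>
    (hu1.differentiable one_ne_zero t).hasDerivAt
  have hUm : ∫ t in (0 : ℝ)..1, U t = 1 := by rw [← integral_torus]; exact hmass
  have hhi := intervalIntegrable_sqrt_mul hUc hg.2.1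
  have hosc : ∀ s t, s ≤ t →
      |G t - G s| ≤ √(∫ τ in s..t, U τ) * √(∫ τ in s..t, lift g τ ^ 2) := fun s t hst => by
    rw [hGd]
    refine le_trans ?_ (intervalIntegral_sqrt_mul_abs_le hUc hU0 hg.2.1 hst)
    refine (intervalIntegral.abs_integral_le_integral_abs hst).trans (le_of_eq ?_)
    simp only [abs_mul, abs_of_nonneg (Real.sqrt_nonneg _)]
  have hGc : Continuous G := by
    have : G = fun t => G 0 + ∫ τ in (0 : ℝ)..t, √(U τ) * lift g τ := by
      ext t; rw [← hGd 0 t]; ring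
    rw [this]
    exact continuous_const.add (intervalIntegral.continuous_primitive hhi 0)
  have hsq : ∫ t in (0 : ℝ)..1, lift g t ^ 2 ≤ L ^ 2 := integral_sq_le hL hg.2.1 hgL
  have hbound : ∀ s ∈ Icc (0 : ℝ) 1, ∀ t ∈ Icc (0 : ℝ) 1, s ≤ t → |G t - G s| ≤ L := by
    intro s hs t ht hst
    refine (hosc s t hst).trans ?_
    have h1 : ∫ τ in s..t, U τ ≤ 1 := by
      rw [← hUm]
      exact intervalIntegral.integral_mono_interval hs.1 hst ht.2
        (Eventually.of_forall fun τ => hU0 τ) (hUc.intervalIntegrable _ _)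
    have h2 : ∫ τ in s..t, lift g τ ^ 2 ≤ L ^ 2 := by
      refine le_trans ?_ hsq
      exact intervalIntegral.integral_mono_interval hs.1 hst ht.2
        (Eventually.of_forall fun τ => sq_nonneg _) (intervalIntegrable_sq_lift hg.2.1 _ _)
    calc _ ≤ 1 * L := mul_le_mul (Real.sqrt_le_one.2 h1)
          (Real.sqrt_le_iff.2 ⟨hL, h2⟩) (Real.sqrt_nonneg _) zero_le_one
      _ = L := one_mul L
  obtain ⟨t₀, ht₀, hmax⟩ := exists_max_of_periodic hUc hUp
  have hpos : 0 < U t₀ := by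
    by_contra hn
    have : ∀ s, U s = 0 := fun s => le_antisymm ((hmax s).trans (not_lt.1 hn)) (hU0 s)
    simp [this] at hUm
  have hmean : ∫ t in (0 : ℝ)..1, G t ≤ C * (1 + M) + 3 * M := by
    rw [hGm]
    have hWc : Continuous fun t => W (U t) := continuous_comp_of_nonneg hW.continuousOn hUc hU0
    have hPc : Continuous fun t => pressure W (U t) :=
      continuous_comp_of_nonneg hW.continuousOn_pressure hUc hU0
    have hEc : Continuous fun t => ε ^ 2 / 2 * deriv U t ^ 2 + W (U t) :=
      Continuous.add (by fun_prop) hWc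
    have hCc : Continuous fun t => C * W (U t) := continuous_const.mul hWc
    have hCc' : Continuous fun t => C + C * W (U t) := continuous_const.add hCc
    have hEc' : Continuous fun t => 3 * (ε ^ 2 / 2 * deriv U t ^ 2 + W (U t)) :=
      continuous_const.mul hEc
    have hEn := integral_energy_le hW hu0 hu1 hM hE
    rw [← hU] at hEn
    have hWn : ∀ t, 0 ≤ W (U t) := fun t => hW.nonneg _ (hU0 t)
    have h1 : ∫ t in (0 : ℝ)..1, W (U t) ≤ M := by
      refine le_trans ?_ hEn
      exact intervalIntegral.integral_mono_on zero_le_one (hWc.intervalIntegrable _ _)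
        (hEc.intervalIntegrable _ _)
        fun t _ => le_add_of_nonneg_left (by positivity)
    calc _ ≤ ∫ t in (0 : ℝ)..1, ((C + C * W (U t)) +
          3 * (ε ^ 2 / 2 * deriv U t ^ 2 + W (U t))) := by
          refine intervalIntegral.integral_mono_on zero_le_one
            ((hPc.add (by fun_prop)).intervalIntegrable _ _)
            ((hCc'.add hEc').intervalIntegrable _ _)
            fun t _ => ?_
          have := (le_abs_self _).trans (hgrow (U t) (hU0 t)).1
          have := hWn t
          nlinarith
      _ = (C + C * ∫ t in (0 : ℝ)..1, W (U t)) +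
          3 * ∫ t in (0 : ℝ)..1, (ε ^ 2 / 2 * deriv U t ^ 2 + W (U t)) := by
          rw [intervalIntegral.integral_add (hCc'.intervalIntegrable _ _)
            (hEc'.intervalIntegrable _ _),
            intervalIntegral.integral_add (continuous_const.intervalIntegrable _ _)
            (hCc.intervalIntegrable _ _),
            intervalIntegral.integral_const_mul, intervalIntegral.integral_const_mul]
          simp
      _ ≤ (C + C * M) + 3 * M := by gcongr
      _ = _ := by ring
  have hGt : G t₀ ≤ C * (1 + M) + 3 * M + L := by
    have : G t₀ - L ≤ ∫ t in (0 : ℝ)..1, G t := by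
      calc G t₀ - L = ∫ t in (0 : ℝ)..1, (G t₀ - L) := by simp
        _ ≤ _ := intervalIntegral.integral_mono_on zero_le_one
          (continuous_const.intervalIntegrable _ _) (hGc.intervalIntegrable _ _) fun s hs => by
            rcases le_total s t₀ with h | h
            · have := (abs_le.1 (hbound s hs t₀ ht₀ h)).2
              linarith
            · have := (abs_le.1 (hbound t₀ ht₀ s hs h)).1
              linarith
    linarith
  have hUR : U t₀ ≤ R₀ := by
    by_contra hn
    push Not at hn
    obtain ⟨u₂, h2, hG⟩ := hGe t₀ hpos
    have h3 := second_deriv_nonpos_of_max hUc hmax h2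
    have h4 := hR₀ _ hn.le
    have h5 : 0 ≤ -(ε ^ 2 * U t₀ * u₂) := by
      have : 0 ≤ ε ^ 2 * U t₀ := by positivity
      nlinarith
    have h6 : 0 ≤ ε ^ 2 / 2 * deriv U t₀ ^ 2 := by positivity
    linarith
  exact ⟨G, ⟨hε, hUd, hU'c, hU0, fun x => (hmax x).trans (hUR.trans (le_max_left _ _)), hGe⟩, hosc⟩

end Bounds

/-! ### Wasserstein convergence -/

section Wasserstein

/-- Closeness in the Wasserstein distance implies closeness in the sense of Lévy and Prokhorov. -/
lemma measure_le_of_wasserstein2_lt {μ ν : Measure Torus} {r η : ℝ} (hr : 0 < r) (hη : 0 < η)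
    (h : wasserstein2 μ ν < ENNReal.ofReal (r * √η)) {A : Set Torus} (hA : IsClosed A) :
    μ A ≤ ν (Metric.cthickening r A) + ENNReal.ofReal η ∧
      ν A ≤ μ (Metric.cthickening r A) + ENNReal.ofReal η := by
  have h1 : (⨅ π ∈ {π : Measure (Torus × Torus) | π.map Prod.fst = μ ∧ π.map Prod.snd = ν},
      ∫⁻ z, edist z.1 z.2 ^ 2 ∂π) < ENNReal.ofReal (r ^ 2) * ENNReal.ofReal η := by
    rw [wasserstein2, ← ENNReal.lt_rpow_inv_iff (by norm_num)] at h
    refine h.trans_le (le_of_eq ?_)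
    rw [ENNReal.ofReal_rpow_of_nonneg (by positivity) (by norm_num),
      ← ENNReal.ofReal_mul (by positivity)]
    norm_num
    rw [mul_pow, Real.sq_sqrt hη.le]
  obtain ⟨π, hπ⟩ := iInf_lt_iff.1 h1
  obtain ⟨⟨hπ1, hπ2⟩, hπc⟩ := iInf_lt_iff.1 hπ
  set B : Set (Torus × Torus) := {z | ENNReal.ofReal (r ^ 2) ≤ edist z.1 z.2 ^ 2} with hB
  have hm : Measurable fun z : Torus × Torus => edist z.1 z.2 ^ 2 :=
    (continuous_fst.edist continuous_snd).measurable.pow_const 2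
  have hr2 : ENNReal.ofReal (r ^ 2) ≠ 0 := by
    rw [Ne, ENNReal.ofReal_eq_zero, not_le]; positivity
  -- Chebyshev's inequality: only a mass `η` is moved by more than `r`
  have hBη : π B ≤ ENNReal.ofReal η := by
    refine (meas_ge_le_lintegral_div hm.aemeasurable hr2 ENNReal.ofReal_ne_top).trans ?_
    refine ENNReal.div_le_of_le_mul ?_
    rw [mul_comm]; exact hπc.le
  have hfar : ∀ z : Torus × Torus, z ∉ B → edist z.1 z.2 ≤ ENNReal.ofReal r := by
    intro z hz
    by_contra hc
    push Not at hc
    refine hz ?_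
    show ENNReal.ofReal (r ^ 2) ≤ edist z.1 z.2 ^ 2
    rw [ENNReal.ofReal_pow hr.le]
    gcongr
  have hT : MeasurableSet (Metric.cthickening r A) := Metric.isClosed_cthickening.measurableSet
  constructor
  · calc μ A = π (Prod.fst ⁻¹' A) := by
          rw [← hπ1, Measure.map_apply measurable_fst hA.measurableSet]
      _ ≤ π (Prod.snd ⁻¹' Metric.cthickening r A ∪ B) := by
          refine measure_mono fun z hz => ?_
          by_cases hzB : z ∈ B
          · exact Or.inr hzB
          · left
            refine Metric.mem_cthickening_of_edist_le _ z.1 r A hz ?_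
            rw [edist_comm]; exact hfar z hzB
      _ ≤ π (Prod.snd ⁻¹' Metric.cthickening r A) + π B := measure_union_le _ _
      _ ≤ _ := by
          rw [← hπ2, Measure.map_apply measurable_snd hT]
          gcongr
  · calc ν A = π (Prod.snd ⁻¹' A) := by
          rw [← hπ2, Measure.map_apply measurable_snd hA.measurableSet]
      _ ≤ π (Prod.fst ⁻¹' Metric.cthickening r A ∪ B) := by
          refine measure_mono fun z hz => ?_
          by_cases hzB : z ∈ B
          · exact Or.inr hzB
          · exact Or.inl (Metric.mem_cthickening_of_edist_le _ z.2 r A hz (hfar z hzB))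
      _ ≤ π (Prod.fst ⁻¹' Metric.cthickening r A) + π B := measure_union_le _ _
      _ ≤ _ := by
          rw [← hπ1, Measure.map_apply measurable_fst hT]
          gcongr

/-- Convergence of measures in the form used below; it follows from convergence in the Wasserstein
distance. -/
def ProkhorovTendsto (μ : ℝ → Measure Torus) (l : Filter ℝ) (ν : Measure Torus) : Prop :=
  ∀ r η : ℝ, 0 < r → 0 < η → ∀ᶠ ε in l, ∀ A : Set Torus, IsClosed A →
    μ ε A ≤ ν (Metric.cthickening r A) + ENNReal.ofReal η ∧
      ν A ≤ μ ε (Metric.cthickening r A) + ENNReal.ofReal η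

lemma prokhorovTendsto_of_wasserstein2 {μ : ℝ → Measure Torus} {l : Filter ℝ} {ν : Measure Torus}
    (h : Tendsto (fun ε => wasserstein2 (μ ε) ν) l (𝓝 0)) : ProkhorovTendsto μ l ν := by
  intro r η hr hη
  have h0 : (0 : ℝ≥0∞) < ENNReal.ofReal (r * √η) := by
    rw [ENNReal.ofReal_pos]; positivity
  filter_upwards [h.eventually (gt_mem_nhds h0)] with ε hε A hA
  exact measure_le_of_wasserstein2_lt hr hη hε hA

variable {μ : ℝ → Measure Torus} {l : Filter ℝ} {ν : Measure Torus}

lemma le_measure_of_le_cthickening_add [IsFiniteMeasure ν] {A : Set Torus} (hA : IsClosed A)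
    {c : ℝ≥0∞}
    (h : ∀ r η : ℝ, 0 < r → 0 < η → c ≤ ν (Metric.cthickening r A) + ENNReal.ofReal η) :
    c ≤ ν A := by
  have hlim : Tendsto (fun r : ℝ => ν (Metric.cthickening r A) + ENNReal.ofReal r) (𝓝[>] 0)
      (𝓝 (ν A + ENNReal.ofReal 0)) := by
    refine Tendsto.add ?_ ?_
    · exact (tendsto_measure_cthickening_of_isClosed ⟨1, one_pos, measure_ne_top _ _⟩
        hA).mono_left nhdsWithin_le_nhds
    · exact (ENNReal.continuous_ofReal.tendsto 0).mono_left nhdsWithin_le_nhds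
  rw [ENNReal.ofReal_zero, add_zero] at hlim
  refine ge_of_tendsto hlim ?_
  filter_upwards [self_mem_nhdsWithin] with r hr
  exact h r r hr hr

lemma ProkhorovTendsto.le_of_eventually_le [IsFiniteMeasure ν] [l.NeBot]
    (h : ProkhorovTendsto μ l ν) {A : Set Torus} (hA : IsClosed A) {c : ℝ≥0∞}
    (hc : ∀ᶠ ε in l, c ≤ μ ε A) : c ≤ ν A := by
  refine le_measure_of_le_cthickening_add hA fun r η hr hη => ?_
  obtain ⟨ε, h1, h2⟩ := (hc.and (h r η hr hη)).exists
  exact h1.trans (h2 A hA).1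

lemma ProkhorovTendsto.le_smul_of_eventually_le [IsFiniteMeasure ν] [l.NeBot]
    (h : ProkhorovTendsto μ l ν) {A : Set Torus} (hA : IsClosed A) {c r₀ : ℝ}
    (hr₀ : 0 < r₀)
    (hle : ∀ r, 0 < r → r < r₀ → ∀ᶠ ε in l, μ ε (Metric.cthickening r A) ≤
      ENNReal.ofReal c * volume (Metric.cthickening r A)) :
    ν A ≤ ENNReal.ofReal c * volume A := by
  have hlim : Tendsto (fun r : ℝ => ENNReal.ofReal c * volume (Metric.cthickening r A) +
      ENNReal.ofReal r) (𝓝[>] 0) (𝓝 (ENNReal.ofReal c * volume A + ENNReal.ofReal 0)) := by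
    refine Tendsto.add (ENNReal.Tendsto.const_mul ?_ (Or.inr ENNReal.ofReal_ne_top)) ?_
    · exact (tendsto_measure_cthickening_of_isClosed ⟨1, one_pos, measure_ne_top _ _⟩
        hA).mono_left nhdsWithin_le_nhds
    · exact (ENNReal.continuous_ofReal.tendsto 0).mono_left nhdsWithin_le_nhds
  rw [ENNReal.ofReal_zero, add_zero] at hlim
  refine ge_of_tendsto hlim ?_
  filter_upwards [Ioo_mem_nhdsGT hr₀] with r hr
  obtain ⟨ε, h1, h2⟩ := ((hle r hr.1 hr.2).and (h r r hr.1 hr.1)).exists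
  exact (h2 A hA).2.trans (by gcongr)

lemma measure_le_smul_volume [IsFiniteMeasure ν] {c : ℝ}
    (h : ∀ A : Set Torus, IsClosed A → ν A ≤ ENNReal.ofReal c * volume A) {A : Set Torus}
    (hA : MeasurableSet A) : ν A ≤ ENNReal.ofReal c * volume A := by
  rw [hA.measure_eq_iSup_isClosed_of_ne_top (measure_ne_top ν A)]
  refine iSup_le fun K => iSup_le fun hK => iSup_le fun hKc => ?_
  exact (h K hKc).trans (by gcongr)

end Wasserstein

/-! ### Arcs -/

section Arcs

lemma dist_coe_le (s t : ℝ) : dist (s : Torus) (t : Torus) ≤ |s - t| := by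
  rw [dist_eq_norm, ← AddCircle.coe_sub]
  exact QuotientAddGroup.norm_mk_le_norm

lemma exists_coe_of_mem_closedBall {x : Torus} {t h : ℝ}
    (hx : x ∈ Metric.closedBall (t : Torus) h) :
    ∃ s : ℝ, (s : Torus) = x ∧ |s - t| ≤ h := by
  obtain ⟨s, rfl⟩ := QuotientAddGroup.mk_surjective x
  have hs : s ∈ QuotientAddGroup.mk ⁻¹' Metric.closedBall (t : Torus) h := hx
  rw [AddCircle.coe_real_preimage_closedBall_eq_iUnion] at hs
  obtain ⟨z, hz⟩ := mem_iUnion.1 hs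
  refine ⟨s - z • (1 : ℝ), ?_, ?_⟩
  · rw [AddCircle.coe_sub, AddCircle.coe_zsmul, AddCircle.coe_period, smul_zero, sub_zero]
  · rw [Metric.mem_closedBall, Real.dist_eq] at hz
    rwa [sub_sub, add_comm]

lemma cthickening_closedBall_subset {x : Torus} {h r : ℝ} (hr : 0 ≤ r) :
    Metric.cthickening r (Metric.closedBall x h) ⊆ Metric.closedBall x (h + r) := by
  intro y hy
  rw [Metric.isClosed_closedBall.isCompact.cthickening_eq_biUnion_closedBall hr] at hy
  obtain ⟨z, hz, hyz⟩ := mem_iUnion₂.1 hy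
  rw [Metric.mem_closedBall] at hz hyz ⊢
  linarith [dist_triangle y z x]

lemma intervalIntegral_le_toMeasure {u : Torus → ℝ} (hu : Continuous (lift u))
    (hu0 : ∀ x, 0 ≤ u x) {s t : ℝ} (hst : s ≤ t) (ht : t ≤ s + 1) :
    ENNReal.ofReal (∫ τ in s..t, lift u τ) ≤
      toMeasure u (Metric.closedBall (((s + t) / 2 : ℝ) : Torus) ((t - s) / 2)) := by
  set A := Metric.closedBall (((s + t) / 2 : ℝ) : Torus) ((t - s) / 2) with hA
  have hAm : MeasurableSet A := Metric.isClosed_closedBall.measurableSet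
  rw [toMeasure, withDensity_apply _ hAm, ← lintegral_indicator hAm,
    ← UnitAddCircle.lintegral_preimage s, intervalIntegral.integral_of_le hst,
    ofReal_integral_eq_lintegral_ofReal hu.integrableOn_Ioc
      (Eventually.of_forall fun τ => hu0 _)]
  calc _ ≤ ∫⁻ τ in Ioc s t, A.indicator (fun x => ENNReal.ofReal (u x)) (τ : Torus) := by
        refine setLIntegral_mono' measurableSet_Ioc fun τ hτ => ?_
        have hmem : (τ : Torus) ∈ A := by
          rw [hA, Metric.mem_closedBall]
          refine (dist_coe_le _ _).trans ?_
          rw [abs_le]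
          constructor <;> linarith [hτ.1, hτ.2]
        rw [indicator_of_mem hmem]
        rfl
    _ ≤ _ := lintegral_mono_set (Ioc_subset_Ioc_right ht)

lemma toMeasure_le_of_le {u : Torus → ℝ} {A : Set Torus} (hA : MeasurableSet A) {c : ℝ}
    (h : ∀ x ∈ A, u x ≤ c) : toMeasure u A ≤ ENNReal.ofReal c * volume A := by
  rw [toMeasure, withDensity_apply _ hA, ← setLIntegral_const]
  exact setLIntegral_mono' hA fun x hx => ENNReal.ofReal_le_ofReal (h x hx)

lemma le_toMeasure_of_le {u : Torus → ℝ} {A : Set Torus} (hA : MeasurableSet A) {c : ℝ}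
    (h : ∀ x ∈ A, c ≤ u x) : ENNReal.ofReal c * volume A ≤ toMeasure u A := by
  rw [toMeasure, withDensity_apply _ hA, ← setLIntegral_const]
  exact setLIntegral_mono' hA fun x hx => ENNReal.ofReal_le_ofReal (h x hx)

end Arcs

/-! ### Auxiliary real analysis -/

section RealAnalysis

lemma exists_tendsto_ultrafilter {l : Ultrafilter ℝ} {f : ℝ → ℝ} {K : Set ℝ} (hK : IsCompact K)
    (h : ∀ᶠ i in (l : Filter ℝ), f i ∈ K) : ∃ x ∈ K, Tendsto f l (𝓝 x) :=
  hK.ultrafilter_le_nhds' (l.map f) h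

/-- If `p` is continuous and stays `κ`-close to `G` wherever its value lies outside a set `N`, then
the increments of `p` are controlled by the oscillation of `G` and the measure of `N`: between its
end points `p` takes all values, and those outside `N` are within `κ` of the range of `G`. -/
lemma abs_sub_le_of_close_off {p G : ℝ → ℝ} (hp : Continuous p) {N : Set ℝ} {κ η D a b : ℝ}
    (hη : 0 ≤ η) (hκ : 0 ≤ κ) (hN : volume N ≤ ENNReal.ofReal η)
    (hclose : ∀ x, p x ∉ N → |G x - p x| ≤ κ) (hab : a ≤ b)
    (hG : ∀ s ∈ Icc a b, ∀ t ∈ Icc a b, |G s - G t| ≤ D) :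
    |p b - p a| ≤ D + 2 * κ + η := by
  have ha : a ∈ Icc a b := left_mem_Icc.2 hab
  have hD : 0 ≤ D := (abs_nonneg _).trans (hG a ha a ha)
  set m := sInf (G '' Icc a b) with hm
  have hbdd : BddBelow (G '' Icc a b) := ⟨G a - D, by
    rintro _ ⟨t, ht, rfl⟩
    linarith [(abs_le.1 (hG a ha t ht)).2]⟩
  have hlow : ∀ t ∈ Icc a b, m ≤ G t := fun t ht => csInf_le hbdd ⟨t, ht, rfl⟩
  have hup : ∀ t ∈ Icc a b, G t ≤ m + D := by
    intro t ht
    have : G t - D ≤ m := le_csInf ⟨_, a, ha, rfl⟩ (by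
      rintro _ ⟨s, hs, rfl⟩
      linarith [(abs_le.1 (hG t ht s hs)).2])
    linarith
  have hsub : uIcc (p a) (p b) ⊆ N ∪ Icc (m - κ) (m + D + κ) := by
    intro v hv
    obtain ⟨t, ht, rfl⟩ := intermediate_value_uIcc (hp.continuousOn (s := uIcc a b)) hv
    rw [uIcc_of_le hab] at ht
    by_cases hvN : p t ∈ N
    · exact Or.inl hvN
    · right
      have h1 := abs_le.1 (hclose t hvN)
      have h2 := hlow t ht
      have h3 := hup t ht
      constructor <;> linarith
  have hvol : ENNReal.ofReal |p b - p a| ≤ ENNReal.ofReal (η + (D + 2 * κ)) := by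
    calc _ = volume (uIcc (p a) (p b)) := by rw [Real.volume_interval]
      _ ≤ volume N + volume (Icc (m - κ) (m + D + κ)) :=
          (measure_mono hsub).trans (measure_union_le _ _)
      _ ≤ ENNReal.ofReal η + ENNReal.ofReal (D + 2 * κ) := by
          rw [Real.volume_Icc]
          gcongr
          linarith
      _ = _ := (ENNReal.ofReal_add hη (by positivity)).symm
  rw [ENNReal.ofReal_le_ofReal_iff (by positivity)] at hvol
  linarith

/-- The points of a level set with nonzero derivative are isolated, hence countably many. -/
lemma ae_deriv_eq_zero_of_mem_countable (q : ℝ → ℝ) {C : Set ℝ} (hC : C.Countable) :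
    ∀ᵐ t, q t ∈ C → DifferentiableAt ℝ q t → deriv q t = 0 := by
  have hsingle : ∀ c : ℝ,
      ({t | q t = c ∧ DifferentiableAt ℝ q t ∧ deriv q t ≠ 0} : Set ℝ).Countable := by
    intro c
    set S : Set ℝ := {t | q t = c ∧ DifferentiableAt ℝ q t ∧ deriv q t ≠ 0} with hS
    have hdisc : DiscreteTopology S := by
      rw [discreteTopology_subtype_iff]
      intro t ht
      have h1 := ht.2.1.hasDerivAt.eventually_ne (c := c) ht.2.2
      rw [← disjoint_iff, disjoint_principal_right]
      filter_upwards [h1] with z hz hzS using hz hzS.1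
    have : Countable S := countable_of_Lindelof_of_discrete
    exact this
  have hcount : (⋃ c ∈ C, {t | q t = c ∧ DifferentiableAt ℝ q t ∧ deriv q t ≠ 0}).Countable :=
    hC.biUnion fun c _ => hsingle c
  filter_upwards [hcount.ae_notMem volume] with t ht hq hd
  by_contra hne
  exact ht (mem_iUnion₂.2 ⟨q t, hq, rfl, hd, hne⟩)

lemma tendsto_symm_slope {q : ℝ → ℝ} {q' t : ℝ} (h : HasDerivAt q q' t) :
    Tendsto (fun r => (q (t + r) - q (t - r)) / (2 * r)) (𝓝[>] 0) (𝓝 q') := by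
  have h1 : HasDerivAt (fun r => q (t + r)) q' 0 := by
    have := HasDerivAt.comp_const_add t 0 (f := q) (f' := q') (by simpa using h)
    exact this
  have h2 : HasDerivAt (fun r => q (t - r)) (-q') 0 := by
    have := HasDerivAt.comp_const_sub t 0 (f := q) (f' := q') (by simpa using h)
    exact this
  have h3 := ((h1.sub h2).hasDerivWithinAt (s := Ioi 0))
  rw [hasDerivWithinAt_iff_tendsto_slope' self_notMem_Ioi] at h3
  have h4 := h3.div_const 2
  have e : (q' - -q') / 2 = q' := by ring
  rw [e] at h4
  refine h4.congr' ?_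
  filter_upwards [self_mem_nhdsWithin] with r hr
  have hr0 : r ≠ 0 := ne_of_gt hr
  simp only [slope_def_field, Pi.sub_apply, add_zero, sub_zero, sub_self]
  field_simp

/-- Absolute continuity of a function whose increments satisfy `|Δq|² ≤ R |Δt| |ΔM|` with `M` of
bounded variation. -/
lemma absolutelyContinuousOnInterval_of_sqrt_bound {q M : ℝ → ℝ} {R L : ℝ} (hR : 0 ≤ R)
    (hL : 0 ≤ L)
    (hq : ∀ s ∈ Icc (0 : ℝ) 1, ∀ t ∈ Icc (0 : ℝ) 1, |q t - q s| ≤ √(R * |t - s|) * √|M t - M s|)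
    (hM : ∀ E ∈ AbsolutelyContinuousOnInterval.disjWithin 0 1,
      ∑ i ∈ Finset.range E.1, |M (E.2 i).2 - M (E.2 i).1| ≤ L) :
    AbsolutelyContinuousOnInterval q 0 1 := by
  rw [absolutelyContinuousOnInterval_iff]
  intro ε hε
  refine ⟨ε ^ 2 / (2 * (R + 1) * (L + 1)), by positivity, fun E hE hlen => ?_⟩
  have hmem : ∀ i ∈ Finset.range E.1, (E.2 i).1 ∈ Icc (0 : ℝ) 1 ∧ (E.2 i).2 ∈ Icc (0 : ℝ) 1 := by
    intro i hi
    have := hE.1 i hi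
    rwa [uIcc_of_le zero_le_one] at this
  have hd : ∑ i ∈ Finset.range E.1, |(E.2 i).2 - (E.2 i).1| < ε ^ 2 / (2 * (R + 1) * (L + 1)) := by
    refine lt_of_le_of_lt (le_of_eq (Finset.sum_congr rfl fun i _ => ?_)) hlen
    rw [Real.dist_eq, abs_sub_comm]
  set X := ∑ i ∈ Finset.range E.1, |(E.2 i).2 - (E.2 i).1| with hX
  have hX0 : 0 ≤ X := Finset.sum_nonneg fun i _ => abs_nonneg _
  calc ∑ i ∈ Finset.range E.1, dist (q (E.2 i).1) (q (E.2 i).2)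
      ≤ ∑ i ∈ Finset.range E.1, √(R * |(E.2 i).2 - (E.2 i).1|) * √|M (E.2 i).2 - M (E.2 i).1| := by
        refine Finset.sum_le_sum fun i hi => ?_
        rw [Real.dist_eq, abs_sub_comm]
        exact hq _ (hmem i hi).1 _ (hmem i hi).2
    _ ≤ √(∑ i ∈ Finset.range E.1, R * |(E.2 i).2 - (E.2 i).1|) *
          √(∑ i ∈ Finset.range E.1, |M (E.2 i).2 - M (E.2 i).1|) :=
        Real.sum_sqrt_mul_sqrt_le _ (fun i => by positivity) (fun i => abs_nonneg _)
    _ ≤ √(R * X) * √L := by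
        rw [← Finset.mul_sum]
        gcongr
        exact hM E hE
    _ = √(R * X * L) := (Real.sqrt_mul (by positivity) _).symm
    _ < ε := by
        rw [Real.sqrt_lt' hε]
        rw [lt_div_iff₀ (by positivity)] at hd
        have : R * X * L ≤ X * (2 * (R + 1) * (L + 1)) := by
          have h1 : R * L ≤ 2 * (R + 1) * (L + 1) := by nlinarith [mul_nonneg hR hL]
          nlinarith
        linarith

end RealAnalysis

/-! ### Limits of profiles -/

section ProfileLimit

lemma intervalIntegral_sq_lift_le {g : Torus → ℝ} (hg : MemLp g 2) {L : ℝ}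
    (hgL : ∫ t in (0 : ℝ)..1, lift g t ^ 2 ≤ L ^ 2) {s t : ℝ} (ht : t ≤ s + 1) :
    ∫ τ in s..t, lift g τ ^ 2 ≤ L ^ 2 := by
  have hi := intervalIntegrable_sq_lift hg
  have hp : Function.Periodic (fun τ => lift g τ ^ 2) 1 := fun τ => by
    simp only [periodic_lift g τ]
  have h1 := hp.intervalIntegral_add_eq s 0
  rw [zero_add] at h1
  have h2 := intervalIntegral.integral_add_adjacent_intervals (hi s t) (hi t (s + 1))
  have h3 : 0 ≤ ∫ τ in t..(s + 1), lift g τ ^ 2 :=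
    intervalIntegral.integral_nonneg ht fun _ _ => sq_nonneg _
  linarith

/-- A family of profiles `u ε`, indexed along an ultrafilter tending to `0⁺`, whose fluxes `G ε`
are controlled by functions `g ε` bounded in `L²`. -/
structure ProfileFamily (W : ℝ → ℝ) (𝒰 : Ultrafilter ℝ) (R L : ℝ) (u g : ℝ → Torus → ℝ)
    (G : ℝ → ℝ → ℝ) : Prop where
  le_nhds : (𝒰 : Filter ℝ) ≤ 𝓝[>] 0
  R_pos : 0 < R
  L_nonneg : 0 ≤ L
  profile : ∀ᶠ ε in (𝒰 : Filter ℝ), IsProfile W ε R (lift (u ε)) (deriv (lift (u ε))) (G ε)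
  memLp : ∀ᶠ ε in (𝒰 : Filter ℝ), MemLp (g ε) 2
  sq_le : ∀ᶠ ε in (𝒰 : Filter ℝ), ∫ t in (0 : ℝ)..1, lift (g ε) t ^ 2 ≤ L ^ 2
  flux : ∀ᶠ ε in (𝒰 : Filter ℝ), ∀ s t, s ≤ t →
    |G ε t - G ε s| ≤ √(∫ τ in s..t, lift (u ε) τ) * √(∫ τ in s..t, lift (g ε) τ ^ 2)

namespace IsProfile

variable {W : ℝ → ℝ} {ε R : ℝ} {u : Torus → ℝ} {u' G : ℝ → ℝ}

lemma continuous_lift (h : IsProfile W ε R (lift u) u' G) : Continuous (lift u) :=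
  continuous_iff_continuousAt.2 fun x => (h.hasDerivAt x).continuousAt

lemma torus_nonneg (h : IsProfile W ε R (lift u) u' G) (x : Torus) : 0 ≤ u x := by
  obtain ⟨t, rfl⟩ := QuotientAddGroup.mk_surjective x
  exact h.nonneg t

lemma torus_le (h : IsProfile W ε R (lift u) u' G) (x : Torus) : u x ≤ R := by
  obtain ⟨t, rfl⟩ := QuotientAddGroup.mk_surjective x
  exact h.le t

lemma integral_mem (h : IsProfile W ε R (lift u) u' G) {s t : ℝ} (hst : s ≤ t) :
    ∫ τ in s..t, lift u τ ∈ Icc 0 (R * (t - s)) := by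
  constructor
  · exact intervalIntegral.integral_nonneg hst fun τ _ => h.nonneg τ
  · calc ∫ τ in s..t, lift u τ ≤ ∫ _ in s..t, R :=
          intervalIntegral.integral_mono_on hst (h.continuous_lift.intervalIntegrable _ _)
            intervalIntegrable_const fun τ _ => h.le τ
      _ = R * (t - s) := by
          rw [intervalIntegral.integral_const, smul_eq_mul, mul_comm]

end IsProfile

namespace ProfileFamily

variable {W : ℝ → ℝ} {𝒰 : Ultrafilter ℝ} {R L : ℝ} {u g : ℝ → Torus → ℝ} {G : ℝ → ℝ → ℝ}

/-- Up to an error that vanishes in the limit, the pressure of the convex envelope inherits the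
modulus of continuity of the flux. The values where the two are not known to be close form a set of
small measure, which contributes little to the increments. -/
lemma pressure_sub_le (h : ProfileFamily W 𝒰 R L u g G) (hW : IsPotential W) {η : ℝ}
    (hη : 0 < η) : ∀ᶠ ε in (𝒰 : Filter ℝ), ∀ s t, s ≤ t → t ≤ s + 1 →
      |pressure (convexEnvelope W) (lift (u ε) t) - pressure (convexEnvelope W) (lift (u ε) s)| ≤
        √(∫ τ in s..t, lift (u ε) τ) * √(∫ τ in s..t, lift (g ε) τ ^ 2) + η := by
  set Q := pressure (convexEnvelope W) with hQ
  obtain ⟨N, hN1, hN2, hN3⟩ := (Q '' unstableSet W).exists_isOpen_lt_of_lt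
    (μ := volume) (ENNReal.ofReal (η / 2)) (by
      rw [hW.volume_image_unstableSet, ENNReal.ofReal_pos]; positivity)
  obtain ⟨ε₀, hε₀, hclose⟩ := hW.exists_flux_close L h.R_pos hN2 hN1 (κ := η / 4) (by positivity)
  have hsmall : ∀ᶠ ε in (𝒰 : Filter ℝ), ε < ε₀ :=
    h.le_nhds (mem_nhdsWithin_of_mem_nhds (Iio_mem_nhds hε₀))
  filter_upwards [hsmall, h.profile, h.memLp, h.sq_le, h.flux] with ε h1 hp hg hgL hG s t hst ht
  have hi := intervalIntegrable_sq_lift hg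
  have hmod : ∀ x y, x ≤ y → y ≤ x + 1 → |G ε y - G ε x| ≤ L * √(R * (y - x)) := by
    intro x y hxy hy
    refine (hG x y hxy).trans ?_
    rw [mul_comm]
    refine mul_le_mul ?_ (Real.sqrt_le_sqrt (hp.integral_mem hxy).2) (Real.sqrt_nonneg _)
      h.L_nonneg
    rw [Real.sqrt_le_left h.L_nonneg]
    exact intervalIntegral_sq_lift_le hg hgL hy
  have hcl := hclose ε h1 _ _ _ hp (by
    intro x y hxy
    rw [abs_le] at hxy
    rcases le_total x y with hle | hle
    · have := hmod x y hle (by linarith)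
      rwa [abs_sub_comm, abs_sub_comm x y, abs_of_nonneg (sub_nonneg.2 hle)]
    · have := hmod y x hle (by linarith)
      rwa [abs_of_nonneg (sub_nonneg.2 hle)])
  have hpc : Continuous fun t => Q (lift (u ε) t) :=
    hW.continuousOn_pressure_envelope.comp_continuous hp.continuous_lift fun t => hp.nonneg t
  have := abs_sub_le_of_close_off hpc (κ := η / 4) (η := η / 2)
    (D := √(∫ τ in s..t, lift (u ε) τ) * √(∫ τ in s..t, lift (g ε) τ ^ 2)) (by positivity)
    (by positivity) hN3.le hcl hst (by
      have key : ∀ x ∈ Icc s t, ∀ y ∈ Icc s t, x ≤ y → |G ε y - G ε x| ≤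
          √(∫ τ in s..t, lift (u ε) τ) * √(∫ τ in s..t, lift (g ε) τ ^ 2) := by
        intro x hx y hy hxy
        refine (hG x y hxy).trans ?_
        have m1 : ∫ τ in x..y, lift (u ε) τ ≤ ∫ τ in s..t, lift (u ε) τ :=
          intervalIntegral.integral_mono_interval hx.1 hxy hy.2
            (Eventually.of_forall fun τ => hp.nonneg τ)
            (hp.continuous_lift.intervalIntegrable _ _)
        have m2 : ∫ τ in x..y, lift (g ε) τ ^ 2 ≤ ∫ τ in s..t, lift (g ε) τ ^ 2 :=
          intervalIntegral.integral_mono_interval hx.1 hxy hy.2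
            (Eventually.of_forall fun τ => sq_nonneg _) (hi _ _)
        gcongr
      intro x hx y hy
      rcases le_total x y with hxy | hxy
      · rw [abs_sub_comm]; exact key x hx y hy hxy
      · exact key y hy x hx hxy)
  linarith

lemma exists_tendsto_pressure (h : ProfileFamily W 𝒰 R L u g G) (hW : IsPotential W) :
    ∃ q : Torus → ℝ, ∀ x, q x ∈ pressure (convexEnvelope W) '' Icc 0 R ∧
      Tendsto (fun ε => pressure (convexEnvelope W) (u ε x)) 𝒰 (𝓝 (q x)) := by
  have hK : IsCompact (pressure (convexEnvelope W) '' Icc 0 R) :=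
    isCompact_Icc.image_of_continuousOn
      (hW.continuousOn_pressure_envelope.mono Icc_subset_Ici_self)
  have hex : ∀ x, ∃ y ∈ pressure (convexEnvelope W) '' Icc 0 R,
      Tendsto (fun ε => pressure (convexEnvelope W) (u ε x)) 𝒰 (𝓝 y) := fun x =>
    exists_tendsto_ultrafilter hK (h.profile.mono fun ε hp =>
      ⟨_, ⟨hp.torus_nonneg x, hp.torus_le x⟩, rfl⟩)
  choose q hq1 hq2 using hex
  exact ⟨q, fun x => ⟨hq1 x, hq2 x⟩⟩

/-- The limits of the primitives of `g²`, extended by constants outside `[0, 1]`. -/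
lemma exists_tendsto_action (h : ProfileFamily W 𝒰 R L u g G) :
    ∃ M : ℝ → ℝ, Monotone M ∧ M 1 - M 0 ≤ L ^ 2 ∧
      (∀ t ∈ Icc (0 : ℝ) 1,
        Tendsto (fun ε => ∫ τ in (0 : ℝ)..t, lift (g ε) τ ^ 2) 𝒰 (𝓝 (M t))) ∧
      ∀ E ∈ AbsolutelyContinuousOnInterval.disjWithin 0 1,
        ∑ i ∈ Finset.range E.1, |M (E.2 i).2 - M (E.2 i).1| ≤ L ^ 2 := by
  have hex : ∀ t : ℝ, ∃ y ∈ Icc 0 (L ^ 2),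
      Tendsto (fun ε => ∫ τ in (0 : ℝ)..(max 0 (min 1 t)), lift (g ε) τ ^ 2) 𝒰 (𝓝 y) := by
    intro t
    refine exists_tendsto_ultrafilter isCompact_Icc ?_
    filter_upwards [h.memLp, h.sq_le] with ε hg hgL
    have h0 : (0 : ℝ) ≤ max 0 (min 1 t) := le_max_left _ _
    refine ⟨intervalIntegral.integral_nonneg h0 fun _ _ => sq_nonneg _,
      intervalIntegral_sq_lift_le hg hgL ?_⟩
    rw [zero_add]
    exact max_le zero_le_one (min_le_left _ _)
  choose M hM1 hM2 using hex
  have hclamp : ∀ t ∈ Icc (0 : ℝ) 1, max 0 (min 1 t) = t := fun t ht => by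
    rw [min_eq_right ht.2, max_eq_right ht.1]
  have hlim : ∀ t ∈ Icc (0 : ℝ) 1,
      Tendsto (fun ε => ∫ τ in (0 : ℝ)..t, lift (g ε) τ ^ 2) 𝒰 (𝓝 (M t)) := by
    intro t ht
    have := hM2 t
    rwa [hclamp t ht] at this
  refine ⟨M, ?_, ?_, hlim, ?_⟩
  · intro s t hst
    refine le_of_tendsto_of_tendsto (hM2 s) (hM2 t) ?_
    filter_upwards [h.memLp] with ε hg
    exact intervalIntegral.integral_mono_interval le_rfl (le_max_left _ _)
      (max_le_max le_rfl (min_le_min le_rfl hst)) (Eventually.of_forall fun τ => sq_nonneg _)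
      (intervalIntegrable_sq_lift hg _ _)
  · have h1 := hM2 0
    rw [hclamp 0 (by simp)] at h1
    simp only [intervalIntegral.integral_same] at h1
    rw [tendsto_nhds_unique h1 tendsto_const_nhds, sub_zero]
    exact (hM1 1).2
  · intro E hE
    have hmem : ∀ i ∈ Finset.range E.1, (E.2 i).1 ∈ Icc (0 : ℝ) 1 ∧ (E.2 i).2 ∈ Icc (0 : ℝ) 1 := by
      intro i hi
      have := hE.1 i hi
      rwa [uIcc_of_le zero_le_one] at this
    have hsum : Tendsto (fun ε => ∑ i ∈ Finset.range E.1,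
        |(∫ τ in (0 : ℝ)..(E.2 i).2, lift (g ε) τ ^ 2) -
          ∫ τ in (0 : ℝ)..(E.2 i).1, lift (g ε) τ ^ 2|) 𝒰
        (𝓝 (∑ i ∈ Finset.range E.1, |M (E.2 i).2 - M (E.2 i).1|)) :=
      tendsto_finsetSum _ fun i hi => ((hlim _ (hmem i hi).2).sub (hlim _ (hmem i hi).1)).abs
    refine le_of_tendsto hsum ?_
    filter_upwards [h.memLp, h.sq_le] with ε hg hgL
    have hi := intervalIntegrable_sq_lift hg
    have hI : IntegrableOn (fun τ => lift (g ε) τ ^ 2) (Ioc 0 1) :=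
      (intervalIntegrable_iff_integrableOn_Ioc_of_le zero_le_one).1 (hi 0 1)
    have hsub : ∀ i ∈ Finset.range E.1, uIoc (E.2 i).1 (E.2 i).2 ⊆ Ioc (0 : ℝ) 1 := by
      intro i hi τ hτ
      rw [mem_uIoc] at hτ
      have h1 := (hmem i hi).1
      have h2 := (hmem i hi).2
      rcases hτ with hτ | hτ
      · exact ⟨h1.1.trans_lt hτ.1, hτ.2.trans h2.2⟩
      · exact ⟨h2.1.trans_lt hτ.1, hτ.2.trans h1.2⟩
    calc ∑ i ∈ Finset.range E.1, |(∫ τ in (0 : ℝ)..(E.2 i).2, lift (g ε) τ ^ 2) -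
          ∫ τ in (0 : ℝ)..(E.2 i).1, lift (g ε) τ ^ 2|
        = ∑ i ∈ Finset.range E.1, ∫ τ in uIoc (E.2 i).1 (E.2 i).2, lift (g ε) τ ^ 2 := by
          refine Finset.sum_congr rfl fun i _ => ?_
          rw [intervalIntegral.integral_interval_sub_left (hi _ _) (hi _ _),
            intervalIntegral.abs_integral_eq_abs_integral_uIoc, abs_of_nonneg]
          exact integral_nonneg fun τ => sq_nonneg _
      _ = ∫ τ in ⋃ i ∈ Finset.range E.1, uIoc (E.2 i).1 (E.2 i).2, lift (g ε) τ ^ 2 :=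
          (integral_biUnion_finset _ (fun i _ => measurableSet_uIoc) hE.2
            fun i hi => hI.mono_set (hsub i hi)).symm
      _ ≤ ∫ τ in Ioc (0 : ℝ) 1, lift (g ε) τ ^ 2 :=
          setIntegral_mono_set hI (Eventually.of_forall fun τ => sq_nonneg _)
            (iUnion₂_subset hsub).eventuallyLE
      _ ≤ L ^ 2 := by rwa [← intervalIntegral.integral_of_le zero_le_one]

/-- The limit of the modulus of continuity of the pressures, localized on an arc; `a` is the limit
of the masses of the arc. -/
lemma exists_mass_of_tendsto (h : ProfileFamily W 𝒰 R L u g G) (hW : IsPotential W)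
    {ν : Measure Torus} [IsFiniteMeasure ν]
    (hν : ProkhorovTendsto (fun ε => toMeasure (u ε)) 𝒰 ν) {q : Torus → ℝ} {M : ℝ → ℝ}
    (hq : ∀ x, Tendsto (fun ε => pressure (convexEnvelope W) (u ε x)) 𝒰 (𝓝 (q x)))
    (hM : ∀ t ∈ Icc (0 : ℝ) 1,
        Tendsto (fun ε => ∫ τ in (0 : ℝ)..t, lift (g ε) τ ^ 2) 𝒰 (𝓝 (M t)))
    {s t : ℝ} (hs : 0 ≤ s) (hst : s ≤ t) (ht : t ≤ 1) :
    ∃ a, 0 ≤ a ∧ a ≤ R * (t - s) ∧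
      ENNReal.ofReal a ≤ ν (Metric.closedBall (((s + t) / 2 : ℝ) : Torus) ((t - s) / 2)) ∧
      |lift q t - lift q s| ≤ √a * √(M t - M s) := by
  obtain ⟨a, ha, hlim⟩ := exists_tendsto_ultrafilter (l := 𝒰)
    (f := fun ε => ∫ τ in s..t, lift (u ε) τ) (isCompact_Icc (a := 0) (b := R * (t - s)))
    (h.profile.mono fun ε hp => hp.integral_mem hst)
  refine ⟨a, ha.1, ha.2, ?_, ?_⟩
  · refine le_of_forall_lt fun c hc => ?_
    obtain ⟨c', hc1, hc2⟩ := exists_between hc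
    refine hc1.trans_le (hν.le_of_eventually_le Metric.isClosed_closedBall ?_)
    have h1 : Tendsto (fun ε => ENNReal.ofReal (∫ τ in s..t, lift (u ε) τ)) 𝒰
        (𝓝 (ENNReal.ofReal a)) := (ENNReal.continuous_ofReal.tendsto a).comp hlim
    filter_upwards [h1.eventually (lt_mem_nhds hc2), h.profile] with ε h2 hp
    exact h2.le.trans (intervalIntegral_le_toMeasure hp.continuous_lift hp.torus_nonneg hst
      (by linarith))
  · refine le_of_forall_pos_le_add fun η hη => ?_
    have hd : Tendsto (fun ε => |pressure (convexEnvelope W) (lift (u ε) t) -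
        pressure (convexEnvelope W) (lift (u ε) s)|) 𝒰 (𝓝 |lift q t - lift q s|) :=
      ((hq t).sub (hq s)).abs
    have hm : Tendsto (fun ε => ∫ τ in s..t, lift (g ε) τ ^ 2) 𝒰 (𝓝 (M t - M s)) := by
      refine ((hM t ⟨hs.trans hst, ht⟩).sub (hM s ⟨hs, hst.trans ht⟩)).congr' ?_
      filter_upwards [h.memLp] with ε hg
      exact intervalIntegral.integral_interval_sub_left (intervalIntegrable_sq_lift hg _ _)
        (intervalIntegrable_sq_lift hg _ _)
    refine le_of_tendsto_of_tendsto hd ((hlim.sqrt.mul hm.sqrt).add_const η) ?_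
    filter_upwards [h.pressure_sub_le hW hη] with ε h1
    exact h1 s t hst (by linarith)

lemma measure_le_smul (h : ProfileFamily W 𝒰 R L u g G)
    {ν : Measure Torus} [IsFiniteMeasure ν]
    (hν : ProkhorovTendsto (fun ε => toMeasure (u ε)) 𝒰 ν) {A : Set Torus}
    (hA : MeasurableSet A) : ν A ≤ ENNReal.ofReal R * volume A := by
  refine measure_le_smul_volume (fun B hB => ?_) hA
  refine hν.le_smul_of_eventually_le hB one_pos fun r _ _ => ?_
  filter_upwards [h.profile] with ε hp
  exact toMeasure_le_of_le Metric.isClosed_cthickening.measurableSet fun x _ => hp.torus_le x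

lemma absolutelyContinuous (h : ProfileFamily W 𝒰 R L u g G)
    {ν : Measure Torus} [IsFiniteMeasure ν]
    (hν : ProkhorovTendsto (fun ε => toMeasure (u ε)) 𝒰 ν) : ν ≪ volume := by
  refine Measure.AbsolutelyContinuous.mk fun A hA h0 => ?_
  have := h.measure_le_smul hν hA
  rwa [h0, mul_zero, nonpos_iff_eq_zero] at this

/-- On small arcs the pressures are eventually close to their value at the centre. -/
lemma eventually_pressure_close (h : ProfileFamily W 𝒰 R L u g G) (hW : IsPotential W)
    {q : Torus → ℝ}
    (hq : ∀ x, Tendsto (fun ε => pressure (convexEnvelope W) (u ε x)) 𝒰 (𝓝 (q x)))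
    (x : Torus) {η : ℝ} (hη : 0 < η) : ∃ r > 0, ∀ᶠ ε in (𝒰 : Filter ℝ),
      ∀ y ∈ Metric.closedBall x r, |pressure (convexEnvelope W) (u ε y) - q x| < η := by
  obtain ⟨t, rfl⟩ := QuotientAddGroup.mk_surjective x
  have hL := h.L_nonneg
  have hR := h.R_pos
  have hlim : Tendsto (fun r : ℝ => √(R * r) * L) (𝓝[>] 0) (𝓝 (√(R * 0) * L)) := by
    have : Continuous fun r : ℝ => √(R * r) * L := by fun_prop
    exact (this.tendsto 0).mono_left nhdsWithin_le_nhds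
  rw [mul_zero, Real.sqrt_zero, zero_mul] at hlim
  obtain ⟨r, hr1, hr2, hr3⟩ := ((hlim.eventually (gt_mem_nhds (show 0 < η / 3 by positivity))).and
    (Ioc_mem_nhdsGT one_pos)).exists
  refine ⟨r, hr2, ?_⟩
  have hnear := (hq (t : Torus)).eventually (Metric.ball_mem_nhds _ (show 0 < η / 3 by positivity))
  filter_upwards [h.pressure_sub_le hW (show 0 < η / 3 by positivity), h.profile, h.memLp, h.sq_le,
    hnear] with ε h1 hp hg hgL hn y hy
  obtain ⟨s, rfl, hs⟩ := exists_coe_of_mem_closedBall hy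
  rw [Real.dist_eq] at hn
  have key : ∀ a b, a ≤ b → b - a ≤ r → |pressure (convexEnvelope W) (lift (u ε) b) -
      pressure (convexEnvelope W) (lift (u ε) a)| ≤ √(R * r) * L + η / 3 := by
    intro a b hab hb
    refine (h1 a b hab (by linarith)).trans ?_
    have e1 : ∫ τ in a..b, lift (u ε) τ ≤ R * r :=
      (hp.integral_mem hab).2.trans (by gcongr)
    have e2 : √(∫ τ in a..b, lift (g ε) τ ^ 2) ≤ L := by
      rw [Real.sqrt_le_left hL]
      exact intervalIntegral_sq_lift_le hg hgL (by linarith)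
    gcongr
  have h2 : |pressure (convexEnvelope W) (lift (u ε) s) -
      pressure (convexEnvelope W) (lift (u ε) t)| ≤ √(R * r) * L + η / 3 := by
    rw [abs_le] at hs
    rcases le_total s t with hst | hst
    · rw [abs_sub_comm]; exact key s t hst (by linarith)
    · exact key t s hst (by linarith)
  have h3 := abs_sub_le (pressure (convexEnvelope W) (u ε (s : Torus)))
    (pressure (convexEnvelope W) (u ε (t : Torus))) (q (t : Torus))
  have h4 : |pressure (convexEnvelope W) (u ε (s : Torus)) -
    pressure (convexEnvelope W) (u ε (t : Torus))| ≤ √(R * r) * L + η / 3 := h2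
  have h5 : |pressure (convexEnvelope W) (u ε (t : Torus)) - q (t : Torus)| < η / 3 := hn
  refine lt_of_le_of_lt h3 ?_
  linarith

end ProfileFamily

end ProfileLimit

/-! ### Weak derivatives of absolutely continuous functions on the torus -/

section WeakDerivative

lemma measurePreserving_representative :
    MeasurePreserving
      (fun x : Torus => ((AddCircle.equivIoc (1 : ℝ) 0 x : Ioc (0 : ℝ) (0 + 1)) : ℝ))
      volume (volume.restrict (Ioc (0 : ℝ) 1)) := by
  have h := (measurePreserving_subtype_coe (μa := (volume : Measure ℝ))
    (measurableSet_Ioc (a := (0 : ℝ)) (b := 0 + 1))).comp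
    (AddCircle.measurePreserving_equivIoc (1 : ℝ) (a := 0))
  have e : (volume : Measure ℝ).restrict (Ioc 0 (0 + 1)) = volume.restrict (Ioc 0 1) := by
    rw [zero_add]
  rw [← e]
  exact h

lemma coe_representative (x : Torus) :
    (((AddCircle.equivIoc (1 : ℝ) 0 x : Ioc (0 : ℝ) (0 + 1)) : ℝ) : Torus) = x :=
  (AddCircle.equivIoc (1 : ℝ) 0).symm_apply_apply x

lemma integrable_torus_of_lift {f : Torus → ℝ} (h : IntegrableOn (lift f) (Ioc 0 1)) :
    Integrable f := by
  have := measurePreserving_representative.integrable_comp_of_integrable (g := lift f) h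
  refine this.congr (Eventually.of_forall fun x => ?_)
  simp only [Function.comp_apply, lift, coe_representative]

lemma ae_torus_of_ae_Ioc {p : Torus → Prop}
    (h : ∀ᵐ t : ℝ ∂(volume.restrict (Ioc (0 : ℝ) 1)), p (t : Torus)) : ∀ᵐ x, p x := by
  filter_upwards [measurePreserving_representative.quasiMeasurePreserving.ae h] with x hx
  rwa [coe_representative] at hx

lemma absolutelyContinuousOnInterval_of_dist_le {f S : ℝ → ℝ} {C a b : ℝ}
    (hf : AbsolutelyContinuousOnInterval f a b)
    (h : ∀ s t, |S t - S s| ≤ C * |f t - f s|) : AbsolutelyContinuousOnInterval S a b := by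
  have hlim := Tendsto.const_mul C hf
  rw [mul_zero] at hlim
  refine squeeze_zero (fun E => Finset.sum_nonneg fun i _ => dist_nonneg) (fun E => ?_) hlim
  rw [Finset.mul_sum]
  exact Finset.sum_le_sum fun i _ => h _ _

lemma isWeakDeriv_of_absolutelyContinuous {q u v : Torus → ℝ}
    (hq : AbsolutelyContinuousOnInterval (lift q) 0 1)
    (hu : ∀ᵐ t ∂(volume.restrict (Ioc (0 : ℝ) 1)), lift u t = lift q t)
    (hv : ∀ᵐ t ∂(volume.restrict (Ioc (0 : ℝ) 1)), lift v t = deriv (lift q) t) :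
    IsWeakDeriv u v := by
  have hqc : ContinuousOn (lift q) (Icc 0 1) := by
    have := hq.continuousOn
    rwa [uIcc_of_le zero_le_one] at this
  have hui : IntegrableOn (lift u) (Ioc 0 1) :=
    Integrable.congr (hqc.integrableOn_Icc.mono_set Ioc_subset_Icc_self)
      (hu.mono fun t ht => ht.symm)
  have hvi : IntegrableOn (lift v) (Ioc 0 1) :=
    Integrable.congr ((intervalIntegrable_iff_integrableOn_Ioc_of_le zero_le_one).1
      hq.intervalIntegrable_deriv) (hv.mono fun t ht => ht.symm)
  refine ⟨integrable_torus_of_lift hui, integrable_torus_of_lift hvi, fun φ hφ => ?_⟩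
  have hφ1 : ContDiff ℝ 1 (lift φ) := ContDiff.of_le hφ (by exact_mod_cast le_top)
  have key := hq.integral_mul_deriv_eq_deriv_mul (g := lift φ)
    hφ1.contDiffOn.absolutelyContinuousOnInterval
  have hp1 := periodic_lift q 0
  have hp2 := periodic_lift φ 0
  rw [zero_add] at hp1 hp2
  rw [hp1, hp2, sub_self, zero_sub] at key
  rw [integral_torus, integral_torus, intervalIntegral.integral_of_le zero_le_one,
    intervalIntegral.integral_of_le zero_le_one]
  rw [intervalIntegral.integral_of_le zero_le_one,
    intervalIntegral.integral_of_le zero_le_one] at key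
  calc ∫ t in Ioc (0 : ℝ) 1, lift (fun x => u x * tderiv φ x) t
      = ∫ t in Ioc (0 : ℝ) 1, lift q t * deriv (lift φ) t := by
        refine integral_congr_ae ?_
        filter_upwards [hu] with t ht
        rw [← ht, ← tderiv_coe]; rfl
    _ = -∫ t in Ioc (0 : ℝ) 1, deriv (lift q) t * lift φ t := key
    _ = _ := by
        congr 1
        refine integral_congr_ae ?_
        filter_upwards [hv] with t ht
        rw [← ht]; rfl

end WeakDerivative

/-! ### Lebesgue points -/

section LebesguePoints

lemma volume_closedBall_torus (x : Torus) {r : ℝ} (hr : r ≤ 1 / 2) :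
    volume (Metric.closedBall x r) = ENNReal.ofReal (2 * r) := by
  rw [AddCircle.volume_closedBall, min_eq_right (by linarith)]

lemma ae_tendsto_density (ν : Measure Torus) [IsFiniteMeasure ν] :
    ∀ᵐ x, Tendsto (fun r => (ν (Metric.closedBall x r)).toReal / (2 * r)) (𝓝[>] 0)
      (𝓝 (density ν x)) := by
  filter_upwards [(IsUnifLocDoublingMeasure.vitaliFamily (volume : Measure Torus)
    1).ae_tendsto_rnDeriv ν, ν.rnDeriv_lt_top volume] with x hx hx'
  have h1 := hx.comp (IsUnifLocDoublingMeasure.tendsto_closedBall_filterAt volume (K := 1)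
    (x := x) (l := 𝓝[>] (0 : ℝ)) (fun _ => x) (fun r => r) tendsto_id (by
      filter_upwards [self_mem_nhdsWithin] with r hr
      rw [one_mul]
      exact Metric.mem_closedBall_self (le_of_lt hr)))
  refine ((ENNReal.tendsto_toReal hx'.ne).comp h1).congr' ?_
  filter_upwards [Ioc_mem_nhdsGT (show (0 : ℝ) < 1 / 2 by norm_num)] with r hr
  simp only [Function.comp_apply]
  rw [volume_closedBall_torus x hr.2, ENNReal.toReal_div,
    ENNReal.toReal_ofReal (by linarith [hr.1])]

variable {ν : Measure Torus} {x : Torus} {d c : ℝ}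

lemma density_le_of_measure_le (hd : Tendsto
    (fun r => (ν (Metric.closedBall x r)).toReal / (2 * r)) (𝓝[>] 0) (𝓝 d)) (hc : 0 ≤ c)
    {r₀ : ℝ} (hr₀ : 0 < r₀) (h : ∀ r, 0 < r → r < r₀ → ν (Metric.closedBall x r) ≤
      ENNReal.ofReal c * volume (Metric.closedBall x r)) : d ≤ c := by
  refine le_of_tendsto hd ?_
  filter_upwards [Ioo_mem_nhdsGT (show (0 : ℝ) < min r₀ (1 / 2) by positivity)] with r hr
  have h1 := h r hr.1 (hr.2.trans_le (min_le_left _ _))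
  rw [volume_closedBall_torus x (hr.2.le.trans (min_le_right _ _)), ← ENNReal.ofReal_mul hc] at h1
  have hr0 := hr.1
  rw [div_le_iff₀ (by positivity)]
  exact ENNReal.toReal_le_of_le_ofReal (by positivity) h1

lemma le_density_of_le_measure [IsFiniteMeasure ν] (hd : Tendsto
    (fun r => (ν (Metric.closedBall x r)).toReal / (2 * r)) (𝓝[>] 0) (𝓝 d)) (hc : 0 ≤ c)
    {r₀ : ℝ} (hr₀ : 0 < r₀) (h : ∀ r, 0 < r → r < r₀ →
      ENNReal.ofReal c * volume (Metric.closedBall x r) ≤ ν (Metric.closedBall x r)) : c ≤ d := by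
  refine ge_of_tendsto hd ?_
  filter_upwards [Ioo_mem_nhdsGT (show (0 : ℝ) < min r₀ (1 / 2) by positivity)] with r hr
  have h1 := h r hr.1 (hr.2.trans_le (min_le_left _ _))
  rw [volume_closedBall_torus x (hr.2.le.trans (min_le_right _ _)), ← ENNReal.ofReal_mul hc] at h1
  have hr0 := hr.1
  rw [le_div_iff₀ (by positivity)]
  exact (ENNReal.ofReal_le_iff_le_toReal (measure_ne_top _ _)).1 h1

end LebesguePoints

namespace ProfileFamily

variable {W : ℝ → ℝ} {𝒰 : Ultrafilter ℝ} {R L : ℝ} {u g : ℝ → Torus → ℝ} {G : ℝ → ℝ → ℝ}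

/-- At a Lebesgue point of the limit measure, the limit of the pressures is the pressure of the
density: the limit of the pressures is attained locally uniformly, and `pressure` is monotone, so
that an inequality between the two would force a strict inequality between densities. -/
lemma pressure_density_eq (h : ProfileFamily W 𝒰 R L u g G) (hW : IsPotential W)
    {ν : Measure Torus} [IsFiniteMeasure ν]
    (hν : ProkhorovTendsto (fun ε => toMeasure (u ε)) 𝒰 ν) {q : Torus → ℝ}
    (hq : ∀ x, q x ∈ pressure (convexEnvelope W) '' Icc 0 R ∧
      Tendsto (fun ε => pressure (convexEnvelope W) (u ε x)) 𝒰 (𝓝 (q x)))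
    {x : Torus} {d : ℝ} (hd0 : 0 ≤ d) (hd : Tendsto
      (fun r => (ν (Metric.closedBall x r)).toReal / (2 * r)) (𝓝[>] 0) (𝓝 d)) :
    pressure (convexEnvelope W) d = q x := by
  set Q := pressure (convexEnvelope W) with hQ
  have hmono : MonotoneOn Q (Ici 0) := hW.monotoneOn_pressure_envelope
  have hcont : ContinuousOn Q (Ici 0) := hW.continuousOn_pressure_envelope
  refine le_antisymm ?_ ?_
  · by_contra hlt
    push Not at hlt
    have hdpos : 0 < d := by
      refine hd0.lt_of_ne fun h0 => ?_
      obtain ⟨y, hy, hyq⟩ := (hq x).1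
      have := hmono (mem_Ici.2 le_rfl) (mem_Ici.2 hy.1) hy.1
      rw [← h0] at hlt
      linarith
    obtain ⟨c, hc, hcd⟩ : ∃ c, q x < Q c ∧ c ∈ Ioo 0 d := by
      have h1 : ContinuousAt Q d := hcont.continuousAt (Ici_mem_nhds hdpos)
      have h2 : ∀ᶠ c in 𝓝[<] d, q x < Q c :=
        (h1.eventually (lt_mem_nhds hlt)).filter_mono nhdsWithin_le_nhds
      exact (h2.and (Ioo_mem_nhdsLT hdpos)).exists
    obtain ⟨r, hr, hclose⟩ := h.eventually_pressure_close hW (fun x => (hq x).2) x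
      (sub_pos.2 hc)
    refine absurd (density_le_of_measure_le hd hcd.1.le hr fun s hs hsr => ?_) (not_le.2 hcd.2)
    refine hν.le_smul_of_eventually_le Metric.isClosed_closedBall (sub_pos.2 hsr)
      fun t ht htr => ?_
    filter_upwards [hclose, h.profile] with ε h1 hp
    refine toMeasure_le_of_le Metric.isClosed_cthickening.measurableSet fun y hy => ?_
    have h2 := h1 y (Metric.closedBall_subset_closedBall (by linarith)
      (cthickening_closedBall_subset ht.le hy))
    by_contra hcy
    push Not at hcy
    have h3 := hmono (mem_Ici.2 hcd.1.le) (mem_Ici.2 (hp.torus_nonneg y)) hcy.le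
    linarith [(abs_lt.1 h2).2]
  · by_contra hlt
    push Not at hlt
    obtain ⟨c, hc, hcd⟩ : ∃ c, Q c < q x ∧ d < c := by
      have h1 : ContinuousWithinAt Q (Ioi d) d :=
        (hcont d hd0).mono (Ioi_subset_Ici hd0)
      exact ((h1.eventually (gt_mem_nhds hlt)).and self_mem_nhdsWithin).exists
    obtain ⟨r, hr, hclose⟩ := h.eventually_pressure_close hW (fun x => (hq x).2) x
      (sub_pos.2 hc)
    have hc0 : 0 ≤ c := hd0.trans hcd.le
    refine absurd (le_density_of_le_measure hd hc0 hr fun s hs hsr => ?_) (not_le.2 hcd)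
    refine hν.le_of_eventually_le Metric.isClosed_closedBall ?_
    filter_upwards [hclose, h.profile] with ε h1 hp
    refine le_toMeasure_of_le Metric.isClosed_closedBall.measurableSet fun y hy => ?_
    have h2 := h1 y (Metric.closedBall_subset_closedBall hsr.le hy)
    by_contra hcy
    push Not at hcy
    have h3 := hmono (mem_Ici.2 (hp.torus_nonneg y)) (mem_Ici.2 hc0) hcy.le
    linarith [(abs_lt.1 h2).1]

end ProfileFamily

/-! ### The slope of the convex envelope along a continuous pressure -/

section Truncation

variable {W : ℝ → ℝ} {q r : ℝ → ℝ}

/-- The truncations of `W^{**}'(r)` are as regular as the pressure: on `[δ, ∞)` the increments of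
`Q^{**}'` are at least `δ` times those of `W^{**}'`. -/
lemma IsPotential.abs_dHalf_max_sub_le (hW : IsPotential W) (hr : ∀ t, 0 ≤ r t)
    (hq : ∀ t, pressure (convexEnvelope W) (r t) = q t) {δ : ℝ} (hδ : 0 < δ) (s t : ℝ) :
    |dHalf (convexEnvelope W) (max (r t) δ) - dHalf (convexEnvelope W) (max (r s) δ)| ≤
      |q t - q s| / δ := by
  wlog hst : r s ≤ r t generalizing s t
  · rw [abs_sub_comm, abs_sub_comm (q t)]
    exact this t s (not_le.1 hst).le
  rcases le_or_gt (r t) δ with hle | hlt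
  · rw [max_eq_right hle, max_eq_right (hst.trans hle), sub_self, abs_zero]
    positivity
  · have hy : 0 < max (r s) δ := lt_max_of_lt_right hδ
    have hyz : max (r s) δ ≤ r t := max_le hst hlt.le
    rw [max_eq_left hlt.le]
    have h1 := hW.dHalf_envelope_mono hy hyz
    have h2 := hW.pressure_envelope_sub_ge hy (hy.trans_le hyz)
    have h3 := hW.monotoneOn_pressure_envelope (mem_Ici.2 (hr s)) (mem_Ici.2 hy.le)
      (le_max_left (r s) δ)
    rw [hq] at h2 h3
    rw [abs_of_nonneg (sub_nonneg.2 h1), le_div_iff₀ hδ]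
    have h4 : δ * (dHalf (convexEnvelope W) (r t) - dHalf (convexEnvelope W) (max (r s) δ)) ≤
        max (r s) δ * (dHalf (convexEnvelope W) (r t) -
          dHalf (convexEnvelope W) (max (r s) δ)) :=
      mul_le_mul_of_nonneg_right (le_max_right _ _) (sub_nonneg.2 h1)
    linarith [le_abs_self (q t - q s)]

lemma IsPotential.continuousAt_of_notMem_flatValues (hW : IsPotential W) (hr : ∀ t, 0 ≤ r t)
    (hq : ∀ t, pressure (convexEnvelope W) (r t) = q t) {t : ℝ} (hqt : ContinuousAt q t)
    (hflat : q t ∉ flatValues W) : ContinuousAt r t := by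
  have hmono := hW.monotoneOn_pressure_envelope
  rw [ContinuousAt, tendsto_order]
  have hne : ∀ a b, 0 ≤ a → a < b → pressure (convexEnvelope W) a = q t →
      pressure (convexEnvelope W) b = q t → False := fun a b ha hab h1 h2 =>
    hflat ⟨a, b, ha, ha.trans hab.le, hab, h1, h2⟩
  constructor
  · intro a ha
    rcases lt_or_ge a 0 with h0 | h0
    · exact Eventually.of_forall fun s => h0.trans_le (hr s)
    · have h1 := hmono (mem_Ici.2 h0) (mem_Ici.2 (hr t)) ha.le
      rw [hq] at h1
      have h2 : pressure (convexEnvelope W) a < q t :=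
        h1.lt_of_ne fun he => hne a (r t) h0 ha he (hq t)
      filter_upwards [hqt.eventually (lt_mem_nhds h2)] with s hs
      by_contra hle
      push Not at hle
      have := hmono (mem_Ici.2 (hr s)) (mem_Ici.2 h0) hle
      rw [hq] at this
      linarith
  · intro b hb
    have hb0 : 0 ≤ b := (hr t).trans hb.le
    have h1 := hmono (mem_Ici.2 (hr t)) (mem_Ici.2 hb0) hb.le
    rw [hq] at h1
    have h2 : q t < pressure (convexEnvelope W) b :=
      h1.lt_of_ne fun he => hne (r t) b (hr t) hb (hq t) he.symm
    filter_upwards [hqt.eventually (gt_mem_nhds h2)] with s hs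
    by_contra hle
    push Not at hle
    have := hmono (mem_Ici.2 hb0) (mem_Ici.2 (hr s)) hle
    rw [hq] at this
    linarith

/-- The chain rule `(W^{**}'(r))_x = Q^{**}'(r)_x / r` for truncations. Only the pressure `q` is
assumed differentiable; `r` may jump, but only across flat parts of the pressure, and there `q'`
vanishes. -/
lemma IsPotential.hasDerivAt_dHalf_max (hW : IsPotential W) (hr : ∀ t, 0 ≤ r t)
    (hq : ∀ t, pressure (convexEnvelope W) (r t) = q t) {δ : ℝ} (hδ : 0 < δ) {q' t : ℝ}
    (hqt : HasDerivAt q q' t) (hflat : q t ∈ flatValues W → q' = 0)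
    (hlevel : q t = pressure (convexEnvelope W) δ → q' = 0) :
    HasDerivAt (fun s => dHalf (convexEnvelope W) (max (r s) δ))
      (if δ < r t then q' / r t else 0) t := by
  set S := fun s => dHalf (convexEnvelope W) (max (r s) δ) with hS
  have hbound : ∀ s, |S s - S t| ≤ |q s - q t| / δ := fun s =>
    hW.abs_dHalf_max_sub_le hr hq hδ t s
  by_cases h0 : q' = 0
  · have hz : (if δ < r t then q' / r t else 0) = 0 := by simp [h0]
    rw [hz, hasDerivAt_iff_isLittleO]
    rw [hasDerivAt_iff_isLittleO, h0] at hqt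
    simp only [smul_zero, sub_zero] at hqt ⊢
    refine Asymptotics.IsBigO.trans_isLittleO ?_ hqt
    refine Asymptotics.IsBigO.of_bound (1 / δ) (Eventually.of_forall fun s => ?_)
    rw [Real.norm_eq_abs, Real.norm_eq_abs, one_div_mul_eq_div]
    exact hbound s
  have hcont := hW.continuousAt_of_notMem_flatValues hr hq hqt.continuousAt fun h => h0 (hflat h)
  have hneδ : r t ≠ δ := fun h => h0 (hlevel (by rw [← hq, h]))
  rcases hneδ.lt_or_gt with hlt | hgt
  · rw [if_neg (not_lt.2 hlt.le)]
    have : S =ᶠ[𝓝 t] fun _ => dHalf (convexEnvelope W) δ := by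
      filter_upwards [hcont.eventually (gt_mem_nhds hlt)] with s hs
      rw [hS]
      simp only [max_eq_right hs.le]
    exact (hasDerivAt_const t _).congr_of_eventuallyEq this
  · rw [if_pos hgt]
    have hpos : 0 < r t := hδ.trans hgt
    have hO : (fun s => q s - q t) =O[𝓝 t] fun s => s - t := hqt.isBigO_sub
    have hSO : (fun s => S s - S t) =O[𝓝 t] fun s => s - t := by
      refine Asymptotics.IsBigO.trans ?_ hO
      refine Asymptotics.IsBigO.of_bound (1 / δ) (Eventually.of_forall fun s => ?_)
      rw [Real.norm_eq_abs, Real.norm_eq_abs, one_div_mul_eq_div]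
      exact hbound s
    have hro : (fun s => r s - r t) =o[𝓝 t] fun _ => (1 : ℝ) := by
      rw [Asymptotics.isLittleO_one_iff]
      have := hcont.tendsto.sub_const (r t)
      rwa [sub_self] at this
    have hprod : (fun s => (r s - r t) * (S s - S t)) =o[𝓝 t] fun s => s - t := by
      have := hro.mul_isBigO hSO
      simpa only [one_mul] using this
    have hdiff : (fun s => (q s - q t) - r t * (S s - S t)) =o[𝓝 t] fun s => s - t := by
      refine Asymptotics.IsBigO.trans_isLittleO ?_ hprod
      refine Asymptotics.IsBigO.of_bound 1 ?_
      filter_upwards [hcont.eventually (lt_mem_nhds hgt)] with s hs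
      have hspos : 0 < r s := hδ.trans hs
      have h1 := hW.pressure_envelope_sub_ge hpos hspos
      have h2 := hW.pressure_envelope_sub_le hpos hspos
      rw [hq, hq] at h1 h2
      have e1 : S s = dHalf (convexEnvelope W) (r s) := by rw [hS]; simp only [max_eq_left hs.le]
      have e2 : S t = dHalf (convexEnvelope W) (r t) := by rw [hS]; simp only [max_eq_left hgt.le]
      rw [one_mul, Real.norm_eq_abs, Real.norm_eq_abs, e1, e2, abs_of_nonneg (by linarith)]
      refine le_trans ?_ (le_abs_self _)
      linarith
    rw [hasDerivAt_iff_isLittleO] at hqt ⊢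
    have h3 := (hqt.sub hdiff).const_mul_left (1 / r t)
    refine h3.congr_left fun s => ?_
    simp only [smul_eq_mul]
    field_simp
    ring

end Truncation

/-! ### The lower bound -/

namespace ProfileFamily

variable {W : ℝ → ℝ} {𝒰 : Ultrafilter ℝ} {R L : ℝ} {u g : ℝ → Torus → ℝ} {G : ℝ → ℝ → ℝ}

/-- The slope of the limit is at most the bound for the `L²` norms of the `g ε`. The derivative of
the limit `q` of the pressures satisfies `q'² ≤ ρ₀ M'` almost everywhere, where `M` is the limit of
the primitives of `g²`, and `(W^{**}'(ρ₀))_x = q' / ρ₀`. -/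
lemma slopeStar_le (h : ProfileFamily W 𝒰 R L u g G) (hW : IsPotential W)
    {ν : Measure Torus} [IsFiniteMeasure ν]
    (hν : ProkhorovTendsto (fun ε => toMeasure (u ε)) 𝒰 ν) :
    slopeStar W ν ≤ ENNReal.ofReal L := by
  obtain ⟨q, hq⟩ := h.exists_tendsto_pressure hW
  obtain ⟨M, hMmono, hML, hMlim, hMsum⟩ := h.exists_tendsto_action
  have hmass : ∀ s t, 0 ≤ s → s ≤ t → t ≤ 1 → ∃ a, 0 ≤ a ∧ a ≤ R * (t - s) ∧
      ENNReal.ofReal a ≤ ν (Metric.closedBall (((s + t) / 2 : ℝ) : Torus) ((t - s) / 2)) ∧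
      |lift q t - lift q s| ≤ √a * √(M t - M s) := fun s t hs hst ht =>
    h.exists_mass_of_tendsto hW hν (fun x => (hq x).2) hMlim hs hst ht
  have hqAC : AbsolutelyContinuousOnInterval (lift q) 0 1 := by
    refine absolutelyContinuousOnInterval_of_sqrt_bound (M := M) h.R_pos.le (sq_nonneg L) ?_ hMsum
    have key : ∀ s ∈ Icc (0 : ℝ) 1, ∀ t ∈ Icc (0 : ℝ) 1, s ≤ t →
        |lift q t - lift q s| ≤ √(R * |t - s|) * √|M t - M s| := by
      intro s hs t ht hst
      obtain ⟨a, ha0, ha, -, hqa⟩ := hmass s t hs.1 hst ht.2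
      rw [abs_of_nonneg (sub_nonneg.2 hst), abs_of_nonneg (sub_nonneg.2 (hMmono hst))]
      exact hqa.trans (by gcongr)
    intro s hs t ht
    rcases le_total s t with hst | hst
    · exact key s hs t ht hst
    · rw [abs_sub_comm, abs_sub_comm t, abs_sub_comm (M t)]
      exact key t ht s hs hst
  have hd0 : ∀ x, 0 ≤ density ν x := fun x => ENNReal.toReal_nonneg
  have hleb := ae_Ioc_of_ae_torus (ae_tendsto_density ν)
  have hQd : ∀ᵐ t : ℝ ∂(volume.restrict (Ioc (0 : ℝ) 1)),
      pressure (convexEnvelope W) (density ν (t : Torus)) = q (t : Torus) := by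
    filter_upwards [hleb] with t ht
    exact h.pressure_density_eq hW hν hq (hd0 _) ht
  -- `r` is a representative of the density whose pressure equals `q` everywhere.
  obtain ⟨r, hr0, hrq, hrd⟩ : ∃ r : Torus → ℝ, (∀ x, 0 ≤ r x) ∧
      (∀ x, pressure (convexEnvelope W) (r x) = q x) ∧
      ∀ x, pressure (convexEnvelope W) (density ν x) = q x → r x = density ν x := by
    have hex : ∀ x, ∃ y, 0 ≤ y ∧ pressure (convexEnvelope W) y = q x ∧
        (pressure (convexEnvelope W) (density ν x) = q x → y = density ν x) := by
      intro x
      by_cases hx : pressure (convexEnvelope W) (density ν x) = q x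
      · exact ⟨density ν x, hd0 x, hx, fun _ => rfl⟩
      · obtain ⟨y, hy, hyq⟩ := (hq x).1
        exact ⟨y, hy.1, hyq, fun hx' => absurd hx' hx⟩
    choose r h1 h2 h3 using hex
    exact ⟨r, h1, h2, h3⟩
  have hIoo : ∀ᵐ t : ℝ ∂(volume.restrict (Ioc (0 : ℝ) 1)), t ∈ Ioo (0 : ℝ) 1 := by
    rw [← restrict_Ioo_eq_restrict_Ioc]
    exact ae_restrict_mem measurableSet_Ioo
  have hqdiff : ∀ᵐ t : ℝ ∂(volume.restrict (Ioc (0 : ℝ) 1)), DifferentiableAt ℝ (lift q) t := by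
    filter_upwards [ae_restrict_of_ae hqAC.ae_differentiableAt, hIoo] with t h1 h2
    refine h1 ?_
    rw [uIcc_of_le zero_le_one]
    exact Ioo_subset_Icc_self h2
  set w : Torus → ℝ := fun x => tderiv q x / density ν x with hw
  -- Differentiate `exists_mass_of_tendsto` on arcs shrinking to a Lebesgue point.
  have hdom : ∀ᵐ t : ℝ ∂(volume.restrict (Ioc (0 : ℝ) 1)),
      deriv (lift q) t ^ 2 ≤ density ν (t : Torus) * deriv M t := by
    filter_upwards [hleb, hIoo, hqdiff, ae_restrict_of_ae hMmono.ae_differentiableAt]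
      with t h1 h2 h3 h4
    refine le_of_tendsto_of_tendsto ((tendsto_symm_slope h3.hasDerivAt).pow 2)
      (h1.mul (tendsto_symm_slope h4.hasDerivAt)) ?_
    filter_upwards [Ioo_mem_nhdsGT (show (0 : ℝ) < min t (1 - t) from
      lt_min h2.1 (sub_pos.2 h2.2))] with s hs
    have hs1 := hs.2.trans_le (min_le_left _ _)
    have hs2 := hs.2.trans_le (min_le_right _ _)
    have hs0 := hs.1
    obtain ⟨a, ha0, -, haν, hqa⟩ := hmass (t - s) (t + s) (by linarith) (by linarith) (by linarith)
    have e1 : (t - s + (t + s)) / 2 = t := by ring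
    have e2 : (t + s - (t - s)) / 2 = s := by ring
    rw [e1, e2, ENNReal.ofReal_le_iff_le_toReal (measure_ne_top _ _)] at haν
    have hM0 : 0 ≤ M (t + s) - M (t - s) := sub_nonneg.2 (hMmono (by linarith))
    have hsq : (lift q (t + s) - lift q (t - s)) ^ 2 ≤
        (ν (Metric.closedBall (t : Torus) s)).toReal * (M (t + s) - M (t - s)) := by
      rw [← sq_abs]
      calc |lift q (t + s) - lift q (t - s)| ^ 2 ≤ (√a * √(M (t + s) - M (t - s))) ^ 2 := by
            gcongr
        _ = a * (M (t + s) - M (t - s)) := by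
            rw [mul_pow, Real.sq_sqrt ha0, Real.sq_sqrt hM0]
        _ ≤ _ := by gcongr
    rw [div_pow, div_mul_div_comm, ← sq]
    gcongr
  have hQae : ∀ᵐ x, pressure (convexEnvelope W) (density ν x) = q x := ae_torus_of_ae_Ioc hQd
  have hweak : IsWeakDeriv (fun x => pressure (convexEnvelope W) (density ν x)) (tderiv q) :=
    isWeakDeriv_of_absolutelyContinuous hqAC hQd
      (Eventually.of_forall fun t => tderiv_coe q t)
  have hW1 : MemW1 1 fun x => pressure (convexEnvelope W) (density ν x) :=
    ⟨memLp_one_iff_integrable.2 hweak.1, tderiv q, memLp_one_iff_integrable.2 hweak.2.1, hweak⟩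
  have hderiv : IsDerivOnPos (dHalf (convexEnvelope W)) (density ν) w := by
    intro δ hδ
    have hrq' : ∀ t, pressure (convexEnvelope W) (lift r t) = lift q t := fun t => hrq _
    have hSle := hW.abs_dHalf_max_sub_le (r := lift r) (q := lift q) (fun t => hr0 _) hrq' hδ
    refine isWeakDeriv_of_absolutelyContinuous
      (q := fun x => dHalf (convexEnvelope W) (max (r x) δ)) ?_ ?_ ?_
    · exact absolutelyContinuousOnInterval_of_dist_le (C := 1 / δ) hqAC fun s t => by
        rw [one_div_mul_eq_div]; exact hSle s t
    · filter_upwards [hQd] with t ht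
      simp only [lift, hrd _ ht]
    · have hflat := ae_deriv_eq_zero_of_mem_countable (lift q)
        (hW.countable_flatValues.insert (pressure (convexEnvelope W) δ))
      -- `q'` vanishes almost everywhere on the level sets that `hasDerivAt_dHalf_max` excludes
      filter_upwards [hQd, hqdiff, ae_restrict_of_ae hflat] with t h1 h2 h3
      have hS := hW.hasDerivAt_dHalf_max (r := lift r) (fun t => hr0 _) hrq' hδ h2.hasDerivAt
        (fun hf => h3 (Or.inr hf) h2) (fun hf => h3 (Or.inl hf) h2)
      have e : deriv (lift fun x => dHalf (convexEnvelope W) (max (r x) δ)) t =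
          if δ < lift r t then deriv (lift q) t / lift r t else 0 := hS.deriv
      have er : lift r t = density ν (t : Torus) := hrd _ h1
      rw [e, er]
      simp only [lift, indicator_apply, hw, tderiv_coe]
      rfl
  rw [slopeStar, if_pos ⟨h.absolutelyContinuous hν, hW1⟩]
  have hMint : IntegrableOn (deriv M) (Ioc 0 1) :=
    (intervalIntegrable_iff_integrableOn_Ioc_of_le zero_le_one).1
      (hMmono.monotoneOn _).intervalIntegrable_deriv
  have hM'0 : ∀ᵐ t : ℝ ∂(volume.restrict (Ioc (0 : ℝ) 1)), 0 ≤ deriv M t :=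
    Eventually.of_forall fun t => hMmono.deriv_nonneg
  have hMle : ∫ t in Ioc (0 : ℝ) 1, deriv M t ≤ L ^ 2 := by
    have h1 := (hMmono.monotoneOn (uIcc 0 1)).intervalIntegral_deriv_mem_uIcc
    rw [uIcc_of_le (sub_nonneg.2 (hMmono zero_le_one)),
      intervalIntegral.integral_of_le zero_le_one] at h1
    exact h1.2.trans hML
  have hbound : ∫⁻ x, ENNReal.ofReal (density ν x * w x ^ 2) ≤ ENNReal.ofReal (L ^ 2) := by
    rw [lintegral_torus]
    calc _ ≤ ∫⁻ t in Ioc (0 : ℝ) 1, ENNReal.ofReal (deriv M t) := by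
          refine lintegral_mono_ae ?_
          filter_upwards [hdom, hM'0] with t h1 h2
          refine ENNReal.ofReal_le_ofReal ?_
          simp only [hw, tderiv_coe]
          rcases (hd0 (t : Torus)).eq_or_lt with h3 | h3
          · rw [← h3, zero_mul]; exact h2
          · rw [div_pow, sq (density ν (t : Torus)), mul_div_assoc', mul_div_mul_left _ _ h3.ne',
              div_le_iff₀ h3, mul_comm]
            exact h1
      _ = ENNReal.ofReal (∫ t in Ioc (0 : ℝ) 1, deriv M t) :=
          (ofReal_integral_eq_lintegral_ofReal hMint hM'0).symm
      _ ≤ _ := ENNReal.ofReal_le_ofReal hMle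
  calc _ ≤ ENNReal.ofReal (L ^ 2) ^ (1 / 2 : ℝ) :=
        ENNReal.rpow_le_rpow ((iInf₂_le w hderiv).trans hbound) (by norm_num)
    _ = ENNReal.ofReal L := by
        rw [ENNReal.ofReal_rpow_of_nonneg (sq_nonneg L) (by norm_num), ← Real.sqrt_eq_rpow,
          Real.sqrt_sq h.L_nonneg]

end ProfileFamily

end SlopeLiminf
open SlopeLiminf

theorem theorem3p2 (W : ℝ → ℝ) (hW : IsPotential W)
    (ρ : ℝ → Torus → ℝ) (ρ₀ : Measure Torus) [IsProbabilityMeasure ρ₀]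
    (hρ_nonneg : ∀ ε, 0 < ε → ∀ x, 0 ≤ ρ ε x)
    (hρ_mass : ∀ ε, 0 < ε → ∫ x, ρ ε x = 1)
    (hρ_C1 : ∀ ε, 0 < ε → ContDiff ℝ 1 (lift (ρ ε)))
    (hρ_C4 : ∀ ε, 0 < ε → ContDiffOn ℝ 4 (lift (ρ ε)) {t | 0 < lift (ρ ε) t})
    (hρ_lim : Tendsto (fun ε => wasserstein2 (toMeasure (ρ ε)) ρ₀) (𝓝[>] 0) (𝓝 0))
    (hE : (⨆ ε ∈ Ioi (0 : ℝ), energy W ε (ρ ε)) < ⊤) :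
    liminf (fun ε => slopeEps W ε (ρ ε)) (𝓝[>] 0) ≥ slopeStar W ρ₀ := by
  refine le_of_forall_gt_imp_ge_of_dense fun c hc => ?_
  rcases eq_or_ne c ⊤ with rfl | hctop
  · exact le_top
  set L := c.toReal with hL
  have hcL : ENNReal.ofReal L = c := ENNReal.ofReal_toReal hctop
  set E := (⨆ ε ∈ Ioi (0 : ℝ), energy W ε (ρ ε)) with hEdef
  obtain ⟨R, hR, hprof⟩ := exists_profile hW (M := E.toReal) (L := L) ENNReal.toReal_nonneg
    ENNReal.toReal_nonneg
  have hfreq : ∃ᶠ ε in 𝓝[>] (0 : ℝ), slopeEps W ε (ρ ε) < c :=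
    frequently_lt_of_liminf_lt (by isBoundedDefault) hc
  have hne : (𝓝[>] (0 : ℝ) ⊓ 𝓟 {ε | slopeEps W ε (ρ ε) < c}).NeBot :=
    frequently_mem_iff_neBot.1 hfreq
  -- Limits along `𝒰` replace the extraction of subsequences.
  set 𝒰 := Ultrafilter.of (𝓝[>] (0 : ℝ) ⊓ 𝓟 {ε | slopeEps W ε (ρ ε) < c}) with h𝒰
  have hle : (𝒰 : Filter ℝ) ≤ 𝓝[>] 0 := (Ultrafilter.of_le _).trans inf_le_left
  have hslope : ∀ᶠ ε in (𝒰 : Filter ℝ), slopeEps W ε (ρ ε) < c :=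
    ((Ultrafilter.of_le _).trans inf_le_right) (mem_principal_self _)
  have hpos : ∀ᶠ ε in (𝒰 : Filter ℝ), 0 < ε := hle self_mem_nhdsWithin
  have hex : ∀ ε, ∃ (g : Torus → ℝ) (G : ℝ → ℝ), 0 < ε → slopeEps W ε (ρ ε) < c →
      (MemLp g 2 ∧ ∫ t in (0 : ℝ)..1, lift g t ^ 2 ≤ L ^ 2) ∧
      IsProfile W ε R (lift (ρ ε)) (deriv (lift (ρ ε))) G ∧ ∀ s t, s ≤ t →
        |G t - G s| ≤ √(∫ τ in s..t, lift (ρ ε) τ) * √(∫ τ in s..t, lift g τ ^ 2) := by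
    intro ε
    by_cases hε : 0 < ε ∧ slopeEps W ε (ρ ε) < c
    · obtain ⟨g, hg⟩ := iInf_lt_iff.1 hε.2
      obtain ⟨hga, hgc⟩ := iInf_lt_iff.1 hg
      have hgL : eLpNorm g 2 volume ≤ ENNReal.ofReal L := by rw [hcL]; exact hgc.le
      have hEε : energy W ε (ρ ε) ≤ ENNReal.ofReal E.toReal := by
        rw [ENNReal.ofReal_toReal hE.ne]
        exact le_iSup₂ (f := fun ε (_ : ε ∈ Ioi (0 : ℝ)) => energy W ε (ρ ε)) ε hε.1
      obtain ⟨G, hG⟩ := hprof ε (ρ ε) g hε.1 (hρ_nonneg ε hε.1) (hρ_mass ε hε.1) (hρ_C1 ε hε.1)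
        (hρ_C4 ε hε.1) hEε hga hgL
      exact ⟨g, G, fun _ _ => ⟨⟨hga.2.1, integral_sq_le ENNReal.toReal_nonneg hga.2.1 hgL⟩, hG⟩⟩
    · exact ⟨0, 0, fun h1 h2 => absurd ⟨h1, h2⟩ hε⟩
  choose g G hgG using hex
  have hall := hpos.and hslope
  have hfam : ProfileFamily W 𝒰 R L ρ g G :=
    { le_nhds := hle
      R_pos := hR
      L_nonneg := ENNReal.toReal_nonneg
      profile := hall.mono fun ε h => (hgG ε h.1 h.2).2.1
      memLp := hall.mono fun ε h => (hgG ε h.1 h.2).1.1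
      sq_le := hall.mono fun ε h => (hgG ε h.1 h.2).1.2
      flux := hall.mono fun ε h => (hgG ε h.1 h.2).2.2 }
  rw [← hcL]
  exact hfam.slopeStar_le hW (prokhorovTendsto_of_wasserstein2 (hρ_lim.mono_left hle))
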